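/- Let $\mathbb Z_3=\{1,\omega,\omega^2\}$ and $\Lambda=\mathbb Z[\mathbb Z_3]$. *The space $P^2$.* Let $Y_2$ be the space obtained from three closed unit discs $d_0,d_1,d_2\subset\mathbb C$ by gluing them along their common boundary circle $S^1$, with the $\mathbb Z_3$-action in which $\omega$ sends the point $z$ of $d_i$ to the point $e^{2\pi i/3}z$ of $d_{i+1}$ (indices mod $3$), and with base point $v_0=1\in S^1$. Put $Y_3=Y_2$. For $k\ge 3$, choose representatives $\gamma_j$ of a set of generators of $\pi_k(Y_k,v_0)$ and let $Y_{k+1}$ be obtained from $Y_k$ by attaching, for each $j$, three $(k+1)$-cells along $\gamma_j$, $\omega\cdot\gamma_j$, $\omega^2\cdot\gamma_j$; the $\mathbb Z_3$-action extends by permuting the new cells. Let $P^2=\bigcup_k Y_k$ with the weak topology. *Bredon cohomology.* Let $T^n=(S^1)^n$ with the diagonal action $\omega\cdot(z_1,\dots,z_n)=(e^{2\pi i/3}z_1,\dots,e^{2\pi i/3}z_n)$ and with the product CW structure in which $S^1$ has the vertices $v_j=e^{2\pi ij/3}$ and the edges from $v_j$ to $v_{j+1}$, $j\in\mathbb Z/3$.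 The action permutes the cells, so the cellular chain complex $C_\bullet(T^n)$ is a complex of $\Lambda$-modules. For a $\Lambda$-module $N$, let $H^d_{\mathbb Z_3}(T^n;N)$ be the $d$-th cohomology group of the cochain complex $\operatorname{Hom}_\Lambda(C_\bullet(T^n),N)$. **Proposition.** For all choices made in the construction of $P^2$, there is exactly one $\mathbb Z_3$-action by group automorphisms on $\pi_2(P^2,v_0)$ that is induced by the action on $P^2$, in the sense that $g\cdot[\gamma]=[\delta]$ if and only if $\delta$ is freely homotopic to $g\circ\gamma$, for all $g\in\mathbb Z_3$ and all $\gamma,\delta\colon(S^2,*)\to(P^2,v_0)$. With the resulting $\Lambda$-module structure on $\pi_2(P^2)=\pi_2(P^2,v_0)$, for all integers $n,d\ge 1$, $$H^d_{\mathbb Z_3}\bigl(T^n;\pi_2(P^2)\bigr)\;\cong\;\mathbb Z_3^{\binom{n-1}{d-1}}$$ as abelian groups. -/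

import Mathlib

open scoped unitInterval Topology Topology.Homotopy

noncomputable section

/-- The cyclic group `ℤ₃`, written multiplicatively. -/
abbrev Z3 : Type := Multiplicative (ZMod 3)

/-- The third root of unity `e^{2πij/3}` by which `ω^j ∈ ℤ₃` rotates the circle. -/
def rot : Z3 →* Circle := AddChar.toMonoidHom (ZMod.toCircle (N := 3))

/-! ### Cubical CW complexes with a cellular group action -/

/-- A CW structure on the `G`-space `X` whose `d`-cells have characteristic maps defined on the
cube `[0,1]^d`, such that each of the `2d` facets of a `d`-cell is (the characteristic map of) a
`(d-1)`-cell, and such that `G` permutes the cells, compatibly with the characteristic maps. -/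
structure CubicalGCW (G X : Type) [Group G] [TopologicalSpace X] [MulAction G X] where
  Cell : ℕ → Type
  [action : ∀ d, MulAction G (Cell d)]
  /-- the characteristic map of a cell -/
  char : ∀ {d : ℕ}, Cell d → (Fin d → I) → X
  continuous_char : ∀ {d : ℕ} (c : Cell d), Continuous (char c)
  /-- `face c i ε` is the facet `tᵢ = 0` (`ε = false`) or `tᵢ = 1` (`ε = true`) of `c` -/
  face : ∀ {d : ℕ}, Cell (d + 1) → Fin (d + 1) → Bool → Cell d
  char_face : ∀ {d : ℕ} (c : Cell (d + 1)) (i : Fin (d + 1)) (ε : Bool) (t : Fin d → I),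
    char (face c i ε) t = char c (i.insertNth (if ε then 1 else 0) t)
  /-- `X` is the union of the open cells -/
  cover : ∀ x : X, ∃ (d : ℕ) (c : Cell d) (t : Fin d → I), t ∉ Cube.boundary (Fin d) ∧ char c t = x
  /-- the open cells are pairwise disjoint, and characteristic maps are injective on them -/
  inj : ∀ {d d' : ℕ} (c : Cell d) (c' : Cell d') (t : Fin d → I) (t' : Fin d' → I),
    t ∉ Cube.boundary (Fin d) → t' ∉ Cube.boundary (Fin d') → char c t = char c' t' →
    (⟨d, c, t⟩ : Σ d, Cell d × (Fin d → I)) = ⟨d', c', t'⟩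
  /-- `X` carries the weak topology -/
  weak : ∀ A : Set X, (∀ (d : ℕ) (c : Cell d), IsClosed (char c ⁻¹' A)) → IsClosed A
  char_smul : ∀ {d : ℕ} (g : G) (c : Cell d) (t : Fin d → I), char (g • c) t = g • char c t
  face_smul : ∀ {d : ℕ} (g : G) (c : Cell (d + 1)) (i : Fin (d + 1)) (ε : Bool),
    face (g • c) i ε = g • face c i ε

attribute [instance] CubicalGCW.action

namespace CubicalGCW

variable {G X : Type} [Group G] [TopologicalSpace X] [MulAction G X] (K : CubicalGCW G X)

/-- The action of `G` on the cellular chains: the free abelian group on the `d`-cells, with `G`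
permuting the basis. -/
def chainRep (d : ℕ) : Representation ℤ G (K.Cell d →₀ ℤ) where
  toFun g := Finsupp.lmapDomain ℤ ℤ (g • ·)
  map_one' := by ext; simp
  map_mul' g h := by ext; simp [mul_smul]

/-- The cellular chain group `C_d(X)` as a module over the integral group ring `ℤ[G]`. -/
abbrev Chain (d : ℕ) : Type := (K.chainRep d).asModule

/-- The cellular boundary operator `C_{d+1}(X) → C_d(X)` as a homomorphism of abelian groups. -/
def boundaryZ (d : ℕ) : (K.Cell (d + 1) →₀ ℤ) →ₗ[ℤ] (K.Cell d →₀ ℤ) :=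
  Finsupp.linearCombination ℤ fun c =>
    ∑ i : Fin (d + 1), (-1 : ℤ) ^ (i : ℕ) •
      (Finsupp.single (K.face c i true) 1 - Finsupp.single (K.face c i false) 1)

theorem boundaryZ_comm (d : ℕ) (g : G) (x : K.Cell (d + 1) →₀ ℤ) :
    K.boundaryZ d (K.chainRep (d + 1) g x) = K.chainRep d g (K.boundaryZ d x) := by
  have : K.boundaryZ d ∘ₗ K.chainRep (d + 1) g = K.chainRep d g ∘ₗ K.boundaryZ d := by
    ext c : 2
    simp [boundaryZ, chainRep, K.face_smul, Finsupp.mapDomain_sub]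
  exact LinearMap.congr_fun this x

/-- The cellular boundary operator as a `ℤ[G]`-linear map. -/
def boundary (d : ℕ) : K.Chain (d + 1) →ₗ[MonoidAlgebra ℤ G] K.Chain d :=
  Representation.IntertwiningMap.equivLinearMapAsModule (K.chainRep (d + 1)) (K.chainRep d)
    (LinearMap.intertwiningMap_of_isIntertwiningMap _ _ (K.boundaryZ d) (K.boundaryZ_comm d))

variable {V : Type} [AddCommGroup V] (ρ : Representation ℤ G V)

/-- The Bredon cochain group `Hom_{ℤ[G]}(C_d(X), N)` with coefficients in the `ℤ[G]`-module `N`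
given by an abelian group `V` with a `G`-action `ρ`. -/
abbrev Cochain (d : ℕ) : Type := K.Chain d →ₗ[MonoidAlgebra ℤ G] ρ.asModule

/-- The coboundary operator `f ↦ f ∘ ∂`. -/
def coboundary (d : ℕ) : K.Cochain ρ d →+ K.Cochain ρ (d + 1) where
  toFun f := f ∘ₗ K.boundary d
  map_zero' := LinearMap.zero_comp _
  map_add' f g := LinearMap.add_comp _ g f

/-- The image of the incoming coboundary operator in degree `d` (zero for `d = 0`). -/
def coboundaries : (d : ℕ) → AddSubgroup (K.Cochain ρ d)
  | 0 => ⊥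
  | d + 1 => (K.coboundary ρ d).range

/-- The Bredon cohomology group `H^d_G(X; N)`. -/
abbrev BredonCohomology (d : ℕ) : Type :=
  (K.coboundary ρ d).ker ⧸ (K.coboundaries ρ d).addSubgroupOf (K.coboundary ρ d).ker

end CubicalGCW

/-! ### The torus with the diagonal action -/

/-- The torus `T^n = (S¹)^n`. -/
abbrev Torus (n : ℕ) : Type := Fin n → Circle

/-- `ℤ₃` acts on the torus diagonally, `ω` multiplying every coordinate by `e^{2πi/3}`. -/
instance torusAction (n : ℕ) : MulAction Z3 (Torus n) where
  smul g z := fun k => rot g * z k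
  one_smul z := by funext k; change rot 1 * z k = z k; simp
  mul_smul g h z := by
    funext k; change rot (g * h) * z k = rot g * (rot h * z k); rw [map_mul, mul_assoc]

/-- The `d`-cells of the product CW structure on `T^n`, where the circle has three vertices
`v_j = e^{2πij/3}` and three edges `e_j` running counterclockwise from `v_j` to `v_{j+1}`: the pair
`(s, p)` is the product whose `k`-th factor is `e_{p k}` if `k` is in the range of `s`, and
`v_{p k}` otherwise. -/
@[ext]
structure TorusCell (n d : ℕ) where
  dir : Fin d ↪o Fin n
  pos : Fin n → ZMod 3

namespace TorusCell

variable {n d : ℕ}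

instance : MulAction Z3 (TorusCell n d) where
  smul g c := ⟨c.dir, fun k => Multiplicative.toAdd g + c.pos k⟩
  one_smul c := by
    ext : 1
    · rfl
    · funext k; exact zero_add _
  mul_smul g h c := by
    ext : 1
    · rfl
    · funext k; exact add_assoc _ _ _

/-- The characteristic map of a cell. -/
def char (c : TorusCell n d) (t : Fin d → I) : Torus n := fun k =>
  ZMod.toCircle (c.pos k) *
    Circle.exp (2 * Real.pi / 3 * ∑ i : Fin d, if c.dir i = k then (t i : ℝ) else 0)

/-- The facets of a cell: an edge factor `e_j` is replaced by `v_j` or by `v_{j+1}`. -/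
def face (c : TorusCell n (d + 1)) (i : Fin (d + 1)) (ε : Bool) : TorusCell n d where
  dir := (Fin.succAboveOrderEmb i).trans c.dir
  pos := c.pos + if ε then Pi.single (c.dir i) 1 else 0

theorem char_apply_dir (c : TorusCell n d) (t : Fin d → I) (i : Fin d) :
    c.char t (c.dir i) = ZMod.toCircle (c.pos (c.dir i)) * Circle.exp (2 * Real.pi / 3 * t i) := by
  simp [char]

theorem char_apply_of_notMem (c : TorusCell n d) (t : Fin d → I) (k : Fin n)
    (hk : k ∉ Set.range c.dir) : c.char t k = ZMod.toCircle (c.pos k) := by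
  have : ∀ i, c.dir i ≠ k := fun i h => hk ⟨i, h⟩
  simp [char, this]

theorem toCircle_int (m : ℤ) :
    ZMod.toCircle (m : ZMod 3) = Circle.exp (2 * Real.pi / 3 * m) := by
  ext
  rw [ZMod.toCircle_intCast, Circle.coe_exp]
  congr 1
  push_cast
  ring

/-- Every point of the circle is `e^{2πi(j+x)/3}` for a unique `j ∈ ℤ₃` and `x ∈ [0,1)`. -/
theorem exists_arc (z : Circle) : ∃ (j : ZMod 3) (x : ℝ), 0 ≤ x ∧ x < 1 ∧
    z = ZMod.toCircle j * Circle.exp (2 * Real.pi / 3 * x) := by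
  have hpi := Real.pi_ne_zero
  refine ⟨(⌊3 * Complex.arg z / (2 * Real.pi)⌋ : ℤ), Int.fract (3 * Complex.arg z / (2 * Real.pi)),
    Int.fract_nonneg _, Int.fract_lt_one _, ?_⟩
  rw [toCircle_int, ← Circle.exp_add, ← mul_add, Int.floor_add_fract]
  conv_lhs => rw [← Circle.exp_arg z]
  congr 1
  field_simp

theorem arc_unique (j j' : ZMod 3) (x x' : ℝ) (hx : 0 ≤ x) (hx1 : x < 1) (hx' : 0 ≤ x')
    (hx1' : x' < 1) (h : ZMod.toCircle j * Circle.exp (2 * Real.pi / 3 * x) =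
      ZMod.toCircle j' * Circle.exp (2 * Real.pi / 3 * x')) : j = j' ∧ x = x' := by
  obtain ⟨a, rfl⟩ := ZMod.intCast_surjective j
  obtain ⟨b, rfl⟩ := ZMod.intCast_surjective j'
  rw [toCircle_int, toCircle_int, ← Circle.exp_add, ← Circle.exp_add, Circle.exp_eq_exp] at h
  obtain ⟨m, hm⟩ := h
  have hpi := Real.pi_ne_zero
  have h1 : (a : ℝ) + x = ((b + 3 * m : ℤ) : ℝ) + x' := by
    push_cast
    field_simp at hm
    linarith
  have h2 : a = b + 3 * m := by
    have e1 : ⌊(a : ℝ) + x⌋ = a := by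
      rw [Int.floor_intCast_add, Int.floor_eq_zero_iff.2 ⟨hx, hx1⟩, add_zero]
    have e2 : ⌊((b + 3 * m : ℤ) : ℝ) + x'⌋ = b + 3 * m := by
      rw [Int.floor_intCast_add, Int.floor_eq_zero_iff.2 ⟨hx', hx1'⟩, add_zero]
    rw [← e1, h1, e2]
  subst h2
  refine ⟨?_, by linarith⟩
  have h3 : (3 : ZMod 3) = 0 := rfl
  push_cast
  rw [h3, zero_mul, add_zero]

theorem notMem_boundary {t : Fin d → I} :
    t ∉ Cube.boundary (Fin d) ↔ ∀ i, (0 : ℝ) < t i ∧ (t i : ℝ) < 1 := by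
  simp only [Cube.boundary, Set.mem_ofPred_eq, not_exists, not_or]
  refine forall_congr' fun i => ?_
  exact and_congr unitInterval.pos_iff_ne_zero.symm unitInterval.lt_one_iff_ne_one.symm

theorem char_face (c : TorusCell n (d + 1)) (i : Fin (d + 1)) (ε : Bool) (t : Fin d → I) :
    (c.face i ε).char t = c.char (i.insertNth (if ε then 1 else 0) t) := by
  funext k
  simp only [char, face, Fin.sum_univ_succAbove _ i, Fin.insertNth_apply_same,
    Fin.insertNth_apply_succAbove, RelEmbedding.coe_trans, Function.comp_apply,
    Fin.succAboveOrderEmb_apply, Pi.add_apply, mul_add, Circle.exp_add, AddChar.map_add_eq_mul,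
    mul_assoc]
  congr 2
  cases ε
  · simp
  · by_cases hk : c.dir i = k
    · subst hk
      simpa using toCircle_int 1
    · simp [hk, Ne.symm hk]

theorem cover (z : Torus n) : ∃ (d : ℕ) (c : TorusCell n d) (t : Fin d → I),
    t ∉ Cube.boundary (Fin d) ∧ c.char t = z := by
  choose j x h0 h1 hz using fun k => exists_arc (z k)
  let S : Finset (Fin n) := Finset.univ.filter fun k => x k ≠ 0
  let c : TorusCell n S.card := ⟨S.orderEmbOfFin rfl, j⟩
  let t : Fin S.card → I := fun i => ⟨x (c.dir i), h0 _, (h1 _).le⟩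
  refine ⟨S.card, c, t, notMem_boundary.2 fun i => ⟨?_, h1 _⟩, ?_⟩
  · have : c.dir i ∈ S := Finset.orderEmbOfFin_mem S rfl i
    exact lt_of_le_of_ne (h0 _) (Ne.symm (Finset.mem_filter.1 this).2)
  · funext k
    by_cases hk : k ∈ Set.range c.dir
    · obtain ⟨i, rfl⟩ := hk
      rw [char_apply_dir, hz]
    · rw [char_apply_of_notMem _ _ _ hk, hz]
      have hS : k ∉ S := by
        rw [← Finset.mem_coe, ← Finset.range_orderEmbOfFin S rfl]
        exact hk
      have : x k = 0 := by simpa [S] using hS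
      simp [this, c]

theorem inj {d' : ℕ} (c : TorusCell n d) (c' : TorusCell n d') (t : Fin d → I) (t' : Fin d' → I)
    (ht : t ∉ Cube.boundary (Fin d)) (ht' : t' ∉ Cube.boundary (Fin d'))
    (h : c.char t = c'.char t') :
    (⟨d, c, t⟩ : Σ d, TorusCell n d × (Fin d → I)) = ⟨d', c', t'⟩ := by
  rw [notMem_boundary] at ht ht'
  have key : ∀ {d : ℕ} (c : TorusCell n d) (t : Fin d → I),
      (∀ i, (0 : ℝ) < t i ∧ (t i : ℝ) < 1) → ∀ k, ∃ x : ℝ, 0 ≤ x ∧ x < 1 ∧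
        c.char t k = ZMod.toCircle (c.pos k) * Circle.exp (2 * Real.pi / 3 * x) ∧
        (k ∈ Set.range c.dir ↔ x ≠ 0) ∧ ∀ i, c.dir i = k → (t i : ℝ) = x := by
    intro d c t ht k
    by_cases hk : k ∈ Set.range c.dir
    · obtain ⟨i, rfl⟩ := hk
      refine ⟨t i, (ht i).1.le, (ht i).2, char_apply_dir c t i, ?_, ?_⟩
      · simp [(ht i).1.ne']
      · intro i' hi
        rw [c.dir.injective hi]
    · refine ⟨0, le_rfl, zero_lt_one, ?_, by simpa using hk, fun i hi => (hk ⟨i, hi⟩).elim⟩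
      simp [char_apply_of_notMem _ _ _ hk]
  choose x hx0 hx1 hx hxr hxt using key c t ht
  choose x' hx0' hx1' hx' hxr' hxt' using key c' t' ht'
  have heq : ∀ k, c.pos k = c'.pos k ∧ x k = x' k := fun k =>
    arc_unique _ _ _ _ (hx0 k) (hx1 k) (hx0' k) (hx1' k) (by rw [← hx, ← hx', h])
  have hr : Set.range c.dir = Set.range c'.dir := by
    ext k
    rw [hxr, hxr', (heq k).2]
  have hd : d = d' := by
    have h1 := Set.ncard_range_of_injective c.dir.injective
    have h2 := Set.ncard_range_of_injective c'.dir.injective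
    rw [hr, h2] at h1
    simpa using h1.symm
  subst hd
  have hdir : c.dir = c'.dir := by
    refine DFunLike.coe_injective ?_
    exact (StrictMono.range_inj c.dir.strictMono c'.dir.strictMono).1 hr
  have hc : c = c' := TorusCell.ext hdir (funext fun k => (heq k).1)
  subst hc
  have htt : t = t' := by
    funext i
    refine Subtype.ext ?_
    rw [hxt _ i rfl, hxt' _ i rfl, (heq _).2]
  subst htt
  rfl

theorem continuous_char (c : TorusCell n d) : Continuous c.char := by
  unfold char
  refine continuous_pi fun k => continuous_const.mul (Circle.exp.continuous.comp ?_)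
  refine continuous_const.mul (continuous_finsetSum _ fun i _ => ?_)
  split_ifs <;> fun_prop

theorem weak (A : Set (Torus n))
    (hA : ∀ (d : ℕ) (c : TorusCell n d), IsClosed (c.char ⁻¹' A)) : IsClosed A := by
  have : A = ⋃ x : Σ d : Fin (n + 1), (Fin d ↪o Fin n) × (Fin n → ZMod 3),
      TorusCell.char ⟨x.2.1, x.2.2⟩ '' (TorusCell.char ⟨x.2.1, x.2.2⟩ ⁻¹' A) := by
    refine Set.Subset.antisymm (fun z hz => ?_)
      (Set.iUnion_subset fun x => Set.image_preimage_subset _ _)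
    obtain ⟨d, c, t, -, rfl⟩ := cover z
    have hd : d ≤ n := by simpa using Fintype.card_le_of_injective _ c.dir.injective
    exact Set.mem_iUnion.2 ⟨⟨⟨d, Nat.lt_succ_of_le hd⟩, c.dir, c.pos⟩, t, hz, rfl⟩
  rw [this]
  have : ∀ d : ℕ, Finite (Fin d ↪o Fin n) := fun d =>
    Finite.of_injective (fun s : Fin d ↪o Fin n => (s : Fin d → Fin n)) DFunLike.coe_injective
  exact isClosed_iUnion_of_finite fun x =>
    ((hA _ _).isCompact.image (continuous_char _)).isClosed

end TorusCell

/-- The product CW structure on the torus. -/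
def torusCW (n : ℕ) : CubicalGCW Z3 (Torus n) where
  Cell := TorusCell n
  char := TorusCell.char
  continuous_char := TorusCell.continuous_char
  face := TorusCell.face
  char_face := TorusCell.char_face
  cover := TorusCell.cover
  inj := TorusCell.inj
  weak := TorusCell.weak
  char_smul g c t := by
    funext k
    change ZMod.toCircle (Multiplicative.toAdd g + c.pos k) * _ = rot g * (_ * _)
    rw [AddChar.map_add_eq_mul, mul_assoc]
    rfl
  face_smul g c i ε := by
    refine TorusCell.ext rfl (funext fun k => ?_)
    exact add_assoc _ _ _

/-! ### The space `P²` -/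

/-- A pointed topological space with an action of `G` by homeomorphisms. -/
structure PointedGSpace (G : Type) [Group G] where
  carrier : Type
  [top : TopologicalSpace carrier]
  [act : MulAction G carrier]
  [cont : ContinuousConstSMul G carrier]
  base : carrier

attribute [instance] PointedGSpace.top PointedGSpace.act PointedGSpace.cont

instance (G : Type) [Group G] : CoeSort (PointedGSpace G) Type := ⟨PointedGSpace.carrier⟩

namespace Y2

/-- Two points of the disjoint union of three closed unit discs are identified if they are the
same point of the boundary circle. -/
inductive Glue : (Σ _ : ZMod 3, Metric.closedBall (0 : ℂ) 1) →
    (Σ _ : ZMod 3, Metric.closedBall (0 : ℂ) 1) → Prop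
  | mk (i j : ZMod 3) (z : Metric.closedBall (0 : ℂ) 1) (hz : ‖(z : ℂ)‖ = 1) : Glue ⟨i, z⟩ ⟨j, z⟩

/-- Three discs glued along their common boundary circle. -/
def Carrier : Type := Quot Glue

instance : TopologicalSpace Carrier := inferInstanceAs (TopologicalSpace (Quot Glue))

/-- Rotation of the closed unit disc. -/
def rotDisc (g : Z3) (z : Metric.closedBall (0 : ℂ) 1) : Metric.closedBall (0 : ℂ) 1 :=
  ⟨(rot g : ℂ) * z, by
    have h := z.2
    rw [mem_closedBall_zero_iff] at h ⊢
    rwa [norm_mul, Circle.norm_coe, one_mul]⟩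

/-- `ω` maps the `i`-th disc to the `(i+1)`-st one, rotating it by `2π/3`. -/
def actDiscs (g : Z3) (x : Σ _ : ZMod 3, Metric.closedBall (0 : ℂ) 1) :
    Σ _ : ZMod 3, Metric.closedBall (0 : ℂ) 1 :=
  ⟨Multiplicative.toAdd g + x.1, rotDisc g x.2⟩

instance : MulAction Z3 Carrier where
  smul g := Quot.map (actDiscs g) (by
    rintro _ _ ⟨i, j, z, hz⟩
    exact Glue.mk _ _ _ (by simpa only [rotDisc, norm_mul, Circle.norm_coe, one_mul] using hz))
  one_smul := by
    rintro ⟨i, z⟩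
    refine congrArg (Quot.mk Glue) (Sigma.ext (zero_add i) (heq_of_eq (Subtype.ext ?_)))
    simp [actDiscs, rotDisc]
  mul_smul := by
    rintro g h ⟨i, z⟩
    refine congrArg (Quot.mk Glue) (Sigma.ext (add_assoc _ _ i) (heq_of_eq (Subtype.ext ?_)))
    simp [actDiscs, rotDisc, mul_assoc]

instance : ContinuousConstSMul Z3 Carrier where
  continuous_const_smul g := by
    refine continuous_quot_lift _ (continuous_quot_mk.comp ?_)
    refine continuous_sigma fun i => continuous_sigmaMk.comp ?_
    exact Continuous.subtype_mk (by fun_prop) _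

end Y2

/-- The 2-dimensional complex `Y₂`: three discs `d₀, d₁, d₂` glued to the circle `S¹`, with the free
action rotating the circle by `2π/3` and exchanging the discs cyclically; the base point is the
vertex `v₀ = 1 ∈ S¹`. -/
def Y2 : PointedGSpace Z3 where
  carrier := Y2.Carrier
  base := Quot.mk _ ⟨0, ⟨1, by simp⟩⟩

section Attach

variable {G : Type} [Group G]

/-- The class of a generalized loop in the homotopy group. -/
def piClass {n : ℕ} {X : Type} [TopologicalSpace X] {x : X} (γ : Ω^ (Fin n) X x) : π_ n X x :=
  Quotient.mk _ γ

/-- A family of representatives of a set of generators of the homotopy group `π_{k+1}(Y)`. -/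
structure GeneratingFamily (k : ℕ) (Y : PointedGSpace G) where
  J : Type
  loop : J → Ω^ (Fin (k + 1)) Y Y.base
  generates : Subgroup.closure (Set.range fun j => piClass (loop j)) = ⊤

/-- The map `∂[0,1]^{k+1} → Y` that represents the element `[γ]` of `π_k(Y, y)`: it is `γ` on the
facet `t₀ = 0` and constant on all the other facets. -/
def sphereMap {Y : Type} [TopologicalSpace Y] {y : Y} {k : ℕ} (γ : Ω^ (Fin k) Y y) :
    C(Cube.boundary (Fin (k + 1)), Y) where
  toFun b := if b.1 0 = 0 then γ (Fin.tail b.1) else y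
  continuous_toFun := by
    have hco : ∀ i, Continuous fun b : Cube.boundary (Fin (k + 1)) => b.1 i := fun i =>
      (continuous_apply i).comp continuous_subtype_val
    refine Continuous.if ?_ (γ.1.continuous.comp ?_) continuous_const
    · intro b hb
      refine γ.2 _ ?_
      have h1 : b ∈ closure {b : Cube.boundary (Fin (k + 1)) | ¬ b.1 0 = 0} :=
        frontier_subset_closure (by rwa [← frontier_compl] at hb)
      have h0 : b.1 0 = 0 := by
        have hc : IsClosed {b : Cube.boundary (Fin (k + 1)) | b.1 0 = 0} :=
          isClosed_eq (hco _) continuous_const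
        exact hc.frontier_subset hb
      have hC : IsClosed {b : Cube.boundary (Fin (k + 1)) |
          b.1 0 = 1 ∨ Fin.tail b.1 ∈ Cube.boundary (Fin k)} := by
        have : {b : Cube.boundary (Fin (k + 1)) |
            b.1 0 = 1 ∨ Fin.tail b.1 ∈ Cube.boundary (Fin k)} =
            {b | b.1 0 = 1} ∪ ⋃ i : Fin k, ({b | b.1 i.succ = 0} ∪ {b | b.1 i.succ = 1}) := by
          ext b
          simp only [Set.mem_union, Set.mem_iUnion]
          rfl
        rw [this]
        refine (isClosed_eq (hco _) continuous_const).union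
          (isClosed_iUnion_of_finite fun i => ?_)
        exact (isClosed_eq (hco _) continuous_const).union
          (isClosed_eq (hco _) continuous_const)
      have h2 := closure_minimal (fun (b : Cube.boundary (Fin (k + 1))) (hb : ¬ b.1 0 = 0) => by
        obtain ⟨i, hi⟩ := b.2
        refine Fin.cases (fun hi => ?_) (fun i hi => ?_) i hi
        · exact Or.inl (hi.resolve_left hb)
        · exact Or.inr ⟨i, hi⟩) hC h1
      refine h2.resolve_left fun h => ?_
      rw [h0] at h
      exact zero_ne_one h
    · exact continuous_pi fun i => hco i.succ

/-- `(k+2)`-cells `[0,1]^{k+2}`, one for each `g ∈ G` and each member `γ` of the family, are attached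
to `Y` along the maps `g • γ`. -/
inductive AttachRel {k : ℕ} {Y : PointedGSpace G} (F : GeneratingFamily k Y) :
    (Y ⊕ Σ _ : G × F.J, (Fin (k + 2) → I)) → (Y ⊕ Σ _ : G × F.J, (Fin (k + 2) → I)) → Prop
  | mk (g : G) (j : F.J) (b : Cube.boundary (Fin (k + 2))) :
      AttachRel F (Sum.inr ⟨(g, j), b⟩) (Sum.inl (g • sphereMap (F.loop j) b))

/-- The underlying space of the result of attaching the cells. -/
def AttachCarrier {k : ℕ} {Y : PointedGSpace G} (F : GeneratingFamily k Y) : Type :=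
  Quot (AttachRel F)

namespace AttachCarrier

variable {k : ℕ} {Y : PointedGSpace G} (F : GeneratingFamily k Y)

instance : TopologicalSpace (AttachCarrier F) := inferInstanceAs (TopologicalSpace (Quot _))

/-- `G` acts on `Y` as before and permutes the new cells. -/
def act (g : G) : (Y ⊕ Σ _ : G × F.J, (Fin (k + 2) → I)) → Y ⊕ Σ _ : G × F.J, (Fin (k + 2) → I) :=
  Sum.map (g • ·) fun x => ⟨(g * x.1.1, x.1.2), x.2⟩

instance : MulAction G (AttachCarrier F) where
  smul g := Quot.map (act F g) (by
    rintro _ _ ⟨h, j, b⟩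
    simpa [act, mul_smul] using AttachRel.mk (F := F) (g * h) j b)
  one_smul := by
    rintro ⟨y | ⟨⟨h, j⟩, t⟩⟩
    · exact congrArg (Quot.mk _) (congrArg Sum.inl (one_smul G y))
    · exact congrArg (Quot.mk _) (by simp [act])
  mul_smul := by
    rintro g g' ⟨y | ⟨⟨h, j⟩, t⟩⟩
    · exact congrArg (Quot.mk _) (congrArg Sum.inl (mul_smul g g' y))
    · exact congrArg (Quot.mk _) (by simp [act, mul_assoc])

instance : ContinuousConstSMul G (AttachCarrier F) where
  continuous_const_smul g := by
    refine continuous_quot_lift _ (continuous_quot_mk.comp ?_)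
    refine Continuous.sumMap (continuous_const_smul g) ?_
    refine continuous_sigma fun i => ?_
    change Continuous (Sigma.mk (β := fun _ : G × F.J => Fin (k + 2) → I) (g * i.1, i.2))
    exact continuous_sigmaMk

end AttachCarrier

/-- The `G`-space obtained from `Y` by attaching an orbit of `(k+2)`-cells for each member of a
family of generators of `π_{k+1}(Y)`. -/
def attach {k : ℕ} {Y : PointedGSpace G} (F : GeneratingFamily k Y) : PointedGSpace G where
  carrier := AttachCarrier F
  base := Quot.mk _ (Sum.inl Y.base)

end Attach

/-- The choices in the construction of `P²`: representatives of generators of `π_k(Y_k)` for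
`k = m + 3 ≥ 3`. -/
abbrev P2Choice : Type 1 := ∀ (m : ℕ) (Y : PointedGSpace Z3), GeneratingFamily (m + 2) Y

/-- Choices exist: all elements form a generating set. -/
instance : Nonempty P2Choice :=
  ⟨fun m Y => ⟨Ω^ (Fin (m + 3)) Y Y.base, id, by
    rw [eq_top_iff]
    rintro x -
    induction x using Quotient.inductionOn with
    | h γ => exact Subgroup.subset_closure ⟨γ, rfl⟩⟩⟩

namespace P2

/-- The spaces of the construction, `stage c m = Y_{m+3}`: it starts with `Y₃ = Y₂`, and `Y_{k+1}`
arises from `Y_k` by attaching orbits of `(k+1)`-cells along generators of `π_k(Y_k)`. -/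
def stage (c : P2Choice) : ℕ → PointedGSpace Z3
  | 0 => Y2
  | m + 1 => attach (c m (stage c m))

/-- The inclusion of one stage in the next. -/
def incl (c : P2Choice) (m : ℕ) (y : stage c m) : stage c (m + 1) := Quot.mk _ (Sum.inl y)

/-- A point is identified with its image in the next stage. -/
inductive UnionRel (c : P2Choice) : (Σ m, stage c m) → (Σ m, stage c m) → Prop
  | mk (m : ℕ) (y : stage c m) : UnionRel c ⟨m, y⟩ ⟨m + 1, incl c m y⟩

/-- The union of all the stages, with the weak topology. -/
def Carrier (c : P2Choice) : Type := Quot (UnionRel c)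

instance (c : P2Choice) : TopologicalSpace (Carrier c) := inferInstanceAs (TopologicalSpace (Quot _))

instance (c : P2Choice) : MulAction Z3 (Carrier c) where
  smul g := Quot.map (Sigma.map id fun _ y => g • y) (by
    rintro _ _ ⟨m, y⟩
    exact UnionRel.mk m (g • y))
  one_smul := by
    rintro ⟨m, y⟩
    exact congrArg (Quot.mk _) (congrArg (Sigma.mk m) (one_smul Z3 y))
  mul_smul := by
    rintro g h ⟨m, y⟩
    exact congrArg (Quot.mk _) (congrArg (Sigma.mk m) (mul_smul g h y))

instance (c : P2Choice) : ContinuousConstSMul Z3 (Carrier c) where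
  continuous_const_smul g := by
    refine continuous_quot_lift _ (continuous_quot_mk.comp ?_)
    exact continuous_sigma fun m => continuous_sigmaMk.comp (continuous_const_smul g)

end P2

/-- The `ℤ₃`-space `P²`. -/
def P2 (c : P2Choice) : PointedGSpace Z3 where
  carrier := P2.Carrier c
  base := Quot.mk _ ⟨0, Y2.base⟩

/-! ### The action on the second homotopy group -/

/-- Free homotopy of 2-spheres, i.e. of maps `[0,1]² → X` that are constant on the boundary of the
square: a homotopy that is constant on the boundary at every time. -/
def FreelyHomotopic {X : Type} [TopologicalSpace X] (f f' : (Fin 2 → I) → X) : Prop :=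
  ∃ F : C(I × (Fin 2 → I), X), (∀ t, F (0, t) = f t) ∧ (∀ t, F (1, t) = f' t) ∧
    ∀ s, ∀ b ∈ Cube.boundary (Fin 2), ∀ b' ∈ Cube.boundary (Fin 2), F (s, b) = F (s, b')

/-- The action `ρ` of `G` on the abelian group `π₂(X, x)` is the one induced by the action on `X`:
`ρ(g)[γ]` is the class of those spheres based at `x` that are freely homotopic to `g • γ` (which is
based at `g • x`). -/
def IsInducedAction {G : Type} [Group G] (X : PointedGSpace G)
    (ρ : Representation ℤ G (Additive (π_ 2 X X.base))) : Prop :=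
  ∀ (g : G) (γ δ : Ω^ (Fin 2) X X.base),
    ρ g (Additive.ofMul (piClass γ)) = Additive.ofMul (piClass δ) ↔
      FreelyHomotopic (fun t => g • γ t) δ

end

/-! The argument has a topological half, which computes `π₂(P²)` with its action, and an algebraic
half, which computes the cohomology.

Topology. The cells added to `Y₂` have dimension at least `4`, while a homotopy of spheres has a
three-dimensional domain. Such a homotopy can be pushed off the centres of the cells and then
radially out of them (`AttachCarrier.exists_compression`, `P2.exists_compression`), so spheres and
their free homotopies may be studied in `Y₂`. There a sphere has a degree over each of the three
discs: collapsing the other two discs maps `Y₂` to the projective line, and the degree is the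
winding number that the pulled-back tautological line bundle shows on the boundary of the square
(`Y2.Deg`). These degrees are invariant under free homotopy, additive, and permuted by the group
(`Y2.exists_deg`, `Y2.Deg.transAt`, `Y2.Deg.smul`). They determine the class: triples in `ℂ³` with
at most one zero coordinate serve as homogeneous coordinates on `Y₂`, their three entries being
sections of the three line bundles. A sphere with vanishing degrees lifts to such triples, and since
only the coordinate axes, of real codimension `4`, are removed from `ℂ³`, the lift contracts by
general position (`Y2.homotopic_const`). Explicit spheres of degrees `(1, -1, 0)` and `(0, 1, -1)`
then identify `π₂` with the module `N` of integer triples of sum zero, permuted cyclically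
(`Y2.exists_equiv`, `P2.exists_equiv`).

Algebra. Let `T` be the generator acting on `N`. Then `T - 1` is injective on `N` with cokernel
`ℤ/3`. Bredon cochains of the torus are the Koszul complex of the `n` difference operators `δᵢ` on
equivariant functions `(ℤ/3)ⁿ → N`. The diagonal translation `∏ (1 + δᵢ)` acts as `T`. On the Koszul
complex of the operators other than `δ₀`, the product of their `1 + δᵢ` is homotopic to the identity
(`KX.exists_homotopy`), so `T - 1` is homotopic to `δ₀` there, and the whole complex, the cone of
`δ₀`, may be replaced by the cone of `T - 1`. Its cohomology in degree `d` is that of the cokernel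
in degree `d - 1`, and the cokernel is the ordinary cochain complex of the `(n - 1)`-torus with
coefficients `N / (T - 1) = ℤ/3` (`nonempty_H_eqFun`). That cohomology has binomial rank by Pascal's
rule (`nonempty_H_torus`). -/

/-! ### Cochain complexes of abelian groups -/

/-- A sequence of abelian groups and homomorphisms, indexed by the natural numbers. -/
structure NComplex where
  X : ℕ → Type
  [grp : ∀ k, AddCommGroup (X k)]
  d : ∀ k, X k →+ X (k + 1)

attribute [instance] NComplex.grp

/-- The sequence of types `X` shifted by one, starting with the trivial group. -/
def Prev (X : ℕ → Type) : ℕ → Type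
  | 0 => PUnit
  | k + 1 => X k

instance Prev.instAddCommGroup (X : ℕ → Type) [h : ∀ k, AddCommGroup (X k)] :
    ∀ k, AddCommGroup (Prev X k)
  | 0 => inferInstanceAs (AddCommGroup PUnit)
  | k + 1 => h k

/-- The identification of the shifted sequence in degree `k + 1`. -/
abbrev unprev {X : ℕ → Type} {k : ℕ} (x : Prev X (k + 1)) : X k := x

/-- The identification of the shifted sequence in degree `k + 1`, as a homomorphism. -/
def unprevHom {X : ℕ → Type} [∀ k, AddCommGroup (X k)] (k : ℕ) : Prev X (k + 1) →+ X k :=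
  AddMonoidHom.id (X k)

/-- The shift of a sequence of homomorphisms. -/
def Prev.map {X Y : ℕ → Type} [∀ k, AddCommGroup (X k)] [∀ k, AddCommGroup (Y k)]
    (f : ∀ k, X k →+ Y k) : ∀ k, Prev X k →+ Prev Y k
  | 0 => 0
  | k + 1 => f k

namespace NComplex

variable (C D : NComplex)

/-- The differential with values in degree `k`. -/
def prevD : ∀ k, Prev C.X k →+ C.X k
  | 0 => 0
  | k + 1 => C.d k

/-- The complex shifted by one degree. -/
def shift : NComplex where
  X := Prev C.X
  d k := C.prevD k

/-- Cohomology. -/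
abbrev H (k : ℕ) : Type := (C.d k).ker ⧸ (C.prevD k).range.addSubgroupOf (C.d k).ker

/-- The mapping cone of an endomorphism. -/
def cone (f : ∀ k, C.X k →+ C.X k) : NComplex where
  X k := C.X k × Prev C.X k
  -- The minus sign on the second summand makes the square vanish when `f` is a chain map.
  d k := ((C.d k).comp (AddMonoidHom.fst _ _)).prod
    (show C.X k × Prev C.X k →+ C.X k from
      (f k).comp (AddMonoidHom.fst _ _) - (C.prevD k).comp (AddMonoidHom.snd _ _))

/-- The square of the differential vanishes. -/
def IsComplex : Prop := ∀ k x, C.d (k + 1) (C.d k x) = 0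

variable {C D}

theorem IsComplex.d_prevD (h : C.IsComplex) : ∀ k x, C.d k (C.prevD k x) = 0
  | 0, _ => map_zero _
  | k + 1, x => h k x

theorem map_prevD (f : ∀ k, C.X k →+ D.X k) (hf : ∀ k x, f (k + 1) (C.d k x) = D.d k (f k x)) :
    ∀ k x, f k (C.prevD k x) = D.prevD k (Prev.map f k x)
  | 0, _ => map_zero _
  | k + 1, x => hf k x

theorem _root_.Prev.map_surjective {X Y : ℕ → Type} [∀ k, AddCommGroup (X k)]
    [∀ k, AddCommGroup (Y k)] (f : ∀ k, X k →+ Y k) (hf : ∀ k, Function.Surjective (f k)) :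
    ∀ k, Function.Surjective (Prev.map f k)
  | 0 => fun _ => ⟨0, rfl⟩
  | k + 1 => hf k

/-- A surjective chain map with acyclic kernel induces isomorphisms in cohomology. -/
theorem nonempty_H_equiv_of_surjective (hC : C.IsComplex) (f : ∀ k, C.X k →+ D.X k)
    (hf : ∀ k x, f (k + 1) (C.d k x) = D.d k (f k x)) (hs : ∀ k, Function.Surjective (f k))
    (ha : ∀ k x, f k x = 0 → C.d k x = 0 → ∃ y, Prev.map f k y = 0 ∧ C.prevD k y = x) (k : ℕ) :
    Nonempty (C.H k ≃+ D.H k) := by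
  let g : (C.d k).ker →+ (D.d k).ker :=
    ((f k).comp (C.d k).ker.subtype).codRestrict _ (fun x => by
      have := x.2
      rw [AddMonoidHom.mem_ker] at this ⊢
      simp [← hf, this])
  let φ : (C.d k).ker →+ D.H k := (QuotientAddGroup.mk' _).comp g
  have hφs : Function.Surjective φ := by
    intro w
    obtain ⟨⟨w, hw⟩, rfl⟩ := QuotientAddGroup.mk_surjective w
    obtain ⟨c, rfl⟩ := hs k w
    -- A lift of a cocycle need not be a cocycle, but its differential is a cocycle of the acyclic
    -- kernel, so the lift can be corrected inside the kernel.
    obtain ⟨y, hy, hy'⟩ := ha (k + 1) (C.d k c) (by rw [hf]; exact hw) (hC _ _)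
    refine ⟨⟨c - unprev y, ?_⟩, ?_⟩
    · rw [AddMonoidHom.mem_ker, map_sub, sub_eq_zero]
      exact hy'.symm
    · refine congrArg (fun z : (D.d k).ker => (z : D.H k)) (Subtype.ext ?_)
      change f k (c - unprev y) = f k c
      rw [map_sub]
      exact sub_eq_self.2 hy
  have hker : φ.ker = (C.prevD k).range.addSubgroupOf (C.d k).ker := by
    ext z
    rw [AddMonoidHom.mem_ker, AddSubgroup.mem_addSubgroupOf]
    change ((g z : (D.d k).ker) : D.H k) = 0 ↔ _
    rw [QuotientAddGroup.eq_zero_iff, AddSubgroup.mem_addSubgroupOf]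
    constructor
    · rintro ⟨w, hw⟩
      obtain ⟨c, rfl⟩ := Prev.map_surjective f hs k w
      rw [← map_prevD f hf] at hw
      obtain ⟨y, -, hy⟩ := ha k (z - C.prevD k c) (by rw [map_sub, hw]; exact sub_self _)
        (by rw [map_sub, hC.d_prevD, sub_zero]; exact z.2)
      exact ⟨y + c, by rw [map_add, hy, sub_add_cancel]⟩
    · rintro ⟨c, hc⟩
      refine ⟨Prev.map f k c, ?_⟩
      rw [← map_prevD f hf, hc]
      rfl
  exact ⟨(QuotientAddGroup.quotientAddEquivOfEq hker.symm).trans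
    (QuotientAddGroup.quotientKerEquivOfSurjective φ hφs)⟩

theorem IsComplex.cone (hC : C.IsComplex) (f : ∀ k, C.X k →+ C.X k)
    (hf : ∀ k x, f (k + 1) (C.d k x) = C.d k (f k x)) : (C.cone f).IsComplex := by
  intro k (x : C.X k × Prev C.X k)
  obtain ⟨x, y⟩ := x
  refine Prod.ext (hC k x) ?_
  change f (k + 1) (C.d k x) - C.d k (unprev (f k x - C.prevD k y)) = 0
  rw [hf, map_sub, hC.d_prevD, sub_zero, sub_self]

/-- The cohomology of the cone of an injective endomorphism is that of its cokernel. -/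
theorem nonempty_H_cone_equiv (hC : C.IsComplex) (f : ∀ k, C.X k →+ C.X k)
    (hf : ∀ k x, f (k + 1) (C.d k x) = C.d k (f k x)) (hinj : ∀ k, Function.Injective (f k))
    (p : ∀ k, C.X k →+ D.X k) (hp : ∀ k x, p (k + 1) (C.d k x) = D.d k (p k x))
    (hps : ∀ k, Function.Surjective (p k)) (hex : ∀ k x, p k x = 0 ↔ ∃ y, f k y = x) (k : ℕ) :
    Nonempty ((C.cone f).H (k + 1) ≃+ D.H k) := by
  -- The first summand is dropped. The alternating signs turn the differential `-d` of the second
  -- summand of the cone into that of the shifted complex.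
  let q : ∀ k, (C.cone f).X k →+ D.shift.X k := fun k =>
    (Prev.map (fun k => (-1 : ℤ) ^ k • p k) k).comp (AddMonoidHom.snd _ _)
  have hsm : ∀ k (x : D.X k), ((-1 : ℤ) ^ k) • ((-1 : ℤ) ^ k) • x = x := fun k x => by
    rw [smul_smul, ← mul_pow]; simp
  have hqs : ∀ k, Function.Surjective (((-1 : ℤ) ^ k) • p k) := fun k x => by
    obtain ⟨y, hy⟩ := hps k ((-1 : ℤ) ^ k • x)
    exact ⟨y, by rw [AddMonoidHom.smul_apply, hy, hsm]⟩
  have hq0 : ∀ k (x : C.X k), ((-1 : ℤ) ^ k • p k) x = 0 ↔ p k x = 0 := fun k x => by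
    refine ⟨fun h => ?_, fun h => by rw [AddMonoidHom.smul_apply, h, smul_zero]⟩
    rw [← hsm k (p k x), ← AddMonoidHom.smul_apply, h, smul_zero]
  refine nonempty_H_equiv_of_surjective (D := D.shift) (hC.cone f hf) q ?_ ?_ ?_ (k + 1)
  · rintro k ⟨x, y⟩
    change ((-1 : ℤ) ^ k • p k) (f k x - C.prevD k y) = D.prevD k (Prev.map _ k y)
    rw [map_sub, (hq0 k _).2 ((hex k _).2 ⟨x, rfl⟩), zero_sub]
    cases k with
    | zero =>
      change -(((-1 : ℤ) ^ 0 • p 0) 0) = 0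
      simp
    | succ k =>
      change C.X k at y
      change -((-1 : ℤ) ^ (k + 1) • p (k + 1) (C.d k y)) = D.d k ((-1 : ℤ) ^ k • p k y)
      rw [hp, map_zsmul, pow_succ]
      simp
  · intro k
    exact (Prev.map_surjective _ hqs k).comp Prod.snd_surjective
  · rintro k ⟨x, y⟩ h1 h2
    obtain ⟨h3, h4⟩ := Prod.ext_iff.1 h2
    change C.d k x = 0 at h3
    change f k x - C.prevD k y = 0 at h4
    cases k with
    | zero =>
      refine ⟨0, rfl, ?_⟩
      have : f 0 x = 0 := by rw [sub_eq_zero] at h4; exact h4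
      have hx : x = 0 := hinj 0 (by rw [this, map_zero])
      subst hx
      rfl
    | succ k =>
      -- A cocycle `(x, y)` with `p y = 0` has `y = f x'`, and injectivity of `f` gives `x = d x'`;
      -- it is the differential of `(x', 0)`.
      obtain ⟨x', rfl⟩ := (hex k y).1 ((hq0 k _).1 h1)
      have hx : x = C.d k x' := by
        refine hinj _ ?_
        rw [hf]
        exact sub_eq_zero.1 h4
      subst hx
      refine ⟨(x', 0), ?_, ?_⟩
      · change Prev.map _ k 0 = 0
        exact map_zero _
      · refine Prod.ext rfl ?_
        change f k x' - C.prevD k 0 = f k x'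
        rw [map_zero, sub_zero]

/-- Cones of homotopic endomorphisms have the same cohomology. -/
theorem nonempty_H_cone_equiv_of_homotopy (hC : C.IsComplex) (f g : ∀ k, C.X k →+ C.X k)
    (hf : ∀ k x, f (k + 1) (C.d k x) = C.d k (f k x)) (h : ∀ k, C.X k →+ Prev C.X k)
    (hh : ∀ k x, g k x = f k x + C.prevD k (h k x) + (unprev (h (k + 1) (C.d k x)))) (k : ℕ) :
    Nonempty ((C.cone f).H k ≃+ (C.cone g).H k) := by
  -- The shear `(x, y) ↦ (x, y + h x)` is bijective and carries one cone differential to the other.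
  let q : ∀ k, (C.cone f).X k →+ (C.cone g).X k := fun k =>
    (AddMonoidHom.fst _ _).prod (AddMonoidHom.snd _ _ + (h k).comp (AddMonoidHom.fst _ _))
  refine nonempty_H_equiv_of_surjective (hC.cone f hf) q ?_ ?_ ?_ k
  · rintro k ⟨x, y⟩
    refine Prod.ext rfl ?_
    change f k x - C.prevD k y + (unprev (h (k + 1) (C.d k x))) = g k x - C.prevD k (y + h k x)
    rw [hh, map_add]
    abel
  · rintro k ⟨x, y⟩
    exact ⟨(x, y - h k x), Prod.ext rfl (sub_add_cancel _ _)⟩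
  · rintro k ⟨x, y⟩ h1 -
    obtain ⟨h3, h4⟩ := Prod.ext_iff.1 h1
    change x = 0 at h3
    change y + h k x = 0 at h4
    rw [h3, map_zero, add_zero] at h4
    refine ⟨0, map_zero _, ?_⟩
    rw [map_zero, h3, h4]
    rfl

/-- The homotopy on the cone of `f` that is induced by a homotopy which commutes with `f`. -/
def coneHomotopy (f : ∀ k, C.X k →+ C.X k) (h : ∀ k, C.X k →+ Prev C.X k) :
    ∀ k, (C.cone f).X k →+ Prev (C.cone f).X k
  | 0 => 0
  | k + 1 => AddMonoidHom.prod
      (((unprevHom k).comp (h (k + 1))).comp (AddMonoidHom.fst (C.X (k + 1)) (C.X k)) +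
        AddMonoidHom.snd (C.X (k + 1)) (C.X k) : C.X (k + 1) × C.X k →+ C.X k)
      (-(h k).comp (AddMonoidHom.snd (C.X (k + 1)) (C.X k)))

/-- The homotopy is the sum of `(x, y) ↦ (y, 0)`, which makes `f` null-homotopic on its own cone,
and of `(x, y) ↦ (h x, -h y)`, which contributes `g`; the cross terms of the latter cancel because
`h` commutes with `f`. -/
theorem coneHomotopy_spec (f g : ∀ k, C.X k →+ C.X k) (h : ∀ k, C.X k →+ Prev C.X k)
    (hfh : ∀ k x, h k (f k x) = Prev.map f k (h k x))
    (hg : ∀ k x, C.prevD k (h k x) + (unprev (h (k + 1) (C.d k x))) = g k x) :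
    ∀ k (x : C.X k) (y : Prev C.X k), (C.cone f).prevD k (coneHomotopy f h k (x, y)) +
      unprev (coneHomotopy f h (k + 1) ((C.cone f).d k (x, y))) =
        (g k x + f k x, Prev.map g k y + Prev.map f k y)
  | 0, x, y => by
    refine Prod.ext ?_ rfl
    change 0 + (unprev (h 1 (C.d 0 x)) + (f 0 x - 0)) = g 0 x + f 0 x
    rw [← hg]
    change _ = (0 : C.X 0) + _ + _
    abel
  | k + 1, x, y => by
    change C.X k at y
    have h1 : f k (unprev (h (k + 1) x)) = h (k + 1) (f (k + 1) x) := (hfh (k + 1) x).symm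
    refine Prod.ext ?_ ?_
    · change C.d k ((unprev (h (k + 1) x)) + y) + ((unprev (h (k + 2) (C.d (k + 1) x))) +
        (f (k + 1) x - C.d k y)) = g (k + 1) x + f (k + 1) x
      rw [← hg]
      change _ = C.d k (unprev (h (k + 1) x)) + (unprev (h (k + 2) (C.d (k + 1) x))) + _
      rw [map_add]
      abel
    · change f k ((unprev (h (k + 1) x)) + y) - C.prevD k (-(h k y)) +
        -(unprev (h (k + 1) (f (k + 1) x - C.d k y))) = g k y + f k y
      have h2 : (unprev (h (k + 1) (f (k + 1) x - C.d k y))) =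
        (unprev (h (k + 1) (f (k + 1) x))) - (unprev (h (k + 1) (C.d k y))) := map_sub (h (k + 1)) _ _
      rw [← hg, map_add, h1, map_neg, h2]
      abel

/-- Carries the naturality clause of `KX.exists_homotopy` through its induction. -/
theorem coneHomotopy_comm (f F : ∀ k, C.X k →+ C.X k) (h : ∀ k, C.X k →+ Prev C.X k)
    (hF : ∀ k x, h k (F k x) = Prev.map F k (h k x)) :
    ∀ k (x : C.X k) (y : Prev C.X k), coneHomotopy f h k (F k x, Prev.map F k y) =
      Prev.map (Y := (C.cone f).X) (fun k => (F k).prodMap (Prev.map F k)) k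
        (coneHomotopy f h k (x, y))
  | 0, _, _ => rfl
  | k + 1, x, y => by
    change C.X k at y
    refine Prod.ext ?_ ?_
    · change (unprev (h (k + 1) (F (k + 1) x))) + F k y = F k ((unprev (h (k + 1) x)) + y)
      rw [hF, map_add]
      rfl
    · change -(h k (F k y)) = Prev.map F k (-(h k y))
      rw [hF, map_neg]

end NComplex

/-! ### Koszul complexes -/

/-- The cochain groups of the Koszul complex of `n` operators on `B`. -/
def KX (B : Type) : ℕ → ℕ → Type
  | 0, 0 => B
  | 0, _ + 1 => PUnit
  | n + 1, k => KX B n k × Prev (KX B n) k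

instance KX.instAddCommGroup (B : Type) [AddCommGroup B] : ∀ n k, AddCommGroup (KX B n k)
  | 0, 0 => inferInstanceAs (AddCommGroup B)
  | 0, _ + 1 => inferInstanceAs (AddCommGroup PUnit)
  | n + 1, k =>
    have : ∀ k, AddCommGroup (KX B n k) := KX.instAddCommGroup B n
    inferInstanceAs (AddCommGroup (KX B n k × Prev (KX B n) k))

namespace KX

variable {B B' B'' : Type} [AddCommGroup B] [AddCommGroup B'] [AddCommGroup B'']

/-- The map of cochain groups induced by a homomorphism of the coefficients. -/
def map (φ : B →+ B') : ∀ n k, KX B n k →+ KX B' n k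
  | 0, 0 => φ
  | 0, _ + 1 => 0
  | n + 1, k => (map φ n k).prodMap (Prev.map (map φ n) k)

/-- The Koszul complex of `n` operators. -/
def kos : ∀ (n : ℕ) (_ : Fin n → (B →+ B)), ∀ k, KX B n k →+ KX B n (k + 1)
  | 0, _, _ => 0
  | n + 1, δ, k => ((NComplex.mk (KX B n) (kos n fun i => δ i.succ)).cone (map (δ 0) n)).d k

/-- The Koszul complex of `n` operators. -/
def cx (n : ℕ) (δ : Fin n → (B →+ B)) : NComplex := ⟨KX B n, kos n δ⟩

theorem map_comp (φ : B →+ B') (ψ : B' →+ B'') : ∀ n k (x : KX B n k),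
    map (ψ.comp φ) n k x = map ψ n k (map φ n k x)
  | 0, 0, _ => rfl
  | 0, _ + 1, _ => rfl
  | n + 1, 0, x => Prod.ext (map_comp φ ψ n 0 x.1) rfl
  | n + 1, k + 1, x => Prod.ext (map_comp φ ψ n (k + 1) x.1) (map_comp φ ψ n k x.2)

theorem map_add (φ ψ : B →+ B') : ∀ n k (x : KX B n k),
    map (φ + ψ) n k x = map φ n k x + map ψ n k x
  | 0, 0, _ => rfl
  | 0, _ + 1, _ => rfl
  | n + 1, 0, x => Prod.ext (map_add φ ψ n 0 x.1) rfl
  | n + 1, k + 1, x => Prod.ext (map_add φ ψ n (k + 1) x.1) (map_add φ ψ n k x.2)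

theorem map_zero : ∀ n k (x : KX B n k), map (0 : B →+ B') n k x = 0
  | 0, 0, _ => rfl
  | 0, _ + 1, _ => rfl
  | n + 1, 0, x => Prod.ext (map_zero n 0 x.1) rfl
  | n + 1, k + 1, x => Prod.ext (map_zero n (k + 1) x.1) (map_zero n k x.2)

theorem map_comm {φ : B →+ B'} {δ : (B →+ B)} {δ' : (B' →+ B')}
    (h : ∀ b, φ (δ b) = δ' (φ b)) (n k) (x : KX B n k) :
    map φ n k (map δ n k x) = map δ' n k (map φ n k x) := by
  rw [← map_comp, ← map_comp]
  congr 1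
  congr 1
  ext b
  exact h b

theorem map_surjective {φ : B →+ B'} (h : Function.Surjective φ) :
    ∀ n k, Function.Surjective (map φ n k)
  | 0, 0 => h
  | 0, _ + 1 => fun _ => ⟨0, rfl⟩
  | n + 1, k => (map_surjective h n k).prodMap (Prev.map_surjective _ (map_surjective h n) k)

theorem map_exact {φ : B →+ B'} {ψ : B' →+ B''} (h : ∀ b, ψ b = 0 → ∃ a, φ a = b) :
    ∀ n k (x : KX B' n k), map ψ n k x = 0 → ∃ y, map φ n k y = x
  | 0, 0, x, hx => h x hx
  | 0, _ + 1, _, _ => ⟨0, rfl⟩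
  | n + 1, 0, x, hx => by
    obtain ⟨y, hy⟩ := map_exact h n 0 x.1 (congrArg Prod.fst hx)
    exact ⟨(y, 0), Prod.ext hy rfl⟩
  | n + 1, k + 1, x, hx => by
    obtain ⟨y, hy⟩ := map_exact h n (k + 1) x.1 (congrArg Prod.fst hx)
    obtain ⟨z, hz⟩ := map_exact h n k x.2 (congrArg Prod.snd hx)
    exact ⟨(y, z), Prod.ext hy hz⟩

theorem map_injective {φ : B →+ B'} (h : Function.Injective φ) :
    ∀ n k, Function.Injective (map φ n k)
  | 0, 0 => h
  | 0, _ + 1 => fun _ _ _ => rfl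
  | n + 1, 0 => fun _ _ hxy => Prod.ext (map_injective h n 0 (congrArg Prod.fst hxy)) rfl
  | n + 1, k + 1 => fun _ _ hxy => Prod.ext (map_injective h n (k + 1) (congrArg Prod.fst hxy))
      (map_injective h n k (congrArg Prod.snd hxy))

theorem map_kos {φ : B →+ B'} : ∀ (n : ℕ) (δ : Fin n → (B →+ B))
    (δ' : Fin n → (B' →+ B')) (_ : ∀ i b, φ (δ i b) = δ' i (φ b)) (k) (x : KX B n k),
    map φ n (k + 1) (kos n δ k x) = kos n δ' k (map φ n k x)
  | 0, _, _, _, _, _ => rfl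
  | n + 1, δ, δ', h, k, x => by
    refine Prod.ext (map_kos n _ _ (fun i => h i.succ) k x.1) ?_
    change map φ n k ((map (δ 0) n k x.1 : KX B n k) -
        (show KX B n k from (cx n fun i => δ i.succ).prevD k x.2)) =
      map (δ' 0) n k (map φ n k x.1) -
        (show KX B' n k from (cx n fun i => δ' i.succ).prevD k (Prev.map (map φ n) k x.2))
    rw [map_sub, map_comm (h 0)]
    congr 1
    exact NComplex.map_prevD (C := cx n fun i => δ i.succ) (D := cx n fun i => δ' i.succ)
      (map φ n) (map_kos n _ _ fun i => h i.succ) k x.2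

theorem isComplex : ∀ (n : ℕ) (δ : Fin n → (B →+ B)) (_ : ∀ i j b, δ i (δ j b) = δ j (δ i b)),
    (cx n δ).IsComplex
  | 0, _, _ => fun _ _ => rfl
  | n + 1, δ, h => (isComplex n (fun i => δ i.succ) fun _ _ => h _ _).cone _
      (map_kos n _ _ fun i b => h 0 i.succ b)

/-- The product of the operators `1 + δᵢ`. -/
def prodOp : ∀ (n : ℕ) (_ : Fin n → (B →+ B)), B →+ B
  | 0, _ => AddMonoidHom.id B
  | n + 1, δ => (AddMonoidHom.id B + δ 0).comp (prodOp n fun i => δ i.succ)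

theorem prodOp_comm (F : B →+ B) : ∀ (n : ℕ) (δ : Fin n → (B →+ B))
    (_ : ∀ i b, F (δ i b) = δ i (F b)) (b : B), F (prodOp n δ b) = prodOp n δ (F b)
  | 0, _, _, _ => rfl
  | n + 1, δ, h, b => by
    change F (prodOp n _ b + δ 0 (prodOp n _ b)) = prodOp n _ (F b) + δ 0 (prodOp n _ (F b))
    rw [_root_.map_add, h, prodOp_comm F n _ fun i => h i.succ]

theorem map_id : ∀ n k (x : KX B n k), map (AddMonoidHom.id B) n k x = x
  | 0, 0, _ => rfl
  | 0, _ + 1, _ => rfl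
  | n + 1, 0, x => Prod.ext (map_id n 0 x.1) rfl
  | n + 1, k + 1, x => Prod.ext (map_id n (k + 1) x.1) (map_id n k x.2)

/-- The product of the operators `1 + δᵢ` is homotopic to the identity of the Koszul complex of
the `δᵢ`. -/
theorem exists_homotopy : ∀ (n : ℕ) (δ : Fin n → (B →+ B))
    (_ : ∀ i j b, δ i (δ j b) = δ j (δ i b)), ∃ h : ∀ k, KX B n k →+ Prev (KX B n) k,
      (∀ k x, (show KX B n k from (cx n δ).prevD k (h k x)) + unprev (h (k + 1) (kos n δ k x)) =
        map (prodOp n δ) n k x - x) ∧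
      -- Naturality in all commuting operators is part of the induction: for `F = δ 0` it is the
      -- hypothesis of `NComplex.coneHomotopy_spec`.
      ∀ F : B →+ B, (∀ i b, F (δ i b) = δ i (F b)) → ∀ k x,
        h k (map F n k x) = Prev.map (map F n) k (h k x)
  | 0, δ, _ => by
    refine ⟨fun k => 0, fun k x => ?_, fun F _ k x => ?_⟩
    · change _ = map (AddMonoidHom.id B) 0 k x - x
      rw [map_id, sub_self]
      change (cx 0 δ).prevD k 0 + 0 = 0
      rw [_root_.map_zero, add_zero]
    · change 0 = Prev.map (map F 0) k 0
      rw [_root_.map_zero]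
  | n + 1, δ, hδ => by
    obtain ⟨h, h1, h2⟩ := exists_homotopy n (fun i => δ i.succ) fun _ _ => hδ _ _
    let τ : B →+ B := AddMonoidHom.id B + δ 0
    let C := cx n fun i => δ i.succ
    let P := prodOp n fun i => δ i.succ
    have hτ : ∀ i b, τ (δ i b) = δ i (τ b) := fun i b => by
      change δ i b + δ 0 (δ i b) = δ i (b + δ 0 b)
      rw [_root_.map_add, hδ]
    have hτk : ∀ k x, map τ n (k + 1) (kos n (fun i => δ i.succ) k x) =
        kos n (fun i => δ i.succ) k (map τ n k x) := map_kos n _ _ fun i b => hτ i.succ b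
    have hτx : ∀ k (x : KX B n k), map τ n k x = x + map (δ 0) n k x := fun k x => by
      rw [map_add, map_id]
    -- With `P` the product over the later operators, `τ P - 1 = (P τ - τ) + δ 0`. The first summand
    -- is null-homotopic by `h ∘ τ`, the second by the structure of the cone.
    let h' : ∀ k, C.X k →+ Prev C.X k := fun k => (h k).comp (map τ n k)
    let g : ∀ k, C.X k →+ C.X k := fun k => (map P n k).comp (map τ n k) - map τ n k
    have h'1 : ∀ k x, C.prevD k (h' k x) + (unprev (h' (k + 1) (C.d k x))) = g k x := fun k x => by
      have hd : h' (k + 1) (C.d k x) = h (k + 1) (kos n (fun i => δ i.succ) k (map τ n k x)) :=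
        congrArg (h (k + 1)) (hτk k x)
      rw [hd]
      exact h1 k (map τ n k x)
    have h'2 : ∀ F : B →+ B, (∀ i b, F (δ i b) = δ i (F b)) → ∀ k x,
        h' k (map F n k x) = Prev.map (map F n) k (h' k x) := fun F hF k x => by
      change h k (map τ n k _) = Prev.map (map F n) k (h k _)
      rw [← h2 F fun i => hF i.succ]
      congr 1
      refine map_comm (fun b => ?_) n k x
      change F b + δ 0 (F b) = F (b + δ 0 b)
      rw [_root_.map_add, hF]
    refine ⟨NComplex.coneHomotopy (C := C) (map (δ 0) n) h', fun k x => ?_, fun F hF k x => ?_⟩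
    · refine (NComplex.coneHomotopy_spec (C := C) (map (δ 0) n) g h'
        (h'2 _ fun i b => hδ 0 i b) h'1 k x.1 x.2).trans ?_
      have key : ∀ k (x : KX B n k), (show KX B n k from g k x) + map (δ 0) n k x =
          map (prodOp (n + 1) δ) n k x - x := fun k x => by
        change map P n k (map τ n k x) - map τ n k x + map (δ 0) n k x =
          map (τ.comp P) n k x - x
        rw [map_comp, map_comm (φ := P) (δ := τ) (δ' := τ)
          (fun b => (prodOp_comm τ n _ (fun i => hτ i.succ) b).symm), hτx k x]
        abel
      refine Prod.ext (key k x.1) ?_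
      cases k with
      | zero => rfl
      | succ k => exact key k x.2
    · exact NComplex.coneHomotopy_comm (C := C) (map (δ 0) n) (map F n) h' (h'2 F hF) k x.1 x.2

end KX

/-! ### Cones of zero maps, and Koszul complexes on induced modules -/

namespace NComplex

variable {C : NComplex}

/-- The cohomology of the cone of the zero map. -/
theorem nonempty_H_cone_zero (k : ℕ) :
    Nonempty ((C.cone fun _ => 0).H k ≃+ C.H k × C.shift.H k) := by
  let D := C.cone fun _ => 0
  have h1 : ∀ x : (D.d k).ker, C.d k x.1.1 = 0 := fun x => congrArg Prod.fst x.2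
  have h2 : ∀ x : (D.d k).ker, C.prevD k x.1.2 = 0 := fun x => by
    have : (0 : C.X k) - C.prevD k x.1.2 = 0 := congrArg Prod.snd x.2
    rwa [zero_sub, neg_eq_zero] at this
  let f1 : (D.d k).ker →+ (C.d k).ker :=
    ((AddMonoidHom.fst (C.X k) (Prev C.X k)).comp (D.d k).ker.subtype).codRestrict _ h1
  let f2 : (D.d k).ker →+ (C.shift.d k).ker :=
    ((AddMonoidHom.snd (C.X k) (Prev C.X k)).comp (D.d k).ker.subtype).codRestrict _ h2
  let φ : (D.d k).ker →+ C.H k × C.shift.H k :=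
    ((QuotientAddGroup.mk' _).comp f1).prod ((QuotientAddGroup.mk' _).comp f2)
  have hs : Function.Surjective φ := by
    rintro ⟨a, b⟩
    obtain ⟨a, rfl⟩ := QuotientAddGroup.mk_surjective a
    obtain ⟨b, rfl⟩ := QuotientAddGroup.mk_surjective b
    refine ⟨⟨(a.1, b.1), ?_⟩, rfl⟩
    refine Prod.ext a.2 ?_
    change (0 : C.X k) - C.prevD k b.1 = 0
    have : C.prevD k b.1 = 0 := b.2
    rw [this, sub_zero]
  have hker : φ.ker = (D.prevD k).range.addSubgroupOf (D.d k).ker := by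
    ext z
    rw [AddMonoidHom.mem_ker, AddSubgroup.mem_addSubgroupOf, Prod.ext_iff]
    change ((f1 z : (C.d k).ker) : C.H k) = 0 ∧ ((f2 z : (C.shift.d k).ker) : C.shift.H k) = 0 ↔ _
    rw [QuotientAddGroup.eq_zero_iff, AddSubgroup.mem_addSubgroupOf,
      QuotientAddGroup.eq_zero_iff, AddSubgroup.mem_addSubgroupOf]
    change (∃ x, C.prevD k x = z.1.1) ∧ (∃ y, C.shift.prevD k y = z.1.2) ↔
      ∃ w, D.prevD k w = z.1
    cases k with
    | zero =>
      constructor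
      · rintro ⟨⟨x, hx⟩, ⟨y, hy⟩⟩
        exact ⟨0, Prod.ext hx hy⟩
      · rintro ⟨w, hw⟩
        exact ⟨⟨0, congrArg Prod.fst hw⟩, ⟨0, congrArg Prod.snd hw⟩⟩
    | succ k =>
      constructor
      · rintro ⟨⟨x, hx⟩, ⟨y, hy⟩⟩
        change Prev C.X k at y
        -- The cone carries the negative of the shifted differential, hence the sign.
        refine ⟨(x, -y), Prod.ext hx ?_⟩
        change (0 : C.X k) - C.prevD k (-y) = z.1.2
        rw [map_neg, zero_sub, neg_neg]
        exact hy
      · rintro ⟨w, hw⟩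
        refine ⟨⟨w.1, congrArg Prod.fst hw⟩, ⟨-w.2, ?_⟩⟩
        have : (0 : C.X k) - C.prevD k w.2 = z.1.2 := congrArg Prod.snd hw
        rw [zero_sub] at this
        change C.prevD k (-w.2) = _
        rw [map_neg]
        exact this
  exact ⟨(QuotientAddGroup.quotientAddEquivOfEq hker.symm).trans
    (QuotientAddGroup.quotientKerEquivOfSurjective φ hs)⟩

theorem subsingleton_shift_H_zero : Subsingleton (C.shift.H 0) := by
  refine ⟨fun a b => ?_⟩
  obtain ⟨a, rfl⟩ := QuotientAddGroup.mk_surjective a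
  obtain ⟨b, rfl⟩ := QuotientAddGroup.mk_surjective b
  exact congrArg (fun z : (C.shift.d 0).ker => (z : C.shift.H 0))
    (Subtype.ext (show (a.1 : PUnit) = b.1 from rfl))

end NComplex

namespace KX

variable {B B' : Type} [AddCommGroup B] [AddCommGroup B']

/-- The Koszul complex of `n + 1` operators on a module that is induced along the first one. -/
theorem nonempty_H_equiv_of_induced (n : ℕ) (δ : Fin n → (B →+ B)) (δ' : Fin (n + 1) → (B' →+ B'))
    (hδ' : ∀ i j b, δ' i (δ' j b) = δ' j (δ' i b)) (ev sm : B' →+ B)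
    (hev : ∀ i b, ev (δ' (Fin.succ i) b) = δ i (ev b))
    (hsm : ∀ i b, sm (δ' (Fin.succ i) b) = δ i (sm b))
    (hevs : Function.Surjective ev) (hsms : Function.Surjective sm) (hsm0 : ∀ b, sm (δ' 0 b) = 0)
    (s : B' →+ B') (u v : B →+ B') (h1 : ∀ b, δ' 0 (s b) + u (sm b) = b)
    (h2 : ∀ b, s (δ' 0 b) + v (ev b) = b) (h3 : ∀ b, ev (s b) = 0) (k : ℕ) :
    Nonempty ((cx (n + 1) δ').H k ≃+ ((cx n δ).cone fun _ => 0).H k) := by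
  let C := cx n fun i => δ' i.succ
  let D := cx n δ
  have hC : (cx (n + 1) δ').IsComplex := isComplex _ _ hδ'
  -- The hypotheses make `ev` an isomorphism from the kernel of `δ' 0` to `B`, and `sm` one from its
  -- cokernel. So the cone of `δ' 0` maps to the cone of zero on `B`, and only the acyclicity of the
  -- kernel of this map has to be shown.
  let q : ∀ k, (C.cone (map (δ' 0) n)).X k →+ (D.cone fun _ => 0).X k := fun k =>
    (map ev n k).prodMap (Prev.map (map sm n) k)
  have hcomm0 : ∀ k (x : KX B' n k),
      map (δ' 0) n (k + 1) (kos n (fun i => δ' i.succ) k x) =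
        kos n (fun i => δ' i.succ) k (map (δ' 0) n k x) :=
    map_kos n _ _ fun i b => hδ' 0 i.succ b
  have e1 : ∀ k (x : KX B' n k), map (δ' 0) n k (map s n k x) + map u n k (map sm n k x) = x :=
    fun k x => by
      rw [← map_comp, ← map_comp, ← map_add]
      conv_rhs => rw [← map_id n k x]
      congr 1; congr 1; ext b; exact h1 b
  have e2 : ∀ k (x : KX B' n k), map s n k (map (δ' 0) n k x) + map v n k (map ev n k x) = x :=
    fun k x => by
      rw [← map_comp, ← map_comp, ← map_add]
      conv_rhs => rw [← map_id n k x]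
      congr 1; congr 1; ext b; exact h2 b
  have e3 : ∀ k (x : KX B' n k), map ev n k (map s n k x) = 0 := fun k x => by
    rw [← map_comp, ← map_zero (B := B') (B' := B) n k x]
    congr 1; congr 1; ext b; exact h3 b
  have e0 : ∀ k (x : KX B' n k), map sm n k (map (δ' 0) n k x) = 0 := fun k x => by
    rw [← map_comp, ← map_zero (B := B') (B' := B) n k x]
    congr 1; congr 1; ext b; exact hsm0 b
  have hinj : ∀ k (x : KX B' n k), map ev n k x = 0 → map (δ' 0) n k x = 0 → x = 0 :=
    fun k x h h' => by rw [← e2 k x, h, h', _root_.map_zero, _root_.map_zero, add_zero]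
  refine NComplex.nonempty_H_equiv_of_surjective (C := C.cone (map (δ' 0) n)) hC q ?_ ?_ ?_ k
  · rintro k ⟨x, y⟩
    change KX B' n k at x
    refine Prod.ext (map_kos n _ _ hev k x) ?_
    change map sm n k (map (δ' 0) n k x - (show KX B' n k from C.prevD k y)) =
      (0 : KX B n k) - (show KX B n k from D.prevD k (Prev.map (map sm n) k y))
    rw [map_sub, e0]
    congr 1
    exact NComplex.map_prevD (C := C) (D := D) (map sm n) (map_kos n _ _ hsm) k y
  · intro k
    exact (map_surjective hevs n k).prodMap (Prev.map_surjective _ (map_surjective hsms n) k)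
  · rintro k ⟨x, y⟩ hq hd
    have hx : map ev n k x = 0 := congrArg Prod.fst hq
    have hy : Prev.map (map sm n) k y = 0 := congrArg Prod.snd hq
    have hdy : map (δ' 0) n k x - (show KX B' n k from C.prevD k y) = 0 := congrArg Prod.snd hd
    cases k with
    | zero =>
      refine ⟨0, rfl, ?_⟩
      have : x = 0 := hinj 0 x hx ((sub_eq_zero.1 hdy).trans rfl)
      rw [this]
      rfl
    | succ k =>
      change KX B' n (k + 1) at x
      -- As `sm` kills `y`, `s` provides a preimage of `y` under `δ' 0`; by `h3` this preimage is
      -- killed by `ev`, so it stays in the kernel of `q`.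
      let x' : KX B' n k := map s n k y
      have hx' : map (δ' 0) n k x' = y := by
        have := e1 k y
        rw [show map sm n k y = 0 from hy, _root_.map_zero, add_zero] at this
        exact this
      refine ⟨(x', 0), Prod.ext (e3 k y) (_root_.map_zero (Prev.map (map sm n) k)), ?_⟩
      have hxx : x - kos n (fun i => δ' i.succ) k x' = 0 := by
        refine hinj (k + 1) _ ?_ ?_
        · rw [map_sub, hx, map_kos n _ δ hev, show map ev n k x' = 0 from e3 k y, _root_.map_zero,
            sub_zero]
        · rw [map_sub, hcomm0, hx']
          exact hdy
      refine Prod.ext (sub_eq_zero.1 hxx).symm ?_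
      change map (δ' 0) n k x' - (show KX B' n k from C.prevD k 0) = y
      rw [hx']
      exact (congrArg (fun z : KX B' n k => (show KX B' n k from y) - z) (_root_.map_zero (C.prevD k))).trans
        (sub_zero (G := KX B' n k) y)

end KX

/-! ### Difference operators and the ordinary cohomology of the torus -/

/-- The difference operator in the `i`-th direction. -/
def diff {n : ℕ} (M : Type) [AddCommGroup M] (i : Fin n) :
    ((Fin n → ZMod 3) → M) →+ ((Fin n → ZMod 3) → M) where
  toFun f p := f (p + Pi.single i 1) - f p
  map_zero' := by ext; simp
  map_add' f g := by ext; simp only [Pi.add_apply]; abel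

theorem diff_comm {n : ℕ} {M : Type} [AddCommGroup M] (i j : Fin n) (f : (Fin n → ZMod 3) → M) :
    diff M i (diff M j f) = diff M j (diff M i f) := by
  ext p
  simp only [diff, AddMonoidHom.coe_mk, ZeroHom.coe_mk]
  rw [add_right_comm]
  abel

/-- The functions on two finite types. -/
def piFinAddEquiv (M : Type) [AddCommGroup M] (a b : ℕ) :
    (Fin a → M) × (Fin b → M) ≃+ (Fin (a + b) → M) :=
  ((LinearEquiv.sumArrowLequivProdArrow (Fin a) (Fin b) ℤ M).symm.trans
    (LinearEquiv.funCongrLeft ℤ M finSumFinEquiv.symm)).toAddEquiv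

theorem cons_add_single_zero {n : ℕ} (j : ZMod 3) (p : Fin n → ZMod 3) :
    (Fin.cons j p : Fin (n + 1) → ZMod 3) + Pi.single 0 1 = Fin.cons (j + 1) p := by
  ext i
  refine Fin.cases ?_ (fun i => ?_) i <;> simp

theorem cons_add_single_succ {n : ℕ} (j : ZMod 3) (p : Fin n → ZMod 3) (i : Fin n) :
    (Fin.cons j p : Fin (n + 1) → ZMod 3) + Pi.single i.succ 1 =
      Fin.cons j (p + Pi.single i 1) := by
  ext i'
  refine Fin.cases ?_ (fun i' => ?_) i'
  · simp
  · simp only [Pi.add_apply, Fin.cons_succ]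
    by_cases h : i' = i
    · subst h; simp
    · simp [h]

/-- The cohomology of the torus with coefficients in `M`. -/
theorem nonempty_H_torus (M : Type) [AddCommGroup M] : ∀ n k : ℕ,
    Nonempty ((KX.cx n (diff (n := n) M)).H k ≃+ (Fin (n.choose k) → M))
  | 0, 0 => by
    let C := KX.cx 0 (diff (n := 0) M)
    let φ : (C.d 0).ker →+ (Fin 1 → M) :=
      { toFun := fun x _ => (show (Fin 0 → ZMod 3) → M from x.1) 0
        map_zero' := rfl
        map_add' := fun _ _ => rfl }
    have hs : Function.Surjective φ := fun a => ⟨⟨fun _ => a 0, rfl⟩, by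
      ext i; rw [Subsingleton.elim i 0]; rfl⟩
    have hker : φ.ker = (C.prevD 0).range.addSubgroupOf (C.d 0).ker := by
      ext z
      rw [AddMonoidHom.mem_ker, AddSubgroup.mem_addSubgroupOf]
      constructor
      · intro h
        refine ⟨0, ?_⟩
        funext p
        rw [Subsingleton.elim p 0]
        exact (congrFun h 0).symm
      · rintro ⟨y, hy⟩
        funext i
        exact (congrFun hy 0).symm
    exact ⟨(QuotientAddGroup.quotientAddEquivOfEq hker.symm).trans
      (QuotientAddGroup.quotientKerEquivOfSurjective φ hs)⟩
  | 0, k + 1 => by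
    let C := KX.cx 0 (diff (n := 0) M)
    have : Subsingleton (C.H (k + 1)) := ⟨fun a b => by
      obtain ⟨a, rfl⟩ := QuotientAddGroup.mk_surjective a
      obtain ⟨b, rfl⟩ := QuotientAddGroup.mk_surjective b
      exact congrArg (fun z : (C.d (k + 1)).ker => (z : C.H (k + 1)))
        (Subtype.ext (show (a.1 : PUnit) = b.1 from rfl))⟩
    have : Unique (C.H (k + 1)) := ⟨⟨0⟩, fun _ => Subsingleton.elim _ _⟩
    have : Unique (Fin ((0 : ℕ).choose (k + 1)) → M) := Pi.uniqueOfIsEmpty (α := Fin 0) _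
    exact ⟨AddEquiv.ofUnique⟩
  | n + 1, k => by
    let ev : ((Fin (n + 1) → ZMod 3) → M) →+ ((Fin n → ZMod 3) → M) :=
      { toFun := fun f p => f (Fin.cons 0 p)
        map_zero' := rfl
        map_add' := fun _ _ => rfl }
    let sm : ((Fin (n + 1) → ZMod 3) → M) →+ ((Fin n → ZMod 3) → M) :=
      { toFun := fun f p => f (Fin.cons 0 p) + f (Fin.cons 1 p) + f (Fin.cons 2 p)
        map_zero' := by ext; simp
        map_add' := fun f g => by ext; simp only [Pi.add_apply]; abel }
    -- Partial sums in the first coordinate: the value at `p` is the sum of `f` over `0 ≤ j < p 0`.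
    -- They invert the difference operator except at the step from `2` to `0`, where the total sum
    -- is missing; `u` supplies it.
    let s : ((Fin (n + 1) → ZMod 3) → M) →+ ((Fin (n + 1) → ZMod 3) → M) :=
      { toFun := fun f p => (if p 0 = 0 then 0 else f (Fin.cons 0 (Fin.tail p))) +
          (if p 0 = 2 then f (Fin.cons 1 (Fin.tail p)) else 0)
        map_zero' := by ext; simp
        map_add' := fun f g => by
          ext p; simp only [Pi.add_apply]; split_ifs <;> abel }
    let u : ((Fin n → ZMod 3) → M) →+ ((Fin (n + 1) → ZMod 3) → M) :=
      { toFun := fun f p => if p 0 = 2 then f (Fin.tail p) else 0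
        map_zero' := by ext; simp
        map_add' := fun f g => by
          ext p; simp only [Pi.add_apply]; split_ifs <;> simp }
    let v : ((Fin n → ZMod 3) → M) →+ ((Fin (n + 1) → ZMod 3) → M) :=
      { toFun := fun f p => f (Fin.tail p)
        map_zero' := rfl
        map_add' := fun _ _ => rfl }
    have n10 : (1 : ZMod 3) ≠ 0 := by decide
    have n20 : (2 : ZMod 3) ≠ 0 := by decide
    have n12 : (1 : ZMod 3) ≠ 2 := by decide
    have n02 : (0 : ZMod 3) ≠ 2 := by decide
    have s11 : (1 : ZMod 3) + 1 = 2 := rfl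
    have s21 : (2 : ZMod 3) + 1 = 0 := rfl
    have cases3 : ∀ (P : (Fin (n + 1) → ZMod 3) → Prop), (∀ p, P (Fin.cons 0 p)) →
        (∀ p, P (Fin.cons 1 p)) → (∀ p, P (Fin.cons 2 p)) → ∀ p, P p := by
      intro P h0 h1 h2 p
      rw [← Fin.cons_self_tail p]
      generalize Fin.tail p = p'
      have : ∀ j : ZMod 3, j = 0 ∨ j = 1 ∨ j = 2 := by decide
      rcases this (p 0) with h | h | h <;> rw [h]
      exacts [h0 _, h1 _, h2 _]
    obtain ⟨e⟩ := KX.nonempty_H_equiv_of_induced n (diff (n := n) M) (diff (n := n + 1) M)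
      diff_comm ev sm
      (fun i f => by
        ext p
        simp only [diff, ev, AddMonoidHom.coe_mk, ZeroHom.coe_mk, cons_add_single_succ])
      (fun i f => by
        ext p
        simp only [diff, sm, AddMonoidHom.coe_mk, ZeroHom.coe_mk, cons_add_single_succ]
        abel)
      (fun f => ⟨v f, by ext p; simp [v, ev]⟩)
      (fun f => ⟨u f, by ext p; simp [u, sm, n12, n02]⟩)
      (fun f => by
        ext p
        simp only [diff, sm, AddMonoidHom.coe_mk, ZeroHom.coe_mk, cons_add_single_zero, zero_add,
          s11, s21, Pi.zero_apply]
        abel)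
      s u v
      (fun f => by
        ext p
        revert p
        refine cases3 _ (fun p => ?_) (fun p => ?_) (fun p => ?_) <;>
        simp [diff, s, u, sm, cons_add_single_zero, n10, n20, n12, n02, s11, s21] <;> abel)
      (fun f => by
        ext p
        revert p
        refine cases3 _ (fun p => ?_) (fun p => ?_) (fun p => ?_) <;>
        simp [diff, s, v, ev, cons_add_single_zero, n10, n20, n12, n02, s11])
      (fun f => by ext p; simp [s, ev, n02]) k
    -- The new circle factor contributes one copy of the cohomology in degree `k` and one in degree
    -- `k - 1`, which is Pascal's rule.
    obtain ⟨e'⟩ := NComplex.nonempty_H_cone_zero (C := KX.cx n (diff (n := n) M)) k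
    refine ⟨e.trans (e'.trans ?_)⟩
    cases k with
    | zero =>
      have := NComplex.subsingleton_shift_H_zero (C := KX.cx n (diff (n := n) M))
      have i1 := (nonempty_H_torus M n 0).some
      rw [Nat.choose_zero_right] at i1 ⊢
      have : Unique ((KX.cx n (diff (n := n) M)).shift.H 0) := ⟨⟨0⟩, fun _ => Subsingleton.elim _ _⟩
      exact AddEquiv.prodUnique.trans i1
    | succ k =>
      have i1 := (nonempty_H_torus M n (k + 1)).some
      have i2 := (nonempty_H_torus M n k).some
      have : (n + 1).choose (k + 1) = n.choose (k + 1) + n.choose k := by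
        rw [Nat.choose_succ_succ, add_comm]
      rw [this]
      exact (AddEquiv.prodCongr i1 i2).trans (piFinAddEquiv M _ _)

/-! ### Equivariant functions and the reduction to the coinvariants -/

section Equivariant

variable {V : Type} [AddCommGroup V] (T : V →+ V)

/-- The functions on `(ℤ/3)ⁿ` that are equivariant for the diagonal action. -/
def EqFun (n : ℕ) : AddSubgroup ((Fin n → ZMod 3) → V) where
  carrier := {f | ∀ p, f (p + 1) = T (f p)}
  zero_mem' := fun p => (map_zero T).symm
  add_mem' := fun {f g} hf hg p => by simp only [Pi.add_apply, hf p, hg p, map_add]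
  neg_mem' := fun {f} hf p => by simp only [Pi.neg_apply, hf p, map_neg]

namespace EqFun

variable {n : ℕ}

/-- The difference operators on equivariant functions. -/
def diff (i : Fin n) : EqFun T n →+ EqFun T n :=
  ((_root_.diff V i).comp (EqFun T n).subtype).codRestrict _ fun f p => by
    change f.1 (p + 1 + Pi.single i 1) - f.1 (p + 1) = T (f.1 (p + Pi.single i 1) - f.1 p)
    rw [add_right_comm, f.2, f.2, map_sub]

theorem diff_comm (i j : Fin n) (f : EqFun T n) : diff T i (diff T j f) = diff T j (diff T i f) :=
  Subtype.ext (_root_.diff_comm i j f.1)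

/-- The action of `T - 1` on equivariant functions. -/
def subOne : EqFun T n →+ EqFun T n where
  toFun f := ⟨fun p => T (f.1 p) - f.1 p, fun p => by
    change T (f.1 (p + 1)) - f.1 (p + 1) = T (T (f.1 p) - f.1 p)
    rw [f.2, map_sub]⟩
  map_zero' := Subtype.ext (funext fun p => by simp)
  map_add' f g := Subtype.ext (funext fun p => by
    change T (f.1 p + g.1 p) - (f.1 p + g.1 p) = (T (f.1 p) - f.1 p) + (T (g.1 p) - g.1 p)
    rw [map_add]
    abel)

theorem subOne_diff (i : Fin n) (f : EqFun T n) :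
    subOne T (diff T i f) = diff T i (subOne T f) := by
  refine Subtype.ext (funext fun p => ?_)
  change T (f.1 (p + Pi.single i 1) - f.1 p) - (f.1 (p + Pi.single i 1) - f.1 p) =
    T (f.1 (p + Pi.single i 1)) - f.1 (p + Pi.single i 1) - (T (f.1 p) - f.1 p)
  rw [map_sub]
  abel

/-- Each `1 + δⱼ` is the translation by a unit vector. The sequence `g` of directions is left
arbitrary so that induction on its length is possible. -/
theorem prodOp_apply (f : EqFun T n) (p : Fin n → ZMod 3) : ∀ (m : ℕ) (g : Fin m → Fin n),
    (KX.prodOp m (fun i => diff T (g i)) f).1 p = f.1 (p + ∑ i, Pi.single (g i) 1)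
  | 0, _ => by simp [KX.prodOp]
  | m + 1, g => by
    have key : ∀ (h : EqFun T n) (q : Fin n → ZMod 3),
        ((AddMonoidHom.id (EqFun T n) + diff T (g 0) : EqFun T n →+ EqFun T n) h).1 q = h.1 (q + Pi.single (g 0) 1) := fun h q => by
      change h.1 q + (h.1 (q + Pi.single (g 0) 1) - h.1 q) = _
      abel
    change ((AddMonoidHom.id (EqFun T n) + diff T (g 0) : EqFun T n →+ EqFun T n)
      (KX.prodOp m (fun i => diff T (g i.succ)) f)).1 p = _
    rw [key, prodOp_apply f _ m fun i => g i.succ, Fin.sum_univ_succ, add_assoc]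

/-- Translating once in every direction is the diagonal translation, on which equivariance brings in
`T`. This is the relation that ties `T` to the difference operators. -/
theorem prodOp_eq (f : EqFun T n) (p : Fin n → ZMod 3) :
    (KX.prodOp n (diff T) f).1 p = T (f.1 p) := by
  refine (prodOp_apply T f p n id).trans ?_
  rw [← f.2]
  refine congrArg f.1 (congrArg (p + ·) (funext fun i => ?_))
  simp [Finset.sum_apply, Pi.single_apply]

end EqFun

variable {M : Type} [AddCommGroup M]

/-- The equivariant cohomology of the torus with coefficients in `V` in terms of ordinary
cohomology with coefficients in `V / (T - 1)`. -/
theorem nonempty_H_eqFun (hT : ∀ v, T (T (T v)) = v) (hinj : ∀ v, T v = v → v = 0) (π : V →+ M)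
    (hπ : Function.Surjective π) (hker : ∀ v, π v = 0 ↔ ∃ w, T w - w = v) (n k : ℕ) :
    Nonempty ((KX.cx (n + 1) (EqFun.diff (n := n + 1) T)).H (k + 1) ≃+
      (KX.cx n (diff (n := n) M)).H k) := by
  let C := KX.cx n fun i => EqFun.diff (n := n + 1) T i.succ
  have hC : C.IsComplex := KX.isComplex _ _ fun i j => EqFun.diff_comm T _ _
  obtain ⟨h, h1, h2⟩ := KX.exists_homotopy n (fun i => EqFun.diff (n := n + 1) T i.succ)
    fun i j => EqFun.diff_comm T _ _
  let τ : EqFun T (n + 1) →+ EqFun T (n + 1) := AddMonoidHom.id _ + EqFun.diff T 0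
  have hτ : ∀ i f, τ (EqFun.diff T i f) = EqFun.diff T i (τ f) := fun i f => by
    change EqFun.diff T i f + EqFun.diff T 0 (EqFun.diff T i f) = EqFun.diff T i (f + EqFun.diff T 0 f)
    rw [map_add, EqFun.diff_comm T 0 i]
  have hτk : ∀ k x, KX.map τ n (k + 1) (C.d k x) = C.d k (KX.map τ n k x) :=
    KX.map_kos n _ _ fun i b => hτ i.succ b
  let h' : ∀ k, C.X k →+ Prev C.X k := fun k => (h k).comp (KX.map τ n k)
  -- With `P` the product over the directions other than the first, `T = P τ`. Since `P` is
  -- homotopic to `1`, the map `T - 1 = P τ - 1` is homotopic to `τ - 1 = δ₀`.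
  have hmap : ∀ k (x : KX (EqFun T (n + 1)) n k), KX.map (EqFun.subOne T) n k x + x =
      KX.map (KX.prodOp n fun i => EqFun.diff T i.succ) n k (KX.map τ n k x) := fun k x => by
    conv_lhs => rw [← KX.map_id n k x, ← KX.map_comp, ← KX.map_add]
    rw [← KX.map_comp]
    congr 1
    congr 1
    refine AddMonoidHom.ext fun f => ?_
    change (EqFun.subOne T f + f : EqFun T (n + 1)) = KX.prodOp n (fun i => EqFun.diff T i.succ) (τ f)
    rw [← KX.prodOp_comm τ n _ fun i => hτ i.succ]
    refine Subtype.ext (funext fun p => ?_)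
    refine Eq.trans ?_ (EqFun.prodOp_eq T f p).symm
    change T (f.1 p) - f.1 p + f.1 p = _
    abel
  -- The Koszul complex of all `n + 1` operators is the cone of `δ₀` on `C`; it is traded for the
  -- cone of `T - 1`.
  obtain ⟨e1⟩ := NComplex.nonempty_H_cone_equiv_of_homotopy (C := C) hC
    (KX.map (EqFun.diff T 0) n) (KX.map (EqFun.subOne T) n)
    (KX.map_kos n _ _ fun i b => EqFun.diff_comm T 0 i.succ b) h' (fun k x => by
      have hd : h' (k + 1) (C.d k x) =
          h (k + 1) (KX.kos n (fun i => EqFun.diff T i.succ) k (KX.map τ n k x)) :=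
        congrArg (h (k + 1)) (hτk k x)
      change KX (EqFun T (n + 1)) n k at x
      have e := h1 k (KX.map τ n k x)
      rw [← hmap k x] at e
      rw [add_assoc, hd]
      refine Eq.trans ?_ (congrArg (fun z => KX.map (EqFun.diff T 0) n k x + z) e.symm)
      have : KX.map τ n k x = x + KX.map (EqFun.diff T 0) n k x := by
        rw [KX.map_add, KX.map_id]
      rw [this]
      abel) (k + 1)
  -- An equivariant function is determined, freely, by its values at the points with first
  -- coordinate `0`. Hence the cokernel of `T - 1` consists of functions of the other `n`
  -- coordinates with values in `M`.
  let p : EqFun T (n + 1) →+ ((Fin n → ZMod 3) → M) :=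
    { toFun := fun f q => π (f.1 (Fin.cons 0 q))
      map_zero' := by ext; simp
      map_add' := fun f g => by ext; simp }
  have hcons : ∀ (j : ZMod 3) (q : Fin n → ZMod 3),
      (Fin.cons j q : Fin (n + 1) → ZMod 3) + 1 = Fin.cons (j + 1) (q + 1) := fun j q => by
    ext i
    refine Fin.cases ?_ (fun i => ?_) i <;> simp
  have hps : Function.Surjective p := by
    intro φ
    choose l hl using fun q => hπ (φ q)
    -- The power `T ^ j`, with `j` taken modulo `3`.
    let pw : ZMod 3 → V → V := fun j v => if j = 0 then v else if j = 1 then T v else T (T v)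
    have hpw : ∀ j v, pw (j + 1) v = T (pw j v) := by
      intro j v
      have : ∀ j : ZMod 3, j = 0 ∨ j = 1 ∨ j = 2 := by decide
      have n10 : (1 : ZMod 3) ≠ 0 := by decide
      have n20 : (2 : ZMod 3) ≠ 0 := by decide
      have n21 : (2 : ZMod 3) ≠ 1 := by decide
      have s11 : (1 : ZMod 3) + 1 = 2 := rfl
      have s21 : (2 : ZMod 3) + 1 = 0 := rfl
      rcases this j with rfl | rfl | rfl <;> simp [pw, n10, n20, n21, s11, s21, hT]
    -- The diagonal translation moves `r` to a point with first coordinate `0`; the value there is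
    -- moved back by `T ^ (r 0)`.
    refine ⟨⟨fun r => pw (r 0) (l (Fin.tail r - fun _ => r 0)), fun r => ?_⟩, ?_⟩
    · rw [← hpw]
      refine congrArg (fun q => pw (r 0 + 1) (l q)) (funext fun i => ?_)
      simp [Fin.tail]
    · ext q
      simp only [p, pw, AddMonoidHom.coe_mk, ZeroHom.coe_mk, Fin.cons_zero, Fin.tail_cons, if_true]
      rw [← hl q]
      exact congrArg (fun q => π (l q)) (funext fun i => sub_zero (q i))
  have hpex : ∀ f, p f = 0 → ∃ g, EqFun.subOne T g = f := by
    intro f hf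
    have hf0 : ∀ q, ∃ w, T w - w = f.1 (Fin.cons 0 q) := fun q => (hker _).1 (congrFun hf q)
    have step : ∀ j, (∀ q, ∃ w, T w - w = f.1 (Fin.cons j q)) →
        ∀ q, ∃ w, T w - w = f.1 (Fin.cons (j + 1) q) := by
      intro j hj q
      obtain ⟨w, hw⟩ := hj (q - 1)
      refine ⟨T w, ?_⟩
      rw [← map_sub, hw, ← f.2, hcons, sub_add_cancel]
    have hf1 := step 0 hf0
    have hf2 := step _ hf1
    have hall : ∀ r, ∃ w, T w - w = f.1 r := by
      intro r
      rw [← Fin.cons_self_tail r]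
      have : ∀ j : ZMod 3, j = 0 ∨ j = 0 + 1 ∨ j = 0 + 1 + 1 := by decide
      rcases this (r 0) with h | h | h <;> rw [h]
      exacts [hf0 _, hf1 _, hf2 _]
    choose g hg using hall
    refine ⟨⟨g, fun r => ?_⟩, Subtype.ext (funext hg)⟩
    -- The pointwise preimages under `T - 1` are unique, so they form an equivariant function
    -- without further choice.
    refine sub_eq_zero.1 (hinj _ ?_)
    rw [← sub_eq_zero]
    have h3 : T (g (r + 1)) - g (r + 1) = T (T (g r)) - T (g r) := by
      rw [hg, f.2, ← hg r, map_sub]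
    rw [map_sub, sub_sub_sub_comm, h3, sub_self]
  obtain ⟨e2⟩ := NComplex.nonempty_H_cone_equiv (C := C) (D := KX.cx n (diff (n := n) M)) hC
    (KX.map (EqFun.subOne T) n) (KX.map_kos n _ _ fun i b => EqFun.subOne_diff T i.succ b)
    (KX.map_injective (by
      rw [injective_iff_map_eq_zero]
      intro f hf
      refine Subtype.ext (funext fun r => hinj _ (sub_eq_zero.1 ?_))
      exact congrFun (congrArg Subtype.val hf) r) n)
    (KX.map p n) (KX.map_kos n _ _ fun i f => by
      ext q
      change π (f.1 (Fin.cons 0 q + Pi.single i.succ 1) - f.1 (Fin.cons 0 q)) =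
        π (f.1 (Fin.cons 0 (q + Pi.single i 1))) - π (f.1 (Fin.cons 0 q))
      rw [cons_add_single_succ, map_sub])
    (KX.map_surjective hps n)
    (fun k x => ⟨KX.map_exact hpex n k x, by
      rintro ⟨y, rfl⟩
      change KX (EqFun T (n + 1)) n k at y
      change KX.map p n k (KX.map (EqFun.subOne T) n k y) = 0
      rw [← KX.map_comp, ← KX.map_zero (B' := (Fin n → ZMod 3) → M) n k y]
      congr 1
      congr 1
      ext f q
      exact (hker _).2 ⟨f.1 (Fin.cons 0 q), rfl⟩⟩) k
  exact ⟨e1.trans e2⟩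

end Equivariant

/-! ### Cubical cochains of the torus -/

section Cubical

/-- The sequences of directions that avoid the first one. -/
def dirUp {n k : ℕ} (s : Fin k ↪o Fin n) : Fin k ↪o Fin (n + 1) := s.trans (Fin.succOrderEmb n)

/-- The sequences of directions that start with the first one. -/
def dirCons {n k : ℕ} (s : Fin k ↪o Fin n) : Fin (k + 1) ↪o Fin (n + 1) :=
  OrderEmbedding.ofStrictMono (Fin.cons 0 fun i => (s i).succ) (by
    intro i j hij
    refine Fin.cases (fun hij => ?_) (fun j hij => ?_) j hij
    · exact absurd hij (Fin.not_lt_zero i)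
    · refine Fin.cases (fun _ => ?_) (fun i hij => ?_) i hij
      · simp
      · simpa using hij)

@[simp] theorem dirCons_zero {n k : ℕ} (s : Fin k ↪o Fin n) : dirCons s 0 = 0 := rfl

@[simp] theorem dirCons_succ {n k : ℕ} (s : Fin k ↪o Fin n) (i : Fin k) :
    dirCons s i.succ = (s i).succ := rfl

instance {n : ℕ} : Subsingleton (Fin 0 ↪o Fin n) := ⟨fun _ _ => RelEmbedding.ext fun i => i.elim0⟩

/-- An increasing sequence can contain the first direction only at its first place. This dichotomy
matches the two summands of `KX B (n + 1) (k + 1)`. -/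
theorem dirUp_or_dirCons {n k : ℕ} (s : Fin (k + 1) ↪o Fin (n + 1)) :
    (∃ t, s = dirUp t) ∨ ∃ t, s = dirCons t := by
  by_cases h0 : s 0 = 0
  · right
    have hne : ∀ i : Fin k, s i.succ ≠ 0 := fun i h => by
      have := s.injective (h.trans h0.symm)
      exact Fin.succ_ne_zero i this
    refine ⟨OrderEmbedding.ofStrictMono (fun i => (s i.succ).pred (hne i)) fun i j hij => ?_, ?_⟩
    · simpa using hij
    · refine RelEmbedding.ext fun i => Fin.cases ?_ (fun i => ?_) i
      · rw [h0, dirCons_zero]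
      · rw [dirCons_succ]
        exact (Fin.succ_pred _ (hne i)).symm
  · left
    have hne : ∀ i, s i ≠ 0 := fun i h => by
      have h1 : s 0 ≤ s i := s.monotone (Fin.zero_le i)
      rw [h] at h1
      exact h0 (Fin.le_zero_iff.1 h1)
    refine ⟨OrderEmbedding.ofStrictMono (fun i => (s i).pred (hne i)) fun i j hij => ?_, ?_⟩
    · simpa using hij
    · exact RelEmbedding.ext fun i => (Fin.succ_pred _ (hne i)).symm

variable {B : Type} [AddCommGroup B]

/-- The coboundary of cubical cochains with values in `B`, with respect to operators `δ`. -/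
def cubD {n : ℕ} (δ : Fin n → (B →+ B)) (k : ℕ) :
    ((Fin k ↪o Fin n) → B) →+ ((Fin (k + 1) ↪o Fin n) → B) where
  toFun f s := ∑ i : Fin (k + 1), (-1 : ℤ) ^ (i : ℕ) •
    δ (s i) (f ((Fin.succAboveOrderEmb i).trans s))
  map_zero' := by ext; simp
  map_add' f g := by ext; simp [Finset.sum_add_distrib]

/-- Cubical cochains, as a sequence of groups. -/
def cubCx {n : ℕ} (δ : Fin n → (B →+ B)) : NComplex := ⟨fun k => (Fin k ↪o Fin n) → B, cubD δ⟩

/-- The comparison of cubical cochains with the Koszul complex. -/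
def toKX : ∀ n k : ℕ, ((Fin k ↪o Fin n) → B) → KX B n k
  | 0, 0, f => f (OrderEmbedding.ofIsEmpty)
  | 0, _ + 1, _ => PUnit.unit
  | n + 1, 0, f => (toKX n 0 fun s => f (dirUp s), PUnit.unit)
  | n + 1, k + 1, f => (toKX n (k + 1) fun s => f (dirUp s), toKX n k fun s => f (dirCons s))

theorem toKX_add : ∀ (n k : ℕ) (f g : (Fin k ↪o Fin n) → B),
    toKX n k (f + g) = toKX n k f + toKX n k g
  | 0, 0, _, _ => rfl
  | 0, _ + 1, _, _ => rfl
  | n + 1, 0, _, _ => Prod.ext (toKX_add n 0 _ _) rfl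
  | n + 1, k + 1, _, _ => Prod.ext (toKX_add n (k + 1) _ _) (toKX_add n k _ _)

theorem toKX_map (φ : B →+ B) : ∀ (n k : ℕ) (f : (Fin k ↪o Fin n) → B),
    toKX n k (fun s => φ (f s)) = KX.map φ n k (toKX n k f)
  | 0, 0, _ => rfl
  | 0, _ + 1, _ => rfl
  | n + 1, 0, _ => Prod.ext (toKX_map φ n 0 _) rfl
  | n + 1, k + 1, _ => Prod.ext (toKX_map φ n (k + 1) _) (toKX_map φ n k _)

theorem toKX_injective : ∀ (n k : ℕ), Function.Injective (toKX (B := B) n k)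
  | 0, 0, f, g, h => by
    funext s
    rw [Subsingleton.elim s OrderEmbedding.ofIsEmpty]
    exact h
  | 0, _ + 1, f, g, _ => funext fun s => (s 0).elim0
  | n + 1, 0, f, g, h => by
    funext s
    have h1 := congrFun (toKX_injective n 0 (congrArg Prod.fst h)) OrderEmbedding.ofIsEmpty
    rwa [Subsingleton.elim (dirUp OrderEmbedding.ofIsEmpty) s] at h1
  | n + 1, k + 1, f, g, h => by
    funext s
    have h1 := toKX_injective n (k + 1) (congrArg Prod.fst h)
    have h2 := toKX_injective n k (congrArg Prod.snd h)
    rcases dirUp_or_dirCons s with ⟨t, rfl⟩ | ⟨t, rfl⟩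
    exacts [congrFun h1 t, congrFun h2 t]

theorem dirUp_injective {n k : ℕ} : Function.Injective (dirUp (n := n) (k := k)) := fun _ _ h =>
  RelEmbedding.ext fun i => Fin.succ_injective _ (DFunLike.congr_fun h i)

theorem dirCons_injective {n k : ℕ} : Function.Injective (dirCons (n := n) (k := k)) :=
  fun _ _ h => RelEmbedding.ext fun i => Fin.succ_injective _ (DFunLike.congr_fun h i.succ)

theorem dirUp_ne_dirCons {n k : ℕ} (s : Fin (k + 1) ↪o Fin n) (t : Fin k ↪o Fin n) :
    dirUp s ≠ dirCons t := fun h =>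
  Fin.succ_ne_zero _ (DFunLike.congr_fun h 0)

theorem toKX_surjective : ∀ (n k : ℕ), Function.Surjective (toKX (B := B) n k)
  | 0, 0, b => ⟨fun _ => b, rfl⟩
  | 0, _ + 1, _ => ⟨0, rfl⟩
  | n + 1, 0, b => by
    obtain ⟨f, hf⟩ := toKX_surjective n 0 b.1
    refine ⟨fun _ => f OrderEmbedding.ofIsEmpty, Prod.ext (Eq.trans ?_ hf) rfl⟩
    exact congrArg (toKX n 0) (funext fun s => congrArg f (Subsingleton.elim _ _))
  | n + 1, k + 1, b => by
    classical
    obtain ⟨f, hf⟩ := toKX_surjective n (k + 1) b.1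
    obtain ⟨g, hg⟩ := toKX_surjective n k b.2
    let F : (Fin (k + 1) ↪o Fin (n + 1)) → B := fun s =>
      if h : ∃ t, s = dirUp t then f h.choose else if h : ∃ t, s = dirCons t then g h.choose else 0
    refine ⟨F, Prod.ext (Eq.trans ?_ hf) (Eq.trans ?_ hg)⟩
    · refine congrArg (toKX n (k + 1)) (funext fun s => ?_)
      have h : ∃ t, dirUp s = dirUp t := ⟨s, rfl⟩
      simp only [F, dif_pos h]
      rw [← dirUp_injective h.choose_spec]
    · refine congrArg (toKX n k) (funext fun s => ?_)
      have h : ∃ t, dirCons s = dirCons t := ⟨s, rfl⟩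
      have h' : ¬ ∃ t, dirCons s = dirUp t := fun ⟨t, ht⟩ => dirUp_ne_dirCons t s ht.symm
      simp only [F, dif_neg h', dif_pos h]
      rw [← dirCons_injective h.choose_spec]

theorem toKX_sub (n k : ℕ) (f g : (Fin k ↪o Fin n) → B) :
    toKX n k (f - g) = toKX n k f - toKX n k g := by
  rw [eq_sub_iff_add_eq, ← toKX_add, sub_add_cancel]

/-- On sequences starting with the first direction, deleting that direction gives the `δ 0` term of
the cone. Deleting a later one raises its index by one, and the resulting sign is the minus sign of
the cone differential. -/
theorem toKX_cubD : ∀ (n : ℕ) (δ : Fin n → (B →+ B)) (k : ℕ) (f : (Fin k ↪o Fin n) → B),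
    toKX n (k + 1) (cubD δ k f) = KX.kos n δ k (toKX n k f)
  | 0, _, _, _ => rfl
  | n + 1, δ, k, f => by
    have hup : (fun s => cubD δ k f (dirUp s)) = cubD (fun i => δ i.succ) k fun s => f (dirUp s) :=
      rfl
    have h1 := toKX_cubD n (fun i => δ i.succ) k fun s => f (dirUp s)
    have hcons0 : ∀ s : Fin k ↪o Fin n,
        (Fin.succAboveOrderEmb 0).trans (dirCons s) = dirUp s := fun s =>
      RelEmbedding.ext fun i => rfl
    cases k with
    | zero =>
      refine Prod.ext ((congrArg (toKX n 1) hup).trans h1) ?_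
      change toKX n 0 (fun s => cubD δ 0 f (dirCons s)) =
        KX.map (δ 0) n 0 (toKX n 0 fun s => f (dirUp s)) - (0 : KX B n 0)
      rw [sub_zero, ← toKX_map]
      refine congrArg (toKX n 0) (funext fun s => ?_)
      change ∑ i : Fin 1, (-1 : ℤ) ^ (i : ℕ) •
        δ (dirCons s i) (f ((Fin.succAboveOrderEmb i).trans (dirCons s))) = _
      rw [Fin.sum_univ_one, hcons0, dirCons_zero]
      simp
    | succ k =>
      refine Prod.ext ((congrArg (toKX n (k + 2)) hup).trans h1) ?_
      change toKX n (k + 1) (fun s => cubD δ (k + 1) f (dirCons s)) =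
        KX.map (δ 0) n (k + 1) (toKX n (k + 1) fun s => f (dirUp s)) -
          KX.kos n (fun i => δ i.succ) k (toKX n k fun s => f (dirCons s))
      rw [← toKX_map, ← toKX_cubD n, ← toKX_sub]
      refine congrArg (toKX n (k + 1)) (funext fun s => ?_)
      have hc : ∀ i : Fin (k + 1), (Fin.succAboveOrderEmb i.succ).trans (dirCons s) =
          dirCons ((Fin.succAboveOrderEmb i).trans s) := fun i =>
        RelEmbedding.ext fun j => by refine Fin.cases ?_ (fun j => ?_) j <;> simp
      simp only [cubD, AddMonoidHom.coe_mk, ZeroHom.coe_mk, Pi.sub_apply]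
      rw [Fin.sum_univ_succ]
      simp only [hcons0, hc, dirCons_zero, dirCons_succ]
      simp [pow_succ, sub_eq_add_neg]

/-- Inherited through the injective comparison with the Koszul complex, which avoids cancelling
signed sums of double faces. -/
theorem cubCx_isComplex {n : ℕ} (δ : Fin n → (B →+ B))
    (hδ : ∀ i j b, δ i (δ j b) = δ j (δ i b)) : (cubCx δ).IsComplex := by
  intro k f
  change (Fin k ↪o Fin n) → B at f
  refine toKX_injective n _ ?_
  change toKX n _ (cubD δ (k + 1) (cubD δ k f)) = toKX n _ 0
  rw [toKX_cubD, toKX_cubD]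
  refine (KX.isComplex n δ hδ k (toKX n k f)).trans ?_
  exact (map_zero (AddMonoidHom.mk' (toKX (B := B) n (k + 1 + 1)) (toKX_add n _))).symm

theorem nonempty_H_cub_equiv {n : ℕ} (δ : Fin n → (B →+ B))
    (hδ : ∀ i j b, δ i (δ j b) = δ j (δ i b)) (k : ℕ) :
    Nonempty ((cubCx δ).H k ≃+ (KX.cx n δ).H k) := by
  refine NComplex.nonempty_H_equiv_of_surjective (C := cubCx δ) (D := KX.cx n δ)
    (cubCx_isComplex δ hδ) (fun k => AddMonoidHom.mk' (toKX n k) (toKX_add n k)) (toKX_cubD n δ)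
    (toKX_surjective n) (fun k f hf _ => ⟨0, map_zero _, ?_⟩) k
  rw [map_zero]
  refine toKX_injective n k ?_
  exact (map_zero (AddMonoidHom.mk' (toKX (B := B) n k) (toKX_add n _))).trans hf.symm

end Cubical

/-! ### Bredon cochains as cubical cochains of equivariant functions -/

noncomputable section Bredon

theorem CubicalGCW.map_boundaryZ_single {G X V : Type} [Group G] [TopologicalSpace X]
    [MulAction G X] [AddCommGroup V] (K : CubicalGCW G X) {d : ℕ}
    (ψ : (K.Cell d →₀ ℤ) →ₗ[ℤ] V) (c : K.Cell (d + 1)) :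
    ψ (K.boundaryZ d (Finsupp.single c 1)) = ∑ i : Fin (d + 1), (-1 : ℤ) ^ (i : ℕ) •
      (ψ (Finsupp.single (K.face c i true) 1) - ψ (Finsupp.single (K.face c i false) 1)) := by
  simp [CubicalGCW.boundaryZ]

variable {V : Type} [AddCommGroup V] (ρ : Representation ℤ Z3 V)

/-- The generator of the cyclic group. -/
abbrev genZ3 : Z3 := Multiplicative.ofAdd 1

/-- The action of the generator. -/
abbrev genAct : V →+ V := (ρ genZ3).toAddMonoidHom

/-- `EqFun` imposes equivariance only for the generator; every element of the group is a power of
it. -/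
theorem EqFun.apply_smul {n : ℕ} (f : EqFun (genAct ρ) n) (g : Z3) (p : Fin n → ZMod 3) :
    f.1 ((fun _ => Multiplicative.toAdd g) + p) = ρ g (f.1 p) := by
  have h1 : ∀ p, f.1 (p + 1) = ρ genZ3 (f.1 p) := f.2
  have key : ∀ m : ℕ, f.1 ((m : Fin n → ZMod 3) + p) = ρ (genZ3 ^ m) (f.1 p) := by
    intro m
    induction m with
    | zero => simp
    | succ m ih =>
      rw [pow_succ', map_mul, Module.End.mul_apply, ← ih, ← h1]
      rw [Nat.cast_succ, add_right_comm]
  obtain ⟨m, hm⟩ := ZMod.natCast_zmod_surjective (n := 3) (Multiplicative.toAdd g)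
  have hg : g = genZ3 ^ m := by
    rw [← ofAdd_nsmul, nsmul_one, hm]
    rfl
  rw [← hm, hg]
  exact key m

/-- An equivariant cochain as a family of equivariant functions. -/
def cochainToFun (n k : ℕ) :
    (torusCW n).Cochain ρ k →+ ((Fin k ↪o Fin n) → EqFun (genAct ρ) n) where
  toFun φ s := ⟨fun p => φ (show (torusCW n).Chain k from
    Finsupp.single (⟨s, p⟩ : TorusCell n k) (1 : ℤ)), fun p => by
      let ψ := (Representation.IntertwiningMap.equivLinearMapAsModule ((torusCW n).chainRep k) ρ).symm φ
      have h1 : (torusCW n).chainRep k genZ3 (Finsupp.single (⟨s, p⟩ : TorusCell n k) (1 : ℤ)) =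
          Finsupp.single (⟨s, p + 1⟩ : TorusCell n k) (1 : ℤ) := by
        refine (Finsupp.mapDomain_single (f := fun c : TorusCell n k => genZ3 • c)).trans ?_
        congr 1
        exact TorusCell.ext rfl (add_comm _ _)
      have h2 := Representation.IntertwiningMap.isIntertwining _ _ ψ genZ3 (Finsupp.single (⟨s, p⟩ : TorusCell n k) (1 : ℤ))
      rw [h1] at h2
      exact h2⟩
  map_zero' := rfl
  map_add' _ _ := rfl

theorem cochainToFun_injective (n k : ℕ) : Function.Injective (cochainToFun ρ n k) := by
  intro φ φ' h
  let E := Representation.IntertwiningMap.equivLinearMapAsModule ((torusCW n).chainRep k) ρ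
  refine E.symm.injective (Representation.IntertwiningMap.ext ?_)
  refine Finsupp.lhom_ext' fun c => LinearMap.ext_ring ?_
  exact congrFun (congrArg Subtype.val (congrFun h c.dir)) c.pos

/-- The cells are a `ℤ`-basis of the chains, so arbitrary values on them extend linearly;
equivariance of the functions in `p` is what makes the extension `Λ`-linear. -/
theorem cochainToFun_surjective (n k : ℕ) : Function.Surjective (cochainToFun ρ n k) := by
  intro F
  let L : (TorusCell n k →₀ ℤ) →ₗ[ℤ] V :=
    Finsupp.linearCombination ℤ fun c => (F c.dir).1 c.pos
  have hL : ∀ (g : Z3) (x), L ((torusCW n).chainRep k g x) = ρ g (L x) := by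
    intro g x
    have : L ∘ₗ (torusCW n).chainRep k g = ρ g ∘ₗ L := by
      refine Finsupp.lhom_ext' fun c => LinearMap.ext_ring ?_
      have h1 : (torusCW n).chainRep k g (Finsupp.single c (1 : ℤ)) =
          Finsupp.single (g • c) (1 : ℤ) :=
        Finsupp.mapDomain_single (f := fun c : TorusCell n k => g • c)
      change L ((torusCW n).chainRep k g (Finsupp.single c (1 : ℤ))) =
        ρ g (L (Finsupp.single c (1 : ℤ)))
      rw [h1]
      have h2 : ∀ c : TorusCell n k, L (Finsupp.single c (1 : ℤ)) = (F c.dir).1 c.pos := fun c =>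
        (Finsupp.linearCombination_single ℤ (1 : ℤ) c).trans (one_smul ℤ _)
      exact (h2 (g • c)).trans ((EqFun.apply_smul ρ (F c.dir) g c.pos).trans
        (congrArg (ρ g) (h2 c).symm))
    exact LinearMap.congr_fun this x
  refine ⟨Representation.IntertwiningMap.equivLinearMapAsModule ((torusCW n).chainRep k) ρ
    (LinearMap.intertwiningMap_of_isIntertwiningMap _ _ L hL), ?_⟩
  funext s
  refine Subtype.ext (funext fun p => ?_)
  change L (Finsupp.single (⟨s, p⟩ : TorusCell n k) (1 : ℤ)) = _
  simp [L]

/-- The two facets of a cell in the direction `s i` differ by the translation of `p` by the unit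
vector of that direction, so evaluating on the boundary produces difference operators. -/
theorem cochainToFun_coboundary (n k : ℕ) (φ : (torusCW n).Cochain ρ k) :
    cochainToFun ρ n (k + 1) ((torusCW n).coboundary ρ k φ) =
      cubD (EqFun.diff (genAct ρ)) k (cochainToFun ρ n k φ) := by
  let ψ : (TorusCell n k →₀ ℤ) →ₗ[ℤ] V := ((Representation.IntertwiningMap.equivLinearMapAsModule
    ((torusCW n).chainRep k) ρ).symm φ).toLinearMap
  funext s
  refine Subtype.ext (funext fun p => ?_)
  change ψ ((torusCW n).boundaryZ k (Finsupp.single (⟨s, p⟩ : TorusCell n (k + 1)) (1 : ℤ))) =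
    (∑ i : Fin (k + 1), (-1 : ℤ) ^ (i : ℕ) • EqFun.diff (genAct ρ) (s i)
      (cochainToFun ρ n k φ ((Fin.succAboveOrderEmb i).trans s)) : EqFun (genAct ρ) n).1 p
  refine (CubicalGCW.map_boundaryZ_single (torusCW n) ψ (⟨s, p⟩ : TorusCell n (k + 1))).trans ?_
  rw [AddSubgroup.val_finsetSum, Finset.sum_apply]
  refine Finset.sum_congr rfl fun i _ => ?_
  refine congrArg (fun v => (-1 : ℤ) ^ (i : ℕ) • v) ?_
  refine congrArg₂ (fun a b : V => a - b) rfl ?_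
  exact congrArg (fun q => ψ (Finsupp.single (⟨_, q⟩ : TorusCell n k) (1 : ℤ))) (add_zero p)

/-- The Bredon cohomology of the torus. -/
theorem nonempty_bredon_equiv {M : Type} [AddCommGroup M] (π : V →+ M)
    (hinj : ∀ v, ρ genZ3 v = v → v = 0) (hπ : Function.Surjective π)
    (hker : ∀ v, π v = 0 ↔ ∃ w, ρ genZ3 w - w = v) (n k : ℕ) :
    Nonempty ((torusCW (n + 1)).BredonCohomology ρ (k + 1) ≃+ (Fin (n.choose k) → M)) := by
  have hT : ∀ v, genAct ρ (genAct ρ (genAct ρ v)) = v := fun v => by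
    change ρ genZ3 (ρ genZ3 (ρ genZ3 v)) = v
    rw [← Module.End.mul_apply, ← Module.End.mul_apply, ← map_mul, ← map_mul]
    have : genZ3 * genZ3 * genZ3 = 1 := rfl
    rw [this, map_one]
    rfl
  let C : NComplex := ⟨(torusCW (n + 1)).Cochain ρ, (torusCW (n + 1)).coboundary ρ⟩
  let D := cubCx (EqFun.diff (n := n + 1) (genAct ρ))
  have hD : D.IsComplex := cubCx_isComplex _ (EqFun.diff_comm _)
  have hC : C.IsComplex := fun k φ => by
    refine cochainToFun_injective ρ _ _ ?_
    refine (cochainToFun_coboundary ρ _ _ _).trans ?_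
    rw [map_zero]
    refine (congrArg _ (cochainToFun_coboundary ρ _ _ _)).trans ?_
    exact hD k _
  obtain ⟨e1⟩ := NComplex.nonempty_H_equiv_of_surjective (C := C) (D := D) hC
    (cochainToFun ρ (n + 1)) (cochainToFun_coboundary ρ (n + 1))
    (cochainToFun_surjective ρ (n + 1)) (fun k φ hφ _ => ⟨0, map_zero _, by
      rw [map_zero]
      exact (cochainToFun_injective ρ _ _ (hφ.trans (map_zero _).symm)).symm⟩) (k + 1)
  obtain ⟨e2⟩ := nonempty_H_cub_equiv (EqFun.diff (n := n + 1) (genAct ρ)) (EqFun.diff_comm _) (k + 1)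
  obtain ⟨e3⟩ := nonempty_H_eqFun (genAct ρ) hT hinj π hπ hker n k
  obtain ⟨e4⟩ := nonempty_H_torus M n k
  exact ⟨e1.trans (e2.trans (e3.trans e4))⟩

end Bredon

/-! ### Approximation by differentiable maps -/

/-- A `C¹` function that vanishes near `0` and is the identity away from `0`. -/
theorem exists_contDiff_threshold {ε : ℝ} (hε : 0 < ε) :
    ∃ T : ℝ → ℝ, ContDiff ℝ 1 T ∧ (∀ x, |x| ≤ ε → T x = 0) ∧ ∀ x, |T x - x| ≤ 2 * ε := by
  -- The transition factor is `0` for `|x| ≤ ε` and `1` for `|x| ≥ 2 * ε`, so `x` is changed only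
  -- where it is small.
  refine ⟨fun x => Real.smoothTransition (x ^ 2 / ε ^ 2 - 1) * x, ?_, fun x hx => ?_, fun x => ?_⟩
  · exact (Real.smoothTransition.contDiff.comp (by fun_prop)).mul contDiff_id
  · have : x ^ 2 / ε ^ 2 - 1 ≤ 0 := by
      rw [sub_nonpos, div_le_one (by positivity)]
      exact sq_le_sq' (abs_le.1 hx).1 (abs_le.1 hx).2
    simp only [Real.smoothTransition.zero_of_nonpos this, zero_mul]
  · rcases le_total |x| (2 * ε) with h | h
    · have h0 := Real.smoothTransition.nonneg (x ^ 2 / ε ^ 2 - 1)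
      have h1 := Real.smoothTransition.le_one (x ^ 2 / ε ^ 2 - 1)
      have : Real.smoothTransition (x ^ 2 / ε ^ 2 - 1) * x - x =
        -((1 - Real.smoothTransition (x ^ 2 / ε ^ 2 - 1)) * x) := by ring
      rw [this, abs_neg, abs_mul, abs_of_nonneg (by linarith)]
      calc _ ≤ 1 * |x| := by gcongr; linarith
        _ ≤ 2 * ε := by rwa [one_mul]
    · have : 1 ≤ x ^ 2 / ε ^ 2 - 1 := by
        rw [le_sub_iff_add_le, le_div_iff₀ (by positivity), ← sq_abs x]
        nlinarith
      simp only [Real.smoothTransition.one_of_one_le this, one_mul, sub_self, abs_zero]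
      positivity

section Approx

variable {K E : Type*} [TopologicalSpace K] [CompactSpace K] [NormedAddCommGroup E]
  [NormedSpace ℝ E] {j : K → E}

/-- Stone–Weierstrass for the algebra of functions on `K` that extend along `j` to differentiable
ones; it separates points by continuous linear functionals. Composing with a threshold function then
makes the approximation vanish exactly where `φ` does, which later preserves boundary conditions. -/
theorem exists_contDiff_approx (hj : Continuous j) (hinj : Function.Injective j) (φ : C(K, ℝ))
    {ε : ℝ} (hε : 0 < ε) : ∃ q : E → ℝ, ContDiff ℝ 1 q ∧ (∀ x, |q (j x) - φ x| < ε) ∧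
      ∀ x, φ x = 0 → q (j x) = 0 := by
  let A : Subalgebra ℝ C(K, ℝ) :=
    { carrier := {f | ∃ q : E → ℝ, ContDiff ℝ 1 q ∧ ∀ x, q (j x) = f x}
      mul_mem' := by
        rintro f g ⟨q, hq, h⟩ ⟨q', hq', h'⟩
        exact ⟨fun x => q x * q' x, hq.mul hq', fun x => by simp [h, h']⟩
      add_mem' := by
        rintro f g ⟨q, hq, h⟩ ⟨q', hq', h'⟩
        exact ⟨fun x => q x + q' x, hq.add hq', fun x => by simp [h, h']⟩
      algebraMap_mem' := fun r => ⟨fun _ => r, contDiff_const, fun x => rfl⟩ }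
  have hA : A.SeparatesPoints := by
    intro x y hxy
    obtain ⟨f, hf⟩ := SeparatingDual.exists_separating_of_ne (R := ℝ) (hinj.ne hxy)
    exact ⟨fun x => f (j x), ⟨⟨fun x => f (j x), f.continuous.comp hj⟩,
      ⟨f, f.contDiff, fun x => rfl⟩, rfl⟩, hf⟩
  -- The error is below `ε / 4` from the approximation plus at most `ε / 2` from the threshold.
  obtain ⟨T, hT, hT0, hT1⟩ := exists_contDiff_threshold (ε := ε / 4) (by positivity)
  have hd := ContinuousMap.subalgebra_topologicalClosure_eq_top_of_separatesPoints A hA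
  have hφ : φ ∈ closure (A : Set C(K, ℝ)) := by
    rw [← Subalgebra.topologicalClosure_coe, hd]
    trivial
  obtain ⟨f, ⟨q, hq, hqf⟩, hf⟩ := Metric.mem_closure_iff.1 hφ (ε / 4) (by positivity)
  have hd : ∀ x, |q (j x) - φ x| < ε / 4 := fun x => by
    rw [hqf, ← Real.dist_eq, dist_comm]
    exact (ContinuousMap.dist_apply_le_dist x).trans_lt hf
  refine ⟨fun x => T (q x), hT.comp hq, fun x => ?_, fun x hx => ?_⟩
  · have h1 := hT1 (q (j x))
    calc |T (q (j x)) - φ x| = |(T (q (j x)) - q (j x)) + (q (j x) - φ x)| := by ring_nf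
      _ ≤ |T (q (j x)) - q (j x)| + |q (j x) - φ x| := abs_add_le _ _
      _ < ε := by linarith [hd x]
  · have := hd x
    rw [hx, sub_zero] at this
    exact hT0 _ this.le

theorem exists_contDiff_approx_pi {ι : Type*} [Fintype ι] (hj : Continuous j)
    (hinj : Function.Injective j) (φ : C(K, ι → ℝ)) {ε : ℝ} (hε : 0 < ε) :
    ∃ q : E → ι → ℝ, ContDiff ℝ 1 q ∧ (∀ x i, |q (j x) i - φ x i| < ε) ∧
      ∀ x i, φ x i = 0 → q (j x) i = 0 := by
  choose q hq h1 h2 using fun i => exists_contDiff_approx hj hinj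
    (⟨fun x => φ x i, by fun_prop⟩ : C(K, ℝ)) hε
  exact ⟨fun x i => q i x, contDiff_pi.2 hq, fun x i => h1 i x, fun x i => h2 i x⟩

end Approx

/-! ### Transport along the fibres of a family of projections, and logarithms -/

section Transport

variable {K : Type*} [MetricSpace K] [CompactSpace K]

/-- The points of a subdivision of the interval. -/
theorem exists_subdivision {Z : Type*} [PseudoMetricSpace Z] (f : I × K → Z) (hf : Continuous f)
    {ε : ℝ} (hε : 0 < ε) : ∃ (N : ℕ) (τ : ℕ → I → I), (∀ k, Continuous (τ k)) ∧
      (∀ s, τ 0 s = 0) ∧ (∀ s, τ N s = s) ∧ (∀ k, τ k 0 = 0) ∧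
      ∀ k s x, dist (f (τ k s, x)) (f (τ (k + 1) s, x)) < ε := by
  obtain ⟨δ, hδ, h⟩ := Metric.uniformContinuous_iff.1
    (CompactSpace.uniformContinuous_of_continuous hf) ε hε
  obtain ⟨n, hn⟩ := exists_nat_one_div_lt hδ
  let p : ℕ → I := fun k => Set.projIcc 0 1 zero_le_one ((k : ℝ) / (n + 1))
  have hp0 : p 0 = 0 := by simp [p]
  have hp1 : p (n + 1) = 1 := by
    simp only [p]
    rw [show (((n + 1 : ℕ) : ℝ) / (n + 1)) = 1 by push_cast; field_simp]
    exact Set.projIcc_right (zero_le_one (α := ℝ))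
  -- The subdivision points are cut off at `s`, so for every `s` the sequence runs from `0` to `s`
  -- in steps of length at most `1 / (n + 1)`.
  refine ⟨n + 1, fun k s => min s (p k), fun k => by fun_prop, fun s => ?_, fun s => ?_,
    fun k => ?_, fun k s x => ?_⟩
  · change min s (p 0) = 0
    rw [hp0]; exact min_eq_right s.2.1
  · change min s (p (n + 1)) = s
    rw [hp1]; exact min_eq_left s.2.2
  · exact min_eq_left (p k).2.1
  · refine h ?_
    rw [Prod.dist_eq, dist_self, max_lt_iff]
    refine ⟨lt_of_le_of_lt ?_ hn, hδ⟩
    rw [Subtype.dist_eq, Real.dist_eq]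
    have h1 : |((min s (p k) : I) : ℝ) - (min s (p (k + 1)) : I)| ≤ |(p k : ℝ) - p (k + 1)| := by
      have h2 := abs_min_sub_min_le_max (s : ℝ) (p k) s (p (k + 1))
      rw [sub_self, abs_zero, max_eq_right (abs_nonneg _)] at h2
      exact h2
    refine h1.trans ((Set.abs_projIcc_sub_projIcc zero_le_one).trans_eq ?_)
    rw [← sub_div, abs_div]
    push_cast
    rw [sub_add_cancel_left, abs_neg, abs_one, abs_of_pos (by positivity)]

/-- A discrete parallel transport: a vector in the image at time `0` is projected successively to
the images at the subdivision times. Consecutive projections differ by less than `1` in norm, so a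
nonzero vector in the image of one is not killed by the next. Where the family is constant in time
the vector does not move. -/
theorem exists_transport {F : Type*} [NormedAddCommGroup F] [NormedSpace ℂ F]
    (P : I × K → F →L[ℂ] F) (hP : Continuous P) (hPP : ∀ a v, P a (P a v) = P a v) (v₀ : K → F)
    (hv₀ : Continuous v₀) (h₀ : ∀ x, P (0, x) (v₀ x) = v₀ x ∧ v₀ x ≠ 0) :
    ∃ v : I × K → F, Continuous v ∧ (∀ a, P a (v a) = v a ∧ v a ≠ 0) ∧
      (∀ x, v (0, x) = v₀ x) ∧ ∀ x, (∀ s, P (s, x) = P (0, x)) → ∀ s, v (s, x) = v₀ x := by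
  obtain ⟨N, τ, hτ, hτ0, hτN, hτz, hd⟩ := exists_subdivision P hP one_pos
  have key : ∀ k, ∃ v : I × K → F, Continuous v ∧
      (∀ s x, P (τ k s, x) (v (s, x)) = v (s, x) ∧ v (s, x) ≠ 0) ∧ (∀ x, v (0, x) = v₀ x) ∧
      ∀ x, (∀ s, P (s, x) = P (0, x)) → ∀ s, v (s, x) = v₀ x := by
    intro k
    induction k with
    | zero =>
      exact ⟨fun a => v₀ a.2, hv₀.comp continuous_snd, fun s x => by rw [hτ0]; exact h₀ x,
        fun x => rfl, fun x _ s => rfl⟩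
    | succ k ih =>
      obtain ⟨v, h1, h2, h3, h4⟩ := ih
      refine ⟨fun a => P (τ (k + 1) a.1, a.2) (v a), ?_, fun s x => ⟨hPP _ _, fun h => ?_⟩,
        fun x => ?_, fun x hx s => ?_⟩
      · have := hτ (k + 1)
        exact (hP.comp (by fun_prop)).clm_apply h1
      · have h5 := hd k s x
        rw [dist_eq_norm] at h5
        have h6 : (P (τ k s, x) - P (τ (k + 1) s, x)) (v (s, x)) = v (s, x) := by
          rw [sub_apply, (h2 s x).1]
          exact sub_eq_self.2 h
        have h7 := (P (τ k s, x) - P (τ (k + 1) s, x)).le_opNorm (v (s, x))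
        rw [h6] at h7
        have h8 : 0 < ‖v (s, x)‖ := norm_pos_iff.2 (h2 s x).2
        nlinarith
      · change P (τ (k + 1) 0, x) (v (0, x)) = _
        rw [hτz, h3]
        exact (h₀ x).1
      · change P (τ (k + 1) s, x) (v (s, x)) = _
        rw [h4 x hx, hx]
        exact (h₀ x).1
  obtain ⟨v, h1, h2, h3, h4⟩ := key N
  exact ⟨v, h1, fun a => by have := h2 a.1 a.2; rwa [hτN] at this, h3, h4⟩

/-- The logarithm is continued in time by adding principal logarithms of quotients of successive
values. The subdivision is finer than the minimum of `‖f‖`, so these quotients lie within distance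
`1` of `1`, inside the slit plane. -/
theorem exists_log (f : I × K → ℂ) (hf : Continuous f) (hf0 : ∀ a, f a ≠ 0) (h₀ : K → ℂ)
    (hh₀ : Continuous h₀) (h : ∀ x, Complex.exp (h₀ x) = f (0, x)) :
    ∃ l : I × K → ℂ, Continuous l ∧ (∀ a, Complex.exp (l a) = f a) ∧
      (∀ x, l (0, x) = h₀ x) ∧ ∀ x, (∀ s, f (s, x) = f (0, x)) → ∀ s, l (s, x) = h₀ x := by
  obtain ⟨m, hm, hmf⟩ : ∃ m > 0, ∀ a, m ≤ ‖f a‖ := by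
    rcases isEmpty_or_nonempty K with hK | hK
    · exact ⟨1, one_pos, fun a => (hK.false a.2).elim⟩
    · obtain ⟨a, -, ha⟩ := (isCompact_univ (X := I × K)).exists_isMinOn Set.univ_nonempty
        hf.norm.continuousOn
      exact ⟨‖f a‖, norm_pos_iff.2 (hf0 a), fun b => ha (Set.mem_univ b)⟩
  obtain ⟨N, τ, hτ, hτ0, hτN, hτz, hd⟩ := exists_subdivision f hf hm
  have key : ∀ k, ∃ l : I × K → ℂ, Continuous l ∧
      (∀ s x, Complex.exp (l (s, x)) = f (τ k s, x)) ∧ (∀ x, l (0, x) = h₀ x) ∧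
      ∀ x, (∀ s, f (s, x) = f (0, x)) → ∀ s, l (s, x) = h₀ x := by
    intro k
    induction k with
    | zero =>
      exact ⟨fun a => h₀ a.2, hh₀.comp continuous_snd, fun s x => by rw [hτ0]; exact h x,
        fun x => rfl, fun x _ s => rfl⟩
    | succ k ih =>
      obtain ⟨l, h1, h2, h3, h4⟩ := ih
      refine ⟨fun a => l a + Complex.log (f (τ (k + 1) a.1, a.2) / f (τ k a.1, a.2)), ?_,
        fun s x => ?_, fun x => ?_, fun x hx s => ?_⟩
      · have e1 := hτ (k + 1)
        have e2 := hτ k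
        refine h1.add (Continuous.clog ?_ fun a => ?_)
        · exact (hf.comp (by fun_prop)).div (hf.comp (by fun_prop)) fun a => hf0 _
        · left
          have h5 := hd k a.1 a.2
          rw [dist_eq_norm] at h5
          have h6 : ‖f (τ (k + 1) a.1, a.2) / f (τ k a.1, a.2) - 1‖ < 1 := by
            rw [div_sub_one (hf0 _), norm_div, div_lt_one (norm_pos_iff.2 (hf0 _)), norm_sub_rev]
            exact h5.trans_le (hmf _)
          have h7 := (Complex.abs_re_le_norm _).trans_lt h6
          rw [Complex.sub_re, Complex.one_re, abs_lt] at h7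
          linarith [h7.1]
      · change Complex.exp (l (s, x) + _) = _
        rw [Complex.exp_add, h2, Complex.exp_log (div_ne_zero (hf0 _) (hf0 _)),
          mul_div_cancel₀ _ (hf0 _)]
      · change l (0, x) + Complex.log (f (τ (k + 1) 0, x) / f (τ k 0, x)) = _
        rw [hτz, hτz, div_self (hf0 _), Complex.log_one, add_zero, h3]
      · change l (s, x) + Complex.log (f (τ (k + 1) s, x) / f (τ k s, x)) = _
        rw [hx, hx (τ k s), div_self (hf0 _), Complex.log_one, add_zero, h4 x hx]
  obtain ⟨l, h1, h2, h3, h4⟩ := key N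
  exact ⟨l, h1, fun a => by have := h2 a.1 a.2; rwa [hτN] at this, h3, h4⟩

end Transport

/-! ### Spheres in a complex with cells of high dimension attached -/

/-- A family of maps on the square, each of them constant on the boundary of the square. -/
def BoundaryConst {X : Type*} (f : I × (Fin 2 → I) → X) : Prop :=
  ∀ s, ∀ b ∈ Cube.boundary (Fin 2), ∀ b' ∈ Cube.boundary (Fin 2), f (s, b) = f (s, b')

theorem zero_mem_boundary : (0 : Fin 2 → I) ∈ Cube.boundary (Fin 2) := ⟨0, Or.inl rfl⟩

/-- The value at a boundary point and the deviation from it are approximated separately. The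
deviation vanishes on the boundary and its approximation is kept zero there, so constancy survives.
The result is differentiable on a three-dimensional space, hence its image in dimension `m ≥ 4` has
dense complement. -/
theorem BoundaryConst.exists_approx {m : ℕ} (hm : 4 ≤ m) {φ : C(I × (Fin 2 → I), Fin m → ℝ)}
    (hφ : BoundaryConst φ) {ε : ℝ} (hε : 0 < ε) :
    ∃ q : C(I × (Fin 2 → I), Fin m → ℝ), BoundaryConst q ∧ (∀ x, ‖q x - φ x‖ < ε) ∧
      Dense (Set.range q)ᶜ := by
  let j : I × (Fin 2 → I) → ℝ × (Fin 2 → ℝ) := fun x => (x.1, fun i => x.2 i)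
  have hj : Continuous j := by fun_prop
  have hj' : Function.Injective j := by
    rintro ⟨s, t⟩ ⟨s', t'⟩ h
    simp only [j, Prod.mk.injEq] at h
    exact Prod.ext (Subtype.ext h.1) (funext fun i => Subtype.ext (congrFun h.2 i))
  obtain ⟨q, hq, hq1, -⟩ := exists_contDiff_approx_pi (K := I) (E := ℝ) continuous_subtype_val
    Subtype.val_injective (⟨fun s => φ (s, 0), by fun_prop⟩ : C(I, Fin m → ℝ)) (half_pos hε)
  obtain ⟨p, hp, hp1, hp2⟩ := exists_contDiff_approx_pi hj hj'
    (⟨fun x => φ x - φ (x.1, 0), by fun_prop⟩ : C(I × (Fin 2 → I), Fin m → ℝ)) (half_pos hε)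
  have hF : ContDiff ℝ 1 fun x : ℝ × (Fin 2 → ℝ) => q x.1 + p x :=
    (hq.comp contDiff_fst).add hp
  refine ⟨⟨fun x => q x.1 + p (j x), ?_⟩, fun s b hb b' hb' => ?_, fun x => ?_, ?_⟩
  · exact (hq.continuous.comp (by fun_prop)).add (hp.continuous.comp hj)
  · have key : ∀ b ∈ Cube.boundary (Fin 2), p (j (s, b)) = 0 := fun b hb => funext fun i =>
      hp2 _ i (by
        change (φ (s, b) - φ (s, 0)) i = 0
        rw [hφ s b hb 0 zero_mem_boundary, sub_self, Pi.zero_apply])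
    change q s + p (j (s, b)) = q s + p (j (s, b'))
    rw [key b hb, key b' hb']
  · refine (pi_norm_lt_iff hε).2 fun i => ?_
    have h1 := hq1 x.1 i
    have h2 := hp1 x i
    change |q x.1 i - φ (x.1, 0) i| < _ at h1
    change |p (j x) i - (φ x i - φ (x.1, 0) i)| < _ at h2
    change |q x.1 i + p (j x) i - φ x i| < _
    rw [abs_lt] at *
    constructor <;> linarith
  · refine (hF.dense_compl_range_of_finrank_lt_finrank ?_).mono (Set.compl_subset_compl.2 ?_)
    · simp only [Module.finrank_prod, Module.finrank_self, Module.finrank_fin_fun]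
      lia
    · rintro _ ⟨x, rfl⟩
      exact ⟨j x, rfl⟩

/-! ### Radial deformations of the cube -/

namespace CubeCoord

variable {m : ℕ}

/-- The cube `[0,1]^m` as the unit ball of the supremum norm. -/
def toBall (t : Fin m → I) : Fin m → ℝ := fun i => 2 * t i - 1

/-- The retraction of `ℝ^m` to the cube. -/
noncomputable def ofBall (u : Fin m → ℝ) : Fin m → I := fun i => Set.projIcc 0 1 zero_le_one ((u i + 1) / 2)

theorem continuous_toBall : Continuous (toBall (m := m)) := by
  unfold toBall; fun_prop

theorem continuous_ofBall : Continuous (ofBall (m := m)) := by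
  unfold ofBall; exact continuous_pi fun i => continuous_projIcc.comp (by fun_prop)

theorem ofBall_toBall (t : Fin m → I) : ofBall (toBall t) = t := by
  funext i
  simp only [ofBall, toBall]
  rw [show (2 * (t i : ℝ) - 1 + 1) / 2 = t i by ring]
  exact Set.projIcc_val _ _

theorem norm_toBall_le (t : Fin m → I) : ‖toBall t‖ ≤ 1 := by
  refine (pi_norm_le_iff_of_nonneg zero_le_one).2 fun i => ?_
  have h := (t i).2
  rw [Real.norm_eq_abs, abs_le, toBall]
  constructor <;> linarith [h.1, h.2]

theorem norm_toBall_of_mem {t : Fin m → I} (ht : t ∈ Cube.boundary (Fin m)) : ‖toBall t‖ = 1 := by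
  refine le_antisymm (norm_toBall_le t) ?_
  obtain ⟨i, hi⟩ := ht
  refine le_trans ?_ (norm_le_pi_norm _ i)
  rcases hi with hi | hi <;> norm_num [toBall, hi]

theorem ofBall_mem {u : Fin m → ℝ} (hu : ‖u‖ = 1) : ofBall u ∈ Cube.boundary (Fin m) := by
  obtain ⟨i, hi⟩ : ∃ i, 1 ≤ ‖u i‖ := by
    by_contra! h
    exact ((pi_norm_lt_iff one_pos).2 h).ne hu
  rw [Real.norm_eq_abs, le_abs] at hi
  refine ⟨i, hi.symm.imp (fun h => ?_) fun h => ?_⟩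
  · exact Set.projIcc_of_le_left _ (by linarith)
  · exact Set.projIcc_of_right_le _ (by linarith)

/-- A cutoff function that is `1` on `[0, 1/2]` and `0` on `[3/4, ∞)`. -/
noncomputable def cutoff (r : ℝ) : ℝ := max 0 (min 1 (3 - 4 * r))

theorem continuous_cutoff : Continuous cutoff := by unfold cutoff; fun_prop

theorem cutoff_of_le {r : ℝ} (h : r ≤ 1 / 2) : cutoff r = 1 := by
  unfold cutoff
  rw [min_eq_left (by linarith), max_eq_right zero_le_one]

theorem cutoff_of_ge {r : ℝ} (h : 3 / 4 ≤ r) : cutoff r = 0 :=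
  max_eq_left (min_le_of_right_le (by linarith))

theorem cutoff_nonneg (r : ℝ) : 0 ≤ cutoff r := le_max_left _ _

theorem cutoff_le_one (r : ℝ) : cutoff r ≤ 1 := max_le zero_le_one (min_le_left _ _)

/-- The radial push: the deformation of the ball that moves `u` towards the normalization of
`u + e`, where `e` is cut off near the boundary. -/
noncomputable def push (δ s : ℝ) (e u : Fin m → ℝ) : Fin m → ℝ :=
  -- The bound `δ` only keeps the formula continuous; where the push is used the norm is at least
  -- `δ`, and at `s = 1` the vector is normalized exactly.
  (1 - s) • u + s • ((max ‖u + cutoff ‖u‖ • e‖ δ)⁻¹ • (u + cutoff ‖u‖ • e))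

theorem continuous_push {δ : ℝ} (hδ : 0 < δ) :
    Continuous fun x : (ℝ × (Fin m → ℝ)) × (Fin m → ℝ) => push δ x.1.1 x.1.2 x.2 := by
  have h : Continuous fun x : (ℝ × (Fin m → ℝ)) × (Fin m → ℝ) =>
      x.2 + cutoff ‖x.2‖ • x.1.2 :=
    continuous_snd.add ((continuous_cutoff.comp (by fun_prop)).smul (by fun_prop))
  unfold push
  have h' := (h.norm.max continuous_const).inv₀ fun x => (lt_max_of_lt_right hδ).ne'
  have hs : Continuous fun x : (ℝ × (Fin m → ℝ)) × (Fin m → ℝ) => x.1.1 := by fun_prop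
  exact ((continuous_const.sub hs).smul continuous_snd).add (hs.smul (h'.smul h))

theorem continuous_ofBall_push {δ : ℝ} (hδ : 0 < δ) :
    Continuous fun x : (Fin m → I) × (ℝ × (Fin m → ℝ)) =>
      ofBall (push δ x.2.1 x.2.2 (toBall x.1)) := by
  have h : Continuous fun x : (Fin m → I) × (ℝ × (Fin m → ℝ)) => (x.2, toBall x.1) :=
    continuous_snd.prodMk (continuous_toBall.comp continuous_fst)
  exact continuous_ofBall.comp ((continuous_push hδ).comp h)

theorem push_zero (δ : ℝ) (e u : Fin m → ℝ) : push δ 0 e u = u := by simp [push]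

theorem push_of_norm_eq_one {δ : ℝ} (hδ : δ ≤ 1) (s : ℝ) (e : Fin m → ℝ) {u : Fin m → ℝ}
    (hu : ‖u‖ = 1) : push δ s e u = u := by
  rw [push, hu, cutoff_of_ge (by norm_num), zero_smul, add_zero, hu, max_eq_left hδ, inv_one,
    one_smul, ← add_smul, sub_add_cancel, one_smul]

theorem norm_push_one {δ : ℝ} (hδ : 0 < δ) {e u : Fin m → ℝ} (h : δ ≤ ‖u + cutoff ‖u‖ • e‖) :
    ‖push δ 1 e u‖ = 1 := by
  rw [push, sub_self, zero_smul, zero_add, one_smul, max_eq_left h, norm_smul, norm_inv,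
    norm_norm, inv_mul_cancel₀ (hδ.trans_le h).ne']

end CubeCoord

/-! ### The topology of attached cells, and pushing spheres off them -/

namespace AttachCarrier

open CubeCoord

variable {G : Type} [Group G] {k : ℕ} {Y : PointedGSpace G} (F : GeneratingFamily k Y)

/-- The inclusion of the original space. -/
def incl (y : Y) : AttachCarrier F := Quot.mk _ (Sum.inl y)

/-- The characteristic map of a cell. -/
def cell (a : G × F.J) (t : Fin (k + 2) → I) : AttachCarrier F := Quot.mk _ (Sum.inr ⟨a, t⟩)

theorem isQuotientMap_mk : Topology.IsQuotientMap (Quot.mk (AttachRel F)) := isQuotientMap_quot_mk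

theorem continuous_incl : Continuous (incl F) := continuous_quot_mk.comp continuous_inl

theorem cell_of_mem (a : G × F.J) {t : Fin (k + 2) → I} (ht : t ∈ Cube.boundary (Fin (k + 2))) :
    cell F a t = incl F (a.1 • sphereMap (F.loop a.2) ⟨t, ht⟩) :=
  Quot.sound (AttachRel.mk a.1 a.2 ⟨t, ht⟩)

open Classical in
/-- The points of `Y` that are identified with a given point. -/
def fibre : AttachCarrier F → Set Y :=
  Quot.lift (Sum.elim (fun y => {y}) fun x => if h : x.2 ∈ Cube.boundary (Fin (k + 2)) then
    {x.1.1 • sphereMap (F.loop x.1.2) ⟨x.2, h⟩} else ∅) (by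
    rintro _ _ ⟨g, j, b⟩
    simp)

/-- Being defined on the quotient, `fibre` detects which identifications occur. The injectivity of
`incl` and its disjointness from the open cells are read off from it. -/
theorem mem_fibre {x : AttachCarrier F} {y : Y} : y ∈ fibre F x ↔ incl F y = x := by
  constructor
  · induction x using Quot.ind with
    | mk x =>
      rcases x with y' | ⟨a, t⟩
      · rintro rfl
        rfl
      · intro h
        simp only [fibre, Sum.elim_inr] at h
        split_ifs at h with ht
        · rw [Set.mem_singleton_iff] at h
          rw [h]
          exact (cell_of_mem F a ht).symm
        · exact h.elim
  · rintro rfl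
    exact rfl

theorem incl_injective : Function.Injective (incl F) := fun y y' h => by
  have : y ∈ fibre F (incl F y') := (mem_fibre F).2 h
  exact this

theorem isClosed_boundary (n : ℕ) : IsClosed (Cube.boundary (Fin n)) := by
  have : Cube.boundary (Fin n) = ⋃ i : Fin n, ({t | t i = 0} ∪ {t | t i = 1}) := by
    ext t; simp [Cube.boundary]
  rw [this]
  exact isClosed_iUnion_of_finite fun i =>
    (isClosed_eq (continuous_apply i) continuous_const).union
      (isClosed_eq (continuous_apply i) continuous_const)

theorem isClosed_iff {C : Set (AttachCarrier F)} : IsClosed C ↔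
    IsClosed (incl F ⁻¹' C) ∧ ∀ a, IsClosed (cell F a ⁻¹' C) := by
  refine (isQuotientMap_mk F).isClosed_preimage.symm.trans (isClosed_sum_iff.trans ?_)
  exact and_congr Iff.rfl isClosed_sigma_iff

/-- A closed set of `Y` meets a cell in its preimage under the attaching map, which is closed in the
boundary and so in the cube. -/
theorem isClosedEmbedding_incl : Topology.IsClosedEmbedding (incl F) := by
  refine .of_continuous_injective_isClosedMap (continuous_incl F) (incl_injective F) fun C hC => ?_
  rw [isClosed_iff, Set.preimage_image_eq _ (incl_injective F)]
  refine ⟨hC, fun a => ?_⟩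
  have hc : Continuous fun b : Cube.boundary (Fin (k + 2)) =>
    a.1 • sphereMap (F.loop a.2) b := (sphereMap (F.loop a.2)).continuous.const_smul a.1
  have : cell F a ⁻¹' (incl F '' C) = Subtype.val '' ((fun b : Cube.boundary (Fin (k + 2)) =>
      a.1 • sphereMap (F.loop a.2) b) ⁻¹' C) := by
    ext t
    constructor
    · rintro ⟨y, hy, h⟩
      have : y ∈ fibre F (cell F a t) := (mem_fibre F).2 h
      simp only [fibre, cell, Sum.elim_inr] at this
      split_ifs at this with ht
      · rw [Set.mem_singleton_iff] at this
        exact ⟨⟨t, ht⟩, by rwa [Set.mem_preimage, ← this], rfl⟩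
      · exact this.elim
    · rintro ⟨b, hb, rfl⟩
      exact ⟨_, hb, (cell_of_mem F a b.2).symm⟩
  rw [this]
  exact (isClosed_boundary _).isClosedEmbedding_subtypeVal.isClosedMap _ (hC.preimage hc)

theorem eq_incl_or_cell (x : AttachCarrier F) : (∃ y, x = incl F y) ∨
    ∃ a t, t ∉ Cube.boundary (Fin (k + 2)) ∧ x = cell F a t := by
  induction x using Quot.ind with
  | mk x =>
    rcases x with y | ⟨a, t⟩
    · exact Or.inl ⟨y, rfl⟩
    · by_cases ht : t ∈ Cube.boundary (Fin (k + 2))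
      · exact Or.inl ⟨_, cell_of_mem F a ht⟩
      · exact Or.inr ⟨a, t, ht, rfl⟩

open Classical in
/-- The points in the interiors of the cells are not identified with any other. -/
theorem cell_inj {a a' : G × F.J} {t t' : Fin (k + 2) → I} (ht : t ∉ Cube.boundary (Fin (k + 2)))
    (h : cell F a' t' = cell F a t) :
    (⟨a', t'⟩ : Σ _ : G × F.J, (Fin (k + 2) → I)) = ⟨a, t⟩ := by
  -- Being this particular interior point is a property that descends to the quotient, since only
  -- boundary points of cells are glued.
  let Φ : AttachCarrier F → Prop := Quot.lift (Sum.elim (fun _ => False) fun x => x = ⟨a, t⟩) (by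
    rintro _ _ ⟨g, j, b⟩
    simp only [Sum.elim_inr, Sum.elim_inl, eq_iff_iff, iff_false]
    intro h
    obtain ⟨-, h⟩ := Sigma.mk.inj h
    exact ht (eq_of_heq h ▸ b.2))
  have h1 : Φ (cell F a t) := rfl
  rw [← h] at h1
  exact h1

theorem incl_ne_cell {a : G × F.J} {t : Fin (k + 2) → I} (ht : t ∉ Cube.boundary (Fin (k + 2)))
    (y : Y) : incl F y ≠ cell F a t := fun h => by
  have : y ∈ fibre F (cell F a t) := (mem_fibre F).2 h
  simp only [fibre, cell, Sum.elim_inr] at this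
  rw [dif_neg ht] at this
  exact this

instance [T1Space Y] : T1Space (AttachCarrier F) where
  t1 x := by
    rcases eq_incl_or_cell F x with ⟨y, rfl⟩ | ⟨a, t, ht, rfl⟩
    · rw [← Set.image_singleton]
      exact (isClosedEmbedding_incl F).isClosedMap _ isClosed_singleton
    · rw [isClosed_iff]
      constructor
      · convert isClosed_empty
        ext y
        simpa using incl_ne_cell F ht y
      · intro a'
        by_cases h : a' = a
        · subst h
          convert isClosed_singleton (x := t)
          ext t'
          constructor
          · intro h
            obtain ⟨-, h⟩ := Sigma.mk.inj (cell_inj F ht h)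
            exact eq_of_heq h
          · rintro rfl
            rfl
        · convert isClosed_empty
          ext t'
          simp only [Set.mem_preimage, Set.mem_singleton_iff, Set.mem_empty_iff_false, iff_false]
          intro h'
          exact h (Sigma.mk.inj (cell_inj F ht h')).1

theorem continuous_cell (a : G × F.J) : Continuous (cell F a) :=
  continuous_quot_mk.comp (continuous_inr.comp continuous_sigmaMk)

/-- A product of a quotient map with a locally compact space is again a quotient map. This gives
continuity of the push jointly in the point and in its parameters. -/
theorem continuous_of_cells {P Z : Type*} [TopologicalSpace P] [LocallyCompactSpace P]
    [TopologicalSpace Z] {g : AttachCarrier F × P → Z}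
    (h : Continuous fun x : Y × P => g (incl F x.1, x.2))
    (h' : ∀ a, Continuous fun x : (Fin (k + 2) → I) × P => g (cell F a x.1, x.2)) :
    Continuous g := by
  refine (isQuotientMap_mk F).continuous_lift_prod_left ?_
  rw [← Homeomorph.sumProdDistrib.symm.comp_continuous_iff']
  refine continuous_sum_dom.2 ⟨h, ?_⟩
  rw [← Homeomorph.sigmaProdDistrib.symm.comp_continuous_iff']
  exact continuous_sigma h'

/-- Coordinates on the cells, cut off near the boundary. -/
noncomputable def coord : AttachCarrier F → Fin (k + 2) → ℝ :=
  Quot.lift (Sum.elim (fun _ => 0) fun x => cutoff ‖toBall x.2‖ • toBall x.2) (by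
    rintro _ _ ⟨g, j, b⟩
    change cutoff ‖toBall b.1‖ • toBall b.1 = 0
    rw [norm_toBall_of_mem b.2, cutoff_of_ge (by norm_num), zero_smul])

theorem coord_cell (a : G × F.J) (t : Fin (k + 2) → I) :
    coord F (cell F a t) = cutoff ‖toBall t‖ • toBall t := rfl

theorem continuous_coord : Continuous (coord F) := by
  refine continuous_quot_lift _ (Continuous.sumElim continuous_const (continuous_sigma fun a => ?_))
  exact (continuous_cutoff.comp continuous_toBall.norm).smul continuous_toBall

/-- The radial push on all the cells at once. -/
noncomputable def push {δ : ℝ} (hδ : δ ≤ 1) (p : ℝ × (Fin (k + 2) → ℝ)) : AttachCarrier F → AttachCarrier F :=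
  Quot.lift (Sum.elim (incl F) fun x => cell F x.1 (ofBall (CubeCoord.push δ p.1 p.2 (toBall x.2))))
    (by
      rintro _ _ ⟨g, j, b⟩
      change cell F _ (ofBall (CubeCoord.push δ p.1 p.2 (toBall b.1))) = _
      rw [push_of_norm_eq_one hδ _ _ (norm_toBall_of_mem b.2), ofBall_toBall]
      exact cell_of_mem F _ b.2)

theorem push_incl {δ : ℝ} (hδ : δ ≤ 1) (p : ℝ × (Fin (k + 2) → ℝ)) (y : Y) :
    push F hδ p (incl F y) = incl F y := rfl

theorem push_cell {δ : ℝ} (hδ : δ ≤ 1) (p : ℝ × (Fin (k + 2) → ℝ)) (a : G × F.J)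
    (t : Fin (k + 2) → I) : push F hδ p (cell F a t) =
      cell F a (ofBall (CubeCoord.push δ p.1 p.2 (toBall t))) := rfl

theorem push_zero {δ : ℝ} (hδ : δ ≤ 1) (e : Fin (k + 2) → ℝ) (x : AttachCarrier F) :
    push F hδ (0, e) x = x := by
  rcases eq_incl_or_cell F x with ⟨y, rfl⟩ | ⟨a, t, -, rfl⟩
  · rfl
  · rw [push_cell, CubeCoord.push_zero, ofBall_toBall]

theorem continuous_push {δ : ℝ} (hδ : 0 < δ) (hδ1 : δ ≤ 1) :
    Continuous fun x : AttachCarrier F × (ℝ × (Fin (k + 2) → ℝ)) => push F hδ1 x.2 x.1 := by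
  refine continuous_of_cells F ?_ fun a => ?_
  · simp only [push_incl]
    exact (continuous_incl F).comp continuous_fst
  · simp only [push_cell]
    exact (continuous_cell F a).comp (CubeCoord.continuous_ofBall_push hδ)

/-- A family of spheres in `Y` with cells of dimension at least `4` attached can be deformed
into `Y`. -/
theorem exists_compression (hk : 2 ≤ k) (f : C(I × (Fin 2 → I), AttachCarrier F))
    (hf : BoundaryConst f) : ∃ f' : C(I × (Fin 2 → I), Y), BoundaryConst f' ∧
      f.HomotopicRel ((⟨incl F, continuous_incl F⟩ : C(Y, AttachCarrier F)).comp f')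
        (f ⁻¹' Set.range (incl F)) := by
  obtain ⟨φ, hφf⟩ : ∃ φ : C(I × (Fin 2 → I), Fin (k + 2) → ℝ), ∀ x, φ x = coord F (f x) :=
    ⟨⟨_, (continuous_coord F).comp f.continuous⟩, fun x => rfl⟩
  have hφ : BoundaryConst φ := fun s b hb b' hb' => by rw [hφf, hφf, hf s b hb b' hb']
  -- All the cells share the coordinate map, so a single approximation serves all of them at once.
  obtain ⟨q, hq, hq1, hq2⟩ := hφ.exists_approx (by lia) (ε := 1 / 8) (by norm_num)
  obtain ⟨c, hc, hc1⟩ := Metric.dense_iff.1 hq2 0 (1 / 8) (by norm_num)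
  rw [mem_ball_zero_iff] at hc
  obtain ⟨x₀, -, hx₀⟩ := (isCompact_univ (X := I × (Fin 2 → I))).exists_isMinOn Set.univ_nonempty
    (q.continuous.sub (continuous_const (y := c))).norm.continuousOn
  have hpos : 0 < ‖q x₀ - c‖ := norm_pos_iff.2 fun h => hc1 ⟨x₀, sub_eq_zero.1 h⟩
  -- The first bound controls the push near the centres of the cells, where the pushed vector is `q
  -- - c`; the second controls it outside radius `1 / 2`.
  let δ := min ‖q x₀ - c‖ (1 / 4)
  have hδ : 0 < δ := lt_min hpos (by norm_num)
  have hδ1 : δ ≤ 1 := (min_le_right _ _).trans (by norm_num)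
  -- Chosen so that adding `e` replaces the coordinate `φ` by `q - c`, which never vanishes; `‖e‖`
  -- is below `1 / 8 + 1 / 8`.
  obtain ⟨e, hec⟩ : ∃ e : C(I × (Fin 2 → I), Fin (k + 2) → ℝ), ∀ x, e x = q x - c - φ x :=
    ⟨⟨_, (q.continuous.sub continuous_const).sub φ.continuous⟩, fun x => rfl⟩
  have he : ∀ x, ‖e x‖ < 1 / 4 := fun x => by
    rw [hec, sub_right_comm]
    linarith [norm_sub_le (q x - φ x) c, hq1 x]
  obtain ⟨H, hH⟩ : ∃ H : C(I × (I × (Fin 2 → I)), AttachCarrier F),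
      ∀ s x, H (s, x) = push F hδ1 (s, e x) (f x) := by
    have h1 : Continuous fun x : I × (I × (Fin 2 → I)) => (f x.2, ((x.1 : ℝ), e x.2)) := by
      fun_prop
    exact ⟨⟨_, (continuous_push F hδ hδ1).comp h1⟩, fun s x => rfl⟩
  have hH0 : ∀ x, H (0, x) = f x := fun x => by
    rw [hH, Set.Icc.coe_zero, push_zero]
  have hH1 : ∀ x, H (1, x) ∈ Set.range (incl F) := fun x => by
    rw [hH]
    rcases eq_incl_or_cell F (f x) with ⟨y, h⟩ | ⟨a, t, -, h⟩
    · rw [h]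
      exact ⟨y, rfl⟩
    · rw [h, push_cell]
      have hn : ‖CubeCoord.push δ ((1 : I) : ℝ) (e x) (toBall t)‖ = 1 := by
        refine norm_push_one hδ ?_
        -- Within radius `1 / 2` the cutoff is `1` and the vector is `q - c`. Outside, its norm is
        -- at least `1 / 2 - 1 / 4`.
        rcases le_total ‖toBall t‖ (1 / 2) with h' | h'
        · have h1 : φ x = toBall t := by
            rw [hφf, h, coord_cell, cutoff_of_le h', one_smul]
          have h2 : toBall t + cutoff ‖toBall t‖ • e x = q x - c := by
            rw [cutoff_of_le h', one_smul, ← h1, hec]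
            exact add_sub_cancel _ _
          rw [h2]
          exact (min_le_left _ _).trans (hx₀ (Set.mem_univ x))
        · have h1 : ‖cutoff ‖toBall t‖ • e x‖ ≤ 1 / 4 := by
            rw [norm_smul, Real.norm_of_nonneg (cutoff_nonneg _)]
            nlinarith [cutoff_le_one ‖toBall t‖, cutoff_nonneg ‖toBall t‖, he x, norm_nonneg (e x)]
          have h2 := norm_sub_le (toBall t + cutoff ‖toBall t‖ • e x) (cutoff ‖toBall t‖ • e x)
          rw [add_sub_cancel_right] at h2
          exact (min_le_right _ _).trans (by linarith)
      rw [cell_of_mem F a (ofBall_mem hn)]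
      exact ⟨_, rfl⟩
  choose f' hf' using hH1
  have hcont : Continuous f' := by
    rw [(isClosedEmbedding_incl F).isInducing.continuous_iff]
    refine (H.continuous.comp (Continuous.prodMk_right (1 : I))).congr fun x => (hf' x).symm
  refine ⟨⟨f', hcont⟩, fun s b hb b' hb' => incl_injective F ?_, ⟨?_⟩⟩
  · change incl F (f' _) = incl F (f' _)
    -- The push at `x` depends on `x` only through `f`, `q` and `φ`, all constant on the boundary of
    -- the square.
    rw [hf', hf', hH, hH, hf s b hb b' hb']
    rw [hec, hec, hq s b hb b' hb', hφ s b hb b' hb']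
  · refine ⟨⟨H, hH0, fun x => (hf' x).symm⟩, ?_⟩
    rintro s x ⟨y, hy⟩
    change H (s, x) = f x
    rw [hH, ← hy, push_incl]

end AttachCarrier

/-! ### Coordinates on the complex of three discs -/

namespace Y2

/-- The map to the disc that is the identity on each of the three discs. -/
def fold : Y2 → ℂ := Quot.lift (fun x => (x.2 : ℂ)) (by rintro _ _ ⟨i, j, z, hz⟩; rfl)

/-- The height over the disc of the `i`-th of three hemispheres, zero on the other two. -/
noncomputable def height (i : ZMod 3) : Y2 → ℝ :=
  Quot.lift (fun x => if x.1 = i then √(1 - ‖(x.2 : ℂ)‖ ^ 2) else 0) (by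
    rintro _ _ ⟨j, k, z, hz⟩
    simp [hz])

/-- The point `z` of the `i`-th disc. -/
def mk (i : ZMod 3) (z : Metric.closedBall (0 : ℂ) 1) : Y2 := Quot.mk _ ⟨i, z⟩

theorem mk_surjective (y : Y2) : ∃ i z, mk i z = y := by
  induction y using Quot.ind with
  | mk x => exact ⟨x.1, x.2, rfl⟩

theorem fold_mk (i : ZMod 3) (z : Metric.closedBall (0 : ℂ) 1) : fold (mk i z) = z := rfl

theorem height_mk (i j : ZMod 3) (z : Metric.closedBall (0 : ℂ) 1) :
    height i (mk j z) = if j = i then √(1 - ‖(z : ℂ)‖ ^ 2) else 0 := rfl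

theorem continuous_fold : Continuous fold :=
  continuous_quot_lift _ (continuous_sigma fun _ => continuous_subtype_val)

theorem continuous_height (i : ZMod 3) : Continuous (height i) := by
  refine continuous_quot_lift _ (continuous_sigma fun j => ?_)
  by_cases h : j = i
  · simp only [h, if_true]
    fun_prop
  · simp only [h, if_false]
    exact continuous_const

/-- The pairs of values that the coordinates take. -/
def IsCoord (A : ℂ) (s : ZMod 3 → ℝ) : Prop :=
  ∃ i, (∀ j ≠ i, s j = 0) ∧ 0 ≤ s i ∧ ‖A‖ ^ 2 + s i ^ 2 = 1

theorem isCoord (y : Y2) : IsCoord (fold y) fun i => height i y := by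
  obtain ⟨i, z, rfl⟩ := mk_surjective y
  have hz := mem_closedBall_zero_iff.1 z.2
  refine ⟨i, fun j hj => ?_, ?_, ?_⟩
  · change height j (mk i z) = 0
    rw [height_mk, if_neg (Ne.symm hj)]
  · change 0 ≤ height i (mk i z)
    rw [height_mk, if_pos rfl]
    exact Real.sqrt_nonneg _
  · change ‖fold (mk i z)‖ ^ 2 + height i (mk i z) ^ 2 = 1
    rw [height_mk, if_pos rfl, fold_mk, Real.sq_sqrt (by nlinarith [norm_nonneg (z : ℂ)])]
    ring

theorem IsCoord.exists_mk {A : ℂ} {s : ZMod 3 → ℝ} (h : IsCoord A s) :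
    ∃ y, fold y = A ∧ ∀ i, height i y = s i := by
  obtain ⟨i, hj, h0, h1⟩ := h
  have hA : ‖A‖ ≤ 1 := by nlinarith [norm_nonneg A, sq_nonneg (s i)]
  refine ⟨mk i ⟨A, mem_closedBall_zero_iff.2 hA⟩, rfl, fun j => ?_⟩
  rw [height_mk]
  split_ifs with h
  · subst h
    change √(1 - ‖A‖ ^ 2) = s i
    rw [← h1, add_sub_cancel_left, Real.sqrt_sq h0]
  · exact (hj j (Ne.symm h)).symm

/-- Equal coordinates on different discs force the heights to vanish, that is, a point of the common
circle, where the discs are glued. -/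
theorem ext {y y' : Y2} (h : fold y = fold y') (h' : ∀ i, height i y = height i y') :
    y = y' := by
  obtain ⟨i, z, rfl⟩ := mk_surjective y
  obtain ⟨j, z', rfl⟩ := mk_surjective y'
  obtain rfl : z = z' := Subtype.ext h
  by_cases hij : i = j
  · rw [hij]
  · have h1 := h' i
    rw [height_mk, if_pos rfl, height_mk, if_neg (Ne.symm hij)] at h1
    have hz := mem_closedBall_zero_iff.1 z.2
    have h2 := (Real.sqrt_eq_zero (by nlinarith [norm_nonneg (z : ℂ)])).1 h1
    refine Quot.sound (Glue.mk i j z ?_)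
    nlinarith [norm_nonneg (z : ℂ)]

/-- All the coordinates together. -/
noncomputable def coord (y : Y2) : ℂ × (ZMod 3 → ℝ) := (fold y, fun i => height i y)

theorem continuous_coord : Continuous coord :=
  continuous_fold.prodMk (continuous_pi continuous_height)

theorem coord_injective : Function.Injective coord := fun _ _ h =>
  ext (congrArg Prod.fst h) fun i => congrFun (congrArg Prod.snd h) i

instance : CompactSpace Y2 :=
  have : CompactSpace (Metric.closedBall (0 : ℂ) 1) :=
    isCompact_iff_compactSpace.1 (isCompact_closedBall 0 1)
  inferInstanceAs (CompactSpace (Quot Glue))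

theorem isClosedEmbedding_coord : Topology.IsClosedEmbedding coord :=
  continuous_coord.isClosedEmbedding coord_injective

instance : T2Space Y2 := isClosedEmbedding_coord.isEmbedding.t2Space

/-- Continuous maps to the complex are given by their coordinates. -/
theorem exists_lift {X : Type*} [TopologicalSpace X] {A : X → ℂ} {s : X → ZMod 3 → ℝ}
    (hA : Continuous A) (hs : Continuous s) (h : ∀ x, IsCoord (A x) (s x)) :
    ∃ f : C(X, Y2), (∀ x, fold (f x) = A x) ∧ ∀ x i, height i (f x) = s x i := by
  choose f hf hf' using fun x => (h x).exists_mk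
  refine ⟨⟨f, ?_⟩, hf, hf'⟩
  rw [isClosedEmbedding_coord.isInducing.continuous_iff]
  exact (hA.prodMk hs).congr fun x => (Prod.ext (hf x) (funext (hf' x))).symm

theorem smul_mk (g : Z3) (i : ZMod 3) (z : Metric.closedBall (0 : ℂ) 1) :
    g • mk i z = mk (Multiplicative.toAdd g + i) (rotDisc g z) := rfl

theorem fold_smul (g : Z3) (y : Y2) : fold (g • y) = rot g * fold y := by
  obtain ⟨i, z, rfl⟩ := mk_surjective y
  rfl

theorem height_smul (g : Z3) (i : ZMod 3) (y : Y2) :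
    height (Multiplicative.toAdd g + i) (g • y) = height i y := by
  obtain ⟨j, z, rfl⟩ := mk_surjective y
  rw [smul_mk, height_mk, height_mk, rotDisc, norm_mul, Circle.norm_coe, one_mul]
  simp only [add_right_inj]

theorem fold_base : fold Y2.base = 1 := rfl

theorem height_base (i : ZMod 3) : height i Y2.base = 0 := by
  change (if (0 : ZMod 3) = i then √(1 - ‖(1 : ℂ)‖ ^ 2) else 0) = 0
  simp

/-- The rotation of a family of points by a family of angles. -/
theorem exists_rotate {X : Type*} [TopologicalSpace X] {θ : X → ℝ} (hθ : Continuous θ)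
    {γ : X → Y2} (hγ : Continuous γ) : ∃ f : C(X, Y2),
      (∀ x, fold (f x) = Circle.exp (θ x) * fold (γ x)) ∧
      ∀ x i, height i (f x) = height i (γ x) := by
  refine exists_lift (A := fun x => Circle.exp (θ x) * fold (γ x))
    (s := fun x i => height i (γ x)) ?_ ?_ fun x => ?_
  · have h1 := continuous_fold.comp hγ
    have h2 : Continuous fun x => (Circle.exp (θ x) : ℂ) :=
      continuous_subtype_val.comp (Circle.exp.continuous.comp hθ)
    exact h2.mul h1
  · exact continuous_pi fun i => (continuous_height i).comp hγ
  · obtain ⟨i, h1, h2, h3⟩ := isCoord (γ x)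
    refine ⟨i, h1, h2, ?_⟩
    rw [norm_mul, Circle.norm_coe, one_mul]
    exact h3

/-- The rotation of the circle by a third of a full turn is homotopic to the identity. -/
theorem exists_loop_freelyHomotopic (g : Z3) (γ : Ω^ (Fin 2) Y2 Y2.base) :
    ∃ δ : Ω^ (Fin 2) Y2 Y2.base, FreelyHomotopic (fun t => g • γ t) δ := by
  -- The angle `a` undoes the rotation by `g`. Rotating by `s * a` without permuting the discs moves
  -- the image of the base point back along the circle.
  obtain ⟨a, ha⟩ : ∃ a : ℝ, (Circle.exp a : Circle) * rot g = 1 := by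
    obtain ⟨a, ha⟩ := Circle.exp_surjective (rot g)⁻¹
    exact ⟨a, by rw [ha, inv_mul_cancel]⟩
  obtain ⟨F, hF, hF'⟩ := exists_rotate (X := I × (Fin 2 → I)) (θ := fun x => x.1 * a)
    (γ := fun x => (g • γ x.2 : Y2)) (by fun_prop)
    ((γ.1.continuous.comp continuous_snd).const_smul g)
  have hγ : ∀ b ∈ Cube.boundary (Fin 2), γ b = Y2.base := γ.2
  have hF0 : ∀ s, ∀ b ∈ Cube.boundary (Fin 2), fold (F (s, b)) = Circle.exp (s * a) * rot g :=
    fun s b hb => by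
      rw [hF]
      dsimp only
      rw [hγ b hb, fold_smul, fold_base, mul_one]
  have hF1 : ∀ s, ∀ b ∈ Cube.boundary (Fin 2), ∀ i, height i (F (s, b)) = 0 :=
    fun s b hb i => by
      have := height_smul g (i - Multiplicative.toAdd g) Y2.base
      rw [add_sub_cancel, height_base] at this
      rw [hF']
      dsimp only
      rw [hγ b hb, this]
  have h1 : ∀ b ∈ Cube.boundary (Fin 2), F (1, b) = Y2.base := fun b hb => by
    refine ext ?_ fun i => ?_
    · rw [hF0 1 b hb, fold_base, Set.Icc.coe_one, one_mul]
      exact congrArg Subtype.val ha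
    · rw [hF1 1 b hb, height_base]
  refine ⟨⟨F.comp ⟨fun t => (1, t), by fun_prop⟩, h1⟩, F, fun t => ?_, fun t => rfl,
    fun s b hb b' hb' => ?_⟩
  · refine ext ?_ fun i => ?_
    · rw [hF]
      simp
    · rw [hF']
  · refine ext ?_ fun i => ?_
    · rw [hF0 s b hb, hF0 s b' hb']
    · rw [hF1 s b hb, hF1 s b' hb']

end Y2

/-! ### The union of the stages -/

theorem ContinuousMap.HomotopicRel.mono {X Y : Type*} [TopologicalSpace X] [TopologicalSpace Y]
    {f g : C(X, Y)} {S T : Set X} (h : f.HomotopicRel g S) (hT : T ⊆ S) : f.HomotopicRel g T :=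
  h.map fun K => ⟨K.toHomotopy, fun s x hx => K.prop' s x (hT hx)⟩

namespace P2

variable (c : P2Choice)

theorem isClosedEmbedding_incl (m : ℕ) : Topology.IsClosedEmbedding (incl c m) :=
  AttachCarrier.isClosedEmbedding_incl (c m (stage c m))

instance (m : ℕ) : T1Space (stage c m) := by
  induction m with
  | zero => exact inferInstanceAs (T1Space Y2)
  | succ m ih => exact inferInstanceAs (T1Space (AttachCarrier (c m (stage c m))))

/-- The inclusion of a stage in a later one. -/
def shift {m n : ℕ} (h : m ≤ n) : stage c m → stage c n :=
  Nat.leRecOn (C := fun n => stage c n) h fun {k} => incl c k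

theorem shift_self (m : ℕ) (y : stage c m) : shift c le_rfl y = y :=
  Nat.leRecOn_self (C := fun n => stage c n) y

theorem shift_succ {m n : ℕ} (h : m ≤ n) (y : stage c m) :
    shift c (h.trans n.le_succ) y = incl c n (shift c h y) :=
  Nat.leRecOn_succ (C := fun n => stage c n) h y

theorem shift_shift {l m n : ℕ} (h : l ≤ m) (h' : m ≤ n) (y : stage c l) :
    shift c h' (shift c h y) = shift c (h.trans h') y :=
  (Nat.leRecOn_trans (C := fun n => stage c n) h h' y).symm

theorem isClosedEmbedding_shift {m n : ℕ} (h : m ≤ n) :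
    Topology.IsClosedEmbedding (shift c h) := by
  induction n, h using Nat.le_induction with
  | base =>
    have : shift c (le_refl m) = id := funext (shift_self c m)
    rw [this]
    exact .id
  | succ n h ih =>
    have : shift c (h.trans n.le_succ) = incl c n ∘ shift c h := funext (shift_succ c h)
    rw [this]
    exact (isClosedEmbedding_incl c n).comp ih

/-- The inclusion of a stage in the union. -/
def ofStage (m : ℕ) (y : stage c m) : P2 c := Quot.mk _ ⟨m, y⟩

theorem ofStage_shift {m n : ℕ} (h : m ≤ n) (y : stage c m) :
    ofStage c n (shift c h y) = ofStage c m y := by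
  induction n, h using Nat.le_induction with
  | base => rw [shift_self]
  | succ n h ih =>
    rw [shift_succ, ← ih]
    exact (Quot.sound (UnionRel.mk n _)).symm

theorem exists_ofStage (x : P2 c) : ∃ m y, ofStage c m y = x := by
  induction x using Quot.ind with
  | mk x => exact ⟨x.1, x.2, rfl⟩

/-- Becoming equal at a later stage is an equivalence relation containing the generating one, so
nothing more is identified in the union. -/
theorem exists_shift_eq {m n : ℕ} {y : stage c m} {z : stage c n}
    (h : ofStage c m y = ofStage c n z) :
    ∃ (N : ℕ) (hm : m ≤ N) (hn : n ≤ N), shift c hm y = shift c hn z := by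
  let R : (Σ m, stage c m) → (Σ m, stage c m) → Prop := fun a b =>
    ∃ (N : ℕ) (hm : a.1 ≤ N) (hn : b.1 ≤ N), shift c hm a.2 = shift c hn b.2
  have hR : Equivalence R := by
    refine ⟨fun a => ⟨a.1, le_rfl, le_rfl, rfl⟩, fun ⟨N, h1, h2, h⟩ => ⟨N, h2, h1, h.symm⟩, ?_⟩
    rintro a b d ⟨N, h1, h2, h⟩ ⟨N', h1', h2', h'⟩
    refine ⟨max N N', h1.trans (le_max_left _ _), h2'.trans (le_max_right _ _), ?_⟩
    rw [← shift_shift c h1 (le_max_left _ _), h, ← shift_shift c h2' (le_max_right _ _), ← h',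
      shift_shift, shift_shift]
  have h1 : ∀ a b, UnionRel c a b → R a b := by
    rintro _ _ ⟨m, y⟩
    refine ⟨m + 1, m.le_succ, le_rfl, ?_⟩
    rw [shift_self]
    exact (shift_succ c le_rfl y).trans (congrArg _ (shift_self c m y))
  have h2 := Relation.EqvGen.mono h1 _ _ (Quot.eqvGen_exact h)
  rwa [hR.eqvGen_eq] at h2

theorem eq_shift {m n : ℕ} (h : m ≤ n) {y : stage c n} {z : stage c m}
    (hyz : ofStage c n y = ofStage c m z) : y = shift c h z := by
  obtain ⟨N, h1, h2, h3⟩ := exists_shift_eq c hyz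
  refine (isClosedEmbedding_shift c h1).injective ?_
  rw [h3, shift_shift]

theorem ofStage_injective (m : ℕ) : Function.Injective (ofStage c m) := fun y z h => by
  rw [eq_shift c le_rfl h, shift_self]

theorem continuous_ofStage (m : ℕ) : Continuous (ofStage c m) :=
  continuous_quot_mk.comp continuous_sigmaMk

theorem isClosed_iff {C : Set (P2 c)} : IsClosed C ↔ ∀ m, IsClosed (ofStage c m ⁻¹' C) :=
  (isQuotientMap_quot_mk (r := UnionRel c)).isClosed_preimage.symm.trans isClosed_sigma_iff

theorem isClosedEmbedding_ofStage (m : ℕ) : Topology.IsClosedEmbedding (ofStage c m) := by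
  refine .of_continuous_injective_isClosedMap (continuous_ofStage c m) (ofStage_injective c m)
    fun C hC => ?_
  rw [isClosed_iff]
  intro n
  rcases le_total m n with h | h
  · have : ofStage c n ⁻¹' (ofStage c m '' C) = shift c h '' C := by
      ext y
      constructor
      · rintro ⟨z, hz, hy⟩
        exact ⟨z, hz, (eq_shift c h hy.symm).symm⟩
      · rintro ⟨z, hz, rfl⟩
        exact ⟨z, hz, (ofStage_shift c h z).symm⟩
    rw [this]
    exact (isClosedEmbedding_shift c h).isClosedMap _ hC
  · have : ofStage c n ⁻¹' (ofStage c m '' C) = shift c h ⁻¹' C := by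
      ext y
      constructor
      · rintro ⟨z, hz, hy⟩
        rw [Set.mem_preimage, ← eq_shift c h hy]
        exact hz
      · intro hy
        exact ⟨_, hy, ofStage_shift c h y⟩
    rw [this]
    exact hC.preimage (isClosedEmbedding_shift c h).continuous

/-- Compact sets lie in stages. -/
theorem exists_subset_range {C : Set (P2 c)} (hC : IsCompact C) :
    ∃ m, C ⊆ Set.range (ofStage c m) := by
  by_contra! h
  simp only [Set.not_subset] at h
  choose x hx hx' using h
  -- The sequence picks from `C` a point outside each stage, so a stage contains only finitely many
  -- of its terms and every part of the sequence is closed. The tails then have a common point by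
  -- compactness; lying in some stage `m`, it cannot be a term with index at least `m`.
  have hfin : ∀ S : Set ℕ, IsClosed (x '' S) := fun S => by
    rw [isClosed_iff]
    intro m
    refine Set.Finite.isClosed (Set.Finite.preimage (ofStage_injective c m).injOn ?_ |>.subset
      (s := ofStage c m ⁻¹' (x '' Set.Iio m)) ?_)
    · exact (Set.finite_Iio m).image x
    · rintro y ⟨n, -, hn⟩
      refine ⟨n, ?_, hn⟩
      by_contra hmn
      rw [Set.mem_Iio, not_lt] at hmn
      exact hx' n ⟨shift c hmn y, by rw [ofStage_shift, hn]⟩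
  have hsub : ∀ n, x '' Set.Ici n ⊆ C := by
    rintro n _ ⟨k, -, rfl⟩
    exact hx k
  obtain ⟨a, ha⟩ := IsCompact.nonempty_iInter_of_sequence_nonempty_isCompact_isClosed
    (fun n => x '' Set.Ici n) (fun n => Set.image_mono (Set.Ici_subset_Ici.2 n.le_succ))
    (fun n => Set.nonempty_Ici.image x) (hC.of_isClosed_subset (hfin _) (hsub 0))
    fun n => hfin _
  obtain ⟨m, y, rfl⟩ := exists_ofStage c a
  obtain ⟨k, hk, hxk⟩ := Set.mem_iInter.1 ha m
  rw [Set.mem_Ici] at hk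
  exact hx' k ⟨shift c hk y, by rw [ofStage_shift, hxk]⟩

/-- A family of spheres in a stage can be deformed into the first stage. -/
theorem exists_compression_stage (m : ℕ) (f : C(I × (Fin 2 → I), stage c m))
    (hf : BoundaryConst f) : ∃ f' : C(I × (Fin 2 → I), Y2), BoundaryConst f' ∧
      f.HomotopicRel ((⟨shift c m.zero_le, (isClosedEmbedding_shift c _).continuous⟩ :
        C(stage c 0, stage c m)).comp f') (f ⁻¹' Set.range (shift c m.zero_le)) := by
  induction m with
  | zero =>
    refine ⟨f, hf, ?_⟩
    convert ContinuousMap.HomotopicRel.refl f using 1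
    exact ContinuousMap.ext fun x => shift_self c 0 (f x)
  | succ m ih =>
    obtain ⟨f₁, h₁, H₁⟩ := AttachCarrier.exists_compression (c m (stage c m)) (by lia) f hf
    obtain ⟨f₂, h₂, H₂⟩ := ih f₁ h₁
    refine ⟨f₂, h₂, ?_⟩
    have hS : f ⁻¹' Set.range (shift c (m + 1).zero_le) ⊆
        f ⁻¹' Set.range (AttachCarrier.incl (c m (stage c m))) := by
      rintro x ⟨y, hy⟩
      exact ⟨shift c m.zero_le y, by rw [← hy]; exact (shift_succ c m.zero_le y).symm⟩
    -- The first deformation fixes the points already lying in the first stage, so the second one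
    -- may be taken relative to them as well.
    have hS' : f ⁻¹' Set.range (shift c (m + 1).zero_le) ⊆
        f₁ ⁻¹' Set.range (shift c m.zero_le) := by
      rintro x ⟨y, hy⟩
      refine ⟨y, (isClosedEmbedding_incl c m).injective ?_⟩
      rw [← shift_succ c m.zero_le, hy]
      exact H₁.fst_eq_snd (hS ⟨y, hy⟩)
    have H₂' := H₂.comp_continuousMap
      (⟨incl c m, (isClosedEmbedding_incl c m).continuous⟩ : C(stage c m, stage c (m + 1)))
    refine (H₁.mono hS).trans ?_
    have e : (⟨shift c (m + 1).zero_le, (isClosedEmbedding_shift c _).continuous⟩ :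
        C(stage c 0, stage c (m + 1))).comp f₂ =
        (⟨incl c m, (isClosedEmbedding_incl c m).continuous⟩ : C(stage c m, stage c (m + 1))).comp
          ((⟨shift c m.zero_le, (isClosedEmbedding_shift c _).continuous⟩ :
            C(stage c 0, stage c m)).comp f₂) :=
      ContinuousMap.ext fun x => shift_succ c m.zero_le (f₂ x)
    rw [e]
    exact H₂'.mono hS'

/-- The inclusion of the complex of three discs in the union. -/
def ofY2 : C(Y2, P2 c) := ⟨ofStage c 0, continuous_ofStage c 0⟩

/-- A family of spheres in the union can be deformed into the complex of three discs. -/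
theorem exists_compression (f : C(I × (Fin 2 → I), P2 c)) (hf : BoundaryConst f) :
    ∃ f' : C(I × (Fin 2 → I), Y2), BoundaryConst f' ∧
      f.HomotopicRel ((ofY2 c).comp f') (f ⁻¹' Set.range (ofY2 c)) := by
  obtain ⟨m, hm⟩ := exists_subset_range c (isCompact_range f.continuous)
  choose g hg using fun x => hm (Set.mem_range_self x)
  have hgc : Continuous g := by
    rw [(isClosedEmbedding_ofStage c m).isInducing.continuous_iff]
    exact f.continuous.congr fun x => (hg x).symm
  obtain ⟨f', h', H⟩ := exists_compression_stage c m ⟨g, hgc⟩ fun s b hb b' hb' =>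
    ofStage_injective c m (by
      change ofStage c m (g _) = ofStage c m (g _)
      rw [hg, hg, hf s b hb b' hb'])
  refine ⟨f', h', ?_⟩
  convert H.comp_continuousMap ⟨ofStage c m, continuous_ofStage c m⟩ using 1
  · exact ContinuousMap.ext fun x => (hg x).symm
  · exact ContinuousMap.ext fun x => (ofStage_shift c m.zero_le (f' x)).symm
  · ext x
    refine ⟨fun ⟨y, hy⟩ => ⟨y, ?_⟩, fun ⟨y, hy⟩ => ⟨y, ?_⟩⟩
    · exact (eq_shift c m.zero_le ((hg x).trans hy.symm)).symm
    · rw [← hg]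
      change shift c _ y = g x at hy
      rw [← hy]
      exact (ofStage_shift c m.zero_le y).symm

theorem ofY2_injective : Function.Injective (ofY2 c) := ofStage_injective c 0

/-- Spheres in the complex of three discs that are freely homotopic in the union are freely
homotopic. -/
theorem freelyHomotopic_iff {γ δ : (Fin 2 → I) → Y2} :
    FreelyHomotopic (fun t => ofY2 c (γ t)) (fun t => ofY2 c (δ t)) ↔ FreelyHomotopic γ δ := by
  constructor
  · rintro ⟨F, h0, h1, hF⟩
    -- The ends of the free homotopy already lie in `Y₂`, so the compression leaves them unchanged.
    obtain ⟨F', hF', H⟩ := exists_compression c F hF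
    refine ⟨F', fun t => ofY2_injective c ?_, fun t => ofY2_injective c ?_, hF'⟩
    · refine Eq.trans ?_ (h0 t)
      exact (H.fst_eq_snd (x := (0, t)) ⟨_, (h0 t).symm⟩).symm
    · refine Eq.trans ?_ (h1 t)
      exact (H.fst_eq_snd (x := (1, t)) ⟨_, (h1 t).symm⟩).symm
  · rintro ⟨F, h0, h1, hF⟩
    exact ⟨(ofY2 c).comp F, fun t => congrArg (ofY2 c) (h0 t),
      fun t => congrArg (ofY2 c) (h1 t), fun s b hb b' hb' => congrArg (ofY2 c) (hF s b hb b' hb')⟩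

/-- The map of spheres induced by the inclusion. -/
noncomputable def mapSphere (γ : Ω^ (Fin 2) Y2 Y2.base) : Ω^ (Fin 2) (P2 c) (P2 c).base :=
  ⟨(ofY2 c).comp γ.1, fun t ht => congrArg (ofY2 c) (γ.2 t ht)⟩

/-- The compression is applied to the constant family. It fixes the base point, so its restriction
to time `0` is a based homotopy. -/
theorem exists_homotopic_mapSphere (γ : Ω^ (Fin 2) (P2 c) (P2 c).base) :
    ∃ γ', GenLoop.Homotopic γ (mapSphere c γ') := by
  let f : C(I × (Fin 2 → I), P2 c) := γ.1.comp .snd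
  obtain ⟨f', -, ⟨H⟩⟩ := exists_compression c f fun s b hb b' hb' =>
    (γ.2 b hb).trans (γ.2 b' hb').symm
  have hb : ∀ b ∈ Cube.boundary (Fin 2), ((0 : I), b) ∈ f ⁻¹' Set.range (ofY2 c) :=
    fun b hb => ⟨Y2.base, (γ.2 b hb).symm⟩
  let j : C(Fin 2 → I, I × (Fin 2 → I)) := ⟨fun t => (0, t), by fun_prop⟩
  refine ⟨⟨f'.comp j, fun b hbb => ofY2_injective c ?_⟩, ?_⟩
  · exact (H.fst_eq_snd (hb b hbb)).symm.trans (γ.2 b hbb)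
  · exact ⟨⟨⟨H.toContinuousMap.comp ((ContinuousMap.id I).prodMap j), fun t => H.apply_zero _,
      fun t => H.apply_one _⟩, fun s b hbb => H.eq_fst s (hb b hbb)⟩⟩

end P2

/-! ### Degrees of spheres in the complex of three discs -/

theorem eq_of_exp_eq_one {g : I → ℂ} (hg : Continuous g) (h : ∀ x, Complex.exp (g x) = 1)
    (x y : I) : g x = g y := by
  choose n hn using fun x => Complex.exp_eq_one_iff.1 (h x)
  have hc : Continuous n := by
    rw [Int.isClosedEmbedding_coe_real.isInducing.continuous_iff]
    have : Continuous fun x => (g x).im / (2 * Real.pi) := by fun_prop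
    refine this.congr fun x => ?_
    rw [hn x]
    have := Real.pi_ne_zero
    simp
  rw [hn x, hn y, PreconnectedSpace.constant inferInstance hc (x := x) (y := y)]

namespace Y2

open Complex ComplexConjugate

/-- The projection of `ℂ²` to a line that over the `i`-th disc is spanned by `(fold, height i)`, and
elsewhere is the first coordinate line. -/
noncomputable def proj (i : ZMod 3) (y : Y2) : (ℂ × ℂ) →L[ℂ] (ℂ × ℂ) :=
  -- On the `i`-th disc `1 - height² = |fold|²`, and this is the orthogonal projection to the unit
  -- vector `(fold, height)`. Written with `1 - height²`, the same formula gives the first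
  -- coordinate line on the other discs.
  (1 - (height i y : ℂ) ^ 2) •
      (ContinuousLinearMap.inl ℂ ℂ ℂ).comp (ContinuousLinearMap.fst ℂ ℂ ℂ) +
    (fold y * height i y) •
      (ContinuousLinearMap.inl ℂ ℂ ℂ).comp (ContinuousLinearMap.snd ℂ ℂ ℂ) +
    (conj (fold y) * height i y) •
      (ContinuousLinearMap.inr ℂ ℂ ℂ).comp (ContinuousLinearMap.fst ℂ ℂ ℂ) +
    ((height i y : ℂ) ^ 2) •
      (ContinuousLinearMap.inr ℂ ℂ ℂ).comp (ContinuousLinearMap.snd ℂ ℂ ℂ)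

theorem proj_apply (i : ZMod 3) (y : Y2) (v : ℂ × ℂ) : proj i y v =
    ((1 - (height i y : ℂ) ^ 2) * v.1 + fold y * height i y * v.2,
      conj (fold y) * height i y * v.1 + (height i y : ℂ) ^ 2 * v.2) := by
  simp [proj]

theorem continuous_proj (i : ZMod 3) : Continuous (proj i) := by
  have h1 := continuous_fold
  have h2 : Continuous fun y => (height i y : ℂ) := continuous_ofReal.comp (continuous_height i)
  have h3 : Continuous fun y => conj (fold y) := continuous_conj.comp h1
  unfold proj
  fun_prop

theorem height_eq_zero_or (i : ZMod 3) (y : Y2) :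
    (height i y : ℂ) = 0 ∨ fold y * conj (fold y) = 1 - (height i y : ℂ) ^ 2 := by
  obtain ⟨j, h1, h2, h3⟩ := isCoord y
  by_cases h : i = j
  · subst h
    right
    rw [mul_conj, normSq_eq_norm_sq, eq_sub_iff_add_eq]
    exact_mod_cast h3
  · left
    exact_mod_cast h1 i h

/-- The vector `v` lies in the line over `y`. -/
def InLine (i : ZMod 3) (y : Y2) (v : ℂ × ℂ) : Prop :=
  (height i y : ℂ) * v.1 = fold y * v.2 ∧
    conj (fold y) * height i y * v.1 = (1 - (height i y : ℂ) ^ 2) * v.2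

theorem proj_eq_self {i : ZMod 3} {y : Y2} {v : ℂ × ℂ} : proj i y v = v ↔ InLine i y v := by
  rw [proj_apply, InLine, Prod.ext_iff]
  dsimp only
  constructor
  · rintro ⟨h1, h2⟩
    have h3 : conj (fold y) * height i y * v.1 = (1 - (height i y : ℂ) ^ 2) * v.2 := by
      linear_combination h2
    refine ⟨?_, h3⟩
    rcases eq_or_ne (height i y : ℂ) 0 with h | h
    · rw [h] at h3 ⊢
      have : v.2 = 0 := by linear_combination -h3
      rw [this]
      ring
    · refine mul_left_cancel₀ h ?_
      linear_combination -h1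
  · rintro ⟨h1, h2⟩
    constructor
    · linear_combination -(height i y : ℂ) * h1
    · linear_combination h2

theorem inLine_proj (i : ZMod 3) (y : Y2) (v : ℂ × ℂ) : InLine i y (proj i y v) := by
  rw [proj_apply, InLine]
  dsimp only
  rcases height_eq_zero_or i y with h | h
  · rw [h]
    constructor <;> ring
  · constructor
    · linear_combination ((-(height i y : ℂ) * v.1)) * h
    · linear_combination ((height i y : ℂ) ^ 2 * v.2) * h

theorem InLine.cross {i : ZMod 3} {y : Y2} {v w : ℂ × ℂ} (hv : InLine i y v)
    (hw : InLine i y w) : v.1 * w.2 = v.2 * w.1 := by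
  obtain ⟨h1, h2⟩ := hv
  obtain ⟨h3, h4⟩ := hw
  rcases eq_or_ne (height i y : ℂ) 0 with h | h
  · rw [h] at h2 h4
    have e1 : v.2 = 0 := by linear_combination -h2
    have e2 : w.2 = 0 := by linear_combination -h4
    rw [e1, e2]
    ring
  · refine mul_left_cancel₀ h ?_
    linear_combination w.2 * h1 - v.2 * h3

theorem InLine.smul {i : ZMod 3} {y : Y2} {v : ℂ × ℂ} (hv : InLine i y v) (a : ℂ) :
    InLine i y (a • v) := by
  obtain ⟨h1, h2⟩ := hv
  constructor
  · simp only [Prod.smul_fst, Prod.smul_snd, smul_eq_mul]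
    linear_combination a * h1
  · simp only [Prod.smul_fst, Prod.smul_snd, smul_eq_mul]
    linear_combination a * h2

theorem exists_inLine (i : ZMod 3) (y : Y2) : ∃ v, InLine i y v ∧ v ≠ 0 := by
  rcases eq_or_ne (height i y : ℂ) 0 with h | h
  · refine ⟨(1, 0), ⟨?_, ?_⟩, by simp⟩ <;> rw [h] <;> ring
  · refine ⟨(fold y, height i y), ⟨?_, ?_⟩, fun h' => h (congrArg Prod.snd h')⟩
    · ring
    · have := (height_eq_zero_or i y).resolve_left h
      dsimp only
      linear_combination (height i y : ℂ) * this

/-- The group rotates `fold` and permutes the heights, so a diagonal unitary map carries the lines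
to one another. This is why it permutes the degrees without signs. -/
theorem InLine.smul_group {i : ZMod 3} {y : Y2} {v : ℂ × ℂ} (hv : InLine i y v) (g : Z3) :
    InLine (Multiplicative.toAdd g + i) (g • y) (rot g * v.1, v.2) := by
  obtain ⟨h1, h2⟩ := hv
  have h3 : (rot g : ℂ) * conj (rot g : ℂ) = 1 := by
    rw [mul_conj, Circle.normSq_coe, ofReal_one]
  rw [InLine, fold_smul, height_smul, map_mul]
  constructor
  · linear_combination (rot g : ℂ) * h1
  · linear_combination h2 + conj (fold y) * height i y * v.1 * h3

/-- The ratio of two vectors in the plane that are multiples of one another. -/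
noncomputable def ratio (w v : ℂ × ℂ) : ℂ :=
  (w.1 * conj v.1 + w.2 * conj v.2) / (v.1 * conj v.1 + v.2 * conj v.2)

theorem normSq_ne_zero {v : ℂ × ℂ} (hv : v ≠ 0) : v.1 * conj v.1 + v.2 * conj v.2 ≠ 0 := by
  rw [mul_conj, mul_conj, ← ofReal_add, Ne, ofReal_eq_zero]
  intro h
  have h1 := normSq_nonneg v.1
  have h2 := normSq_nonneg v.2
  exact hv (Prod.ext (normSq_eq_zero.1 (by linarith)) (normSq_eq_zero.1 (by linarith)))

theorem ratio_smul {w v : ℂ × ℂ} (hv : v ≠ 0) (h : w.1 * v.2 = w.2 * v.1) :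
    ratio w v • v = w := by
  have h0 := normSq_ne_zero hv
  refine Prod.ext ?_ ?_
  · rw [Prod.smul_fst, smul_eq_mul, ratio, div_mul_eq_mul_div, div_eq_iff h0]
    linear_combination -conj v.2 * h
  · rw [Prod.smul_snd, smul_eq_mul, ratio, div_mul_eq_mul_div, div_eq_iff h0]
    linear_combination conj v.1 * h

theorem continuous_ratio {X : Type*} [TopologicalSpace X] {w v : X → ℂ × ℂ} (hw : Continuous w)
    (hv : Continuous v) (h : ∀ x, v x ≠ 0) : Continuous fun x => ratio (w x) (v x) := by
  have h1 : Continuous fun x => conj (v x).1 := continuous_conj.comp (by fun_prop)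
  have h2 : Continuous fun x => conj (v x).2 := continuous_conj.comp (by fun_prop)
  exact Continuous.div (by fun_prop) (by fun_prop) fun x => normSq_ne_zero (h x)

/-- The function on the boundary of the square that winds `a` times around zero on the edge
`t₀ = 1` and is `1` on the other edges. -/
noncomputable def wind (a : ℤ) (t : Fin 2 → I) : ℂ :=
  if t 0 = 1 then exp (2 * Real.pi * Complex.I * a * (t 1 : ℝ)) else 1

theorem wind_of_zero (a : ℤ) (x : I) : wind a ![0, x] = 1 := by simp [wind]

theorem wind_of_one (a : ℤ) (x : I) :
    wind a ![1, x] = exp (2 * Real.pi * Complex.I * a * (x : ℝ)) := by simp [wind]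

theorem exp_int (a : ℤ) : exp (2 * Real.pi * Complex.I * a) = 1 := by
  rw [mul_comm]
  exact exp_int_mul_two_pi_mul_I a

theorem wind_of_edge (a : ℤ) (s : I) {x : I} (hx : x = 0 ∨ x = 1) : wind a ![s, x] = 1 := by
  unfold wind
  split_ifs
  · rcases hx with rfl | rfl
    · simp
    · simpa using exp_int a
  · rfl

theorem mem_boundary_iff {t : Fin 2 → I} :
    t ∈ Cube.boundary (Fin 2) ↔ t 0 = 0 ∨ t 0 = 1 ∨ t 1 = 0 ∨ t 1 = 1 := by
  simp [Cube.boundary, Fin.exists_fin_two, or_assoc]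

theorem pair_eta (t : Fin 2 → I) : ![t 0, t 1] = t := by
  funext i
  fin_cases i <;> rfl

theorem forall_boundary {p : (Fin 2 → I) → Prop} (h0 : ∀ x, p ![0, x]) (h1 : ∀ x, p ![1, x])
    (h : ∀ s x, x = 0 ∨ x = 1 → p ![s, x]) : ∀ t ∈ Cube.boundary (Fin 2), p t := by
  intro t ht
  rw [← pair_eta t]
  rcases mem_boundary_iff.1 ht with h' | h' | h'
  · rw [h']; exact h0 _
  · rw [h']; exact h1 _
  · exact h _ _ h'

/-- The degree on the `i`-th disc: the winding number on the boundary of a section of the line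
bundle over the sphere. -/
def Deg (i : ZMod 3) (γ : (Fin 2 → I) → Y2) (a : ℤ) : Prop :=
  ∃ v : (Fin 2 → I) → ℂ × ℂ, Continuous v ∧ (∀ t, InLine i (γ t) (v t) ∧ v t ≠ 0) ∧
    ∃ e, ∀ t ∈ Cube.boundary (Fin 2), v t = wind a t • e

/-- Two sections differ by a nowhere zero function on the square, which has a logarithm. On the edge
`t₀ = 1` that function winds `b - a` times and on the other edges it is constant, so `b - a`
vanishes. -/
theorem Deg.unique {i : ZMod 3} {γ : (Fin 2 → I) → Y2} {a b : ℤ} (ha : Deg i γ a)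
    (hb : Deg i γ b) : a = b := by
  obtain ⟨v, hv, hv', e, he⟩ := ha
  obtain ⟨w, hw, hw', e', he'⟩ := hb
  have hr := continuous_ratio hw hv fun t => (hv' t).2
  have hrw : ∀ t, ratio (w t) (v t) • v t = w t := fun t =>
    ratio_smul (hv' t).2 ((hw' t).1.cross (hv' t).1)
  set r := fun t => ratio (w t) (v t) with hrdef
  have hr0 : ∀ t, r t ≠ 0 := fun t h => (hw' t).2 (by
    rw [← hrw t, show ratio (w t) (v t) = 0 from h, zero_smul])
  have hb0 : (![0, 0] : Fin 2 → I) ∈ Cube.boundary (Fin 2) := ⟨0, Or.inl rfl⟩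
  have hv0 := he _ hb0
  have hw0 := he' _ hb0
  rw [wind_of_zero, one_smul] at hv0 hw0
  have he0 : e ≠ 0 := hv0 ▸ (hv' _).2
  have hee : e' = r ![0, 0] • e := by rw [← hv0, ← hw0]; exact (hrw _).symm
  have key : ∀ t ∈ Cube.boundary (Fin 2), r t * wind a t = wind b t * r ![0, 0] := fun t ht => by
    refine smul_left_injective ℂ he0 ?_
    change (r t * wind a t) • e = (wind b t * r ![0, 0]) • e
    rw [mul_smul, mul_smul, ← he t ht, ← hee, ← he' t ht]
    exact hrw t
  obtain ⟨l, hl, hl1, hl0, hlc⟩ := exists_log (K := I) (fun x => r ![x.1, x.2] / r ![0, 0])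
    ((hr.comp (by fun_prop)).div_const _) (fun x => div_ne_zero (hr0 _) (hr0 _)) (fun _ => 0)
    continuous_const (fun x => by
      have := key ![0, x] ⟨0, Or.inl rfl⟩
      rw [wind_of_zero, wind_of_zero, mul_one, one_mul] at this
      rw [this, exp_zero, div_self (hr0 _)])
  have hedge : ∀ x : I, x = 0 ∨ x = 1 → ∀ s, l (s, x) = 0 := fun x hx => by
    refine hlc x fun s => ?_
    have h1 := key ![s, x] ⟨1, hx⟩
    have h2 := key ![0, x] ⟨1, hx⟩
    rw [wind_of_edge _ _ hx, wind_of_edge _ _ hx] at h1 h2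
    rw [mul_one] at h1 h2
    dsimp only
    rw [h1, h2]
  have h1 : ∀ x : I, exp (l (1, x) - 2 * Real.pi * Complex.I * (b - a) * (x : ℝ)) = 1 := fun x => by
    have := key ![1, x] ⟨0, Or.inr rfl⟩
    rw [wind_of_one, wind_of_one] at this
    rw [exp_sub, hl1, div_eq_one_iff_eq (exp_ne_zero _), div_eq_iff (hr0 _)]
    refine mul_right_cancel₀ (exp_ne_zero (2 * Real.pi * Complex.I * a * (x : ℝ))) ?_
    have h : exp (2 * Real.pi * Complex.I * b * (x : ℝ)) =
        exp (2 * Real.pi * Complex.I * (b - a) * (x : ℝ)) *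
          exp (2 * Real.pi * Complex.I * a * (x : ℝ)) := by
      rw [← exp_add]
      ring_nf
    rw [this, h]
    ring
  have h2 := eq_of_exp_eq_one (by fun_prop) h1 0 1
  rw [hedge 0 (Or.inl rfl), hedge 1 (Or.inr rfl)] at h2
  have h3 : ((b - a : ℤ) : ℂ) = 0 := by
    have := Real.pi_ne_zero
    have h4 : (2 * Real.pi * Complex.I : ℂ) ≠ 0 := two_pi_I_ne_zero
    refine mul_left_cancel₀ h4 ?_
    push_cast
    simp only [Set.Icc.coe_zero, Set.Icc.coe_one, ofReal_zero, ofReal_one, mul_zero, mul_one,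
      sub_zero, zero_sub] at h2
    linear_combination h2
  have h5 : b - a = 0 := by exact_mod_cast h3
  lia

/-- That one integer serves all `s` is homotopy invariance. A section over the path of boundary
values is transported across the squares; on the far edge it has become a multiple of the original
one. The factor is a loop in `ℂ` without `0`, whose winding number is `a` for all `s` by
connectedness. -/
theorem exists_deg (i : ZMod 3) {F : I × (Fin 2 → I) → Y2} (hF : Continuous F)
    (hb : BoundaryConst F) : ∃ a, ∀ s, Deg i (fun t => F (s, t)) a := by
  have hP := continuous_proj i
  obtain ⟨e₀, he₀, he₀'⟩ := exists_inLine i (F (0, 0))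
  obtain ⟨e, he, he1, -, -⟩ := exists_transport (K := I) (fun x => proj i (F (x.1, 0)))
    (hP.comp (hF.comp (by fun_prop))) (fun x v => proj_eq_self.2 (inLine_proj _ _ v)) (fun _ => e₀)
    continuous_const fun _ => ⟨proj_eq_self.2 he₀, he₀'⟩
  have hFb : ∀ s, ∀ t ∈ Cube.boundary (Fin 2), F (s, t) = F (s, 0) := fun s t ht =>
    hb s t ht 0 zero_mem_boundary
  obtain ⟨v, hv, hv1, hv0, hvc⟩ := exists_transport (K := I × I)
    (fun x => proj i (F (x.2.1, ![x.1, x.2.2]))) (hP.comp (hF.comp (by fun_prop)))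
    (fun x v => proj_eq_self.2 (inLine_proj _ _ v)) (fun x => e (x.1, 0)) (by fun_prop)
    fun x => by
      dsimp only
      rw [hFb _ ![0, x.2] ⟨0, Or.inl rfl⟩]
      exact he1 (x.1, 0)
  have hve : ∀ s x : I, x = 0 ∨ x = 1 → ∀ r, v (r, (s, x)) = e (s, 0) := fun s x hx =>
    hvc (s, x) fun r => by
      dsimp only
      rw [hFb _ ![r, x] ⟨1, hx⟩, hFb _ ![0, x] ⟨1, hx⟩]
  -- The factor acquired on the edge `t₀ = 1`, as a function of `t₁` and `s`.
  let h : I × I → ℂ := fun x => ratio (v (1, (x.2, x.1))) (e (x.2, 0))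
  have hhc : Continuous h := continuous_ratio (by fun_prop) (by fun_prop) fun x => (he1 _).2
  have hh : ∀ x, h x • e (x.2, 0) = v (1, (x.2, x.1)) := fun x => by
    refine ratio_smul (he1 _).2 (InLine.cross (i := i) (y := F (x.2, 0)) ?_
      (proj_eq_self.1 (he1 (x.2, 0)).1))
    have := proj_eq_self.1 (hv1 (1, (x.2, x.1))).1
    rwa [hFb _ ![1, x.1] ⟨0, Or.inr rfl⟩] at this
  have hh0 : ∀ x, h x ≠ 0 := fun x h0 => (hv1 (1, (x.2, x.1))).2 (by rw [← hh, h0, zero_smul])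
  have hh1 : ∀ s x : I, x = 0 ∨ x = 1 → h (x, s) = 1 := fun s x hx => by
    have := hh (x, s)
    rw [hve s x hx] at this
    exact smul_left_injective ℂ (he1 (s, 0)).2 (this.trans (one_smul ℂ _).symm)
  obtain ⟨l, hl, hl1, hl0, -⟩ := exists_log h hhc hh0 (fun _ => 0) continuous_const fun s => by
    rw [hh1 s 0 (Or.inl rfl), exp_zero]
  have hl2 : ∀ s : I, exp (l (1, s)) = 1 := fun s => (hl1 _).trans (hh1 s 1 (Or.inr rfl))
  obtain ⟨a, ha⟩ := exp_eq_one_iff.1 (hl2 0)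
  have hla : ∀ s, l (1, s) = a * (2 * Real.pi * Complex.I) := fun s => by
    rw [← ha]
    exact eq_of_exp_eq_one (g := fun s => l (1, s)) (by fun_prop) hl2 s 0
  -- As `t₀` grows, the exponential replaces the logarithm `l` of the factor by the linear function
  -- with the same end values, so that the far edge carries exactly `wind a`.
  refine ⟨a, fun s => ⟨fun t => exp (-((t 0 : ℝ) * (l (t 1, s) -
    2 * Real.pi * Complex.I * a * (t 1 : ℝ)))) • v (t 0, (s, t 1)), by fun_prop, fun t => ⟨?_, ?_⟩,
    e (s, 0), ?_⟩⟩
  · have := proj_eq_self.1 (hv1 (t 0, (s, t 1))).1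
    dsimp only at this
    rw [pair_eta] at this
    exact this.smul _
  · exact smul_ne_zero (exp_ne_zero _) (hv1 _).2
  · refine forall_boundary (fun x => ?_) (fun x => ?_) fun r x hx => ?_
    · rw [wind_of_zero]
      change exp (-(((0 : I) : ℝ) * _)) • v (0, (s, x)) = _
      rw [hv0]
      simp
    · rw [wind_of_one]
      change exp (-(((1 : I) : ℝ) * (l (x, s) - _))) • v (1, (s, x)) = _
      rw [← hh (x, s), ← hl1, smul_smul, ← exp_add, Set.Icc.coe_one, ofReal_one]
      dsimp only
      congr 2
      change -(1 * (l (x, s) - 2 * Real.pi * Complex.I * a * (x : ℝ))) + l (x, s) = _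
      ring
    · rw [wind_of_edge _ _ hx]
      change exp (-((r : ℝ) * (l (x, s) - 2 * Real.pi * Complex.I * a * (x : ℝ)))) •
        v (r, (s, x)) = _
      rw [hve s x hx]
      congr 1
      rcases hx with rfl | rfl
      · rw [hl0]
        simp
      · rw [hla, Set.Icc.coe_one, ofReal_one]
        rw [show (a * (2 * Real.pi * Complex.I) - 2 * Real.pi * Complex.I * a * 1 : ℂ) = 0 by ring]
        simp

theorem Deg.smul {i : ZMod 3} {γ : (Fin 2 → I) → Y2} {a : ℤ} (h : Deg i γ a) (g : Z3) :
    Deg (Multiplicative.toAdd g + i) (fun t => g • γ t) a := by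
  obtain ⟨v, hv, hv', e, he⟩ := h
  refine ⟨fun t => (rot g * (v t).1, (v t).2), by fun_prop, fun t => ⟨(hv' t).1.smul_group g, ?_⟩,
    (rot g * e.1, e.2), fun t ht => ?_⟩
  · intro h
    rw [Prod.mk_eq_zero, mul_eq_zero, or_iff_right (Circle.coe_ne_zero _)] at h
    exact (hv' t).2 (Prod.ext h.1 h.2)
  · dsimp only
    rw [he t ht]
    refine Prod.ext ?_ rfl
    simp only [Prod.smul_fst, smul_eq_mul]
    ring

/-- For a based sphere the section can be normalized. -/
theorem Deg.exists_section {i : ZMod 3} {γ : (Fin 2 → I) → Y2} {a : ℤ} (h : Deg i γ a)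
    (hγ : ∀ t ∈ Cube.boundary (Fin 2), γ t = Y2.base) :
    ∃ v : (Fin 2 → I) → ℂ × ℂ, Continuous v ∧ (∀ t, InLine i (γ t) (v t) ∧ v t ≠ 0) ∧
      ∀ t ∈ Cube.boundary (Fin 2), v t = wind a t • ((1, 0) : ℂ × ℂ) := by
  obtain ⟨v, hv, hv', e, he⟩ := h
  have hb0 : (![0, 0] : Fin 2 → I) ∈ Cube.boundary (Fin 2) := ⟨0, Or.inl rfl⟩
  have hv0 := he _ hb0
  rw [wind_of_zero, one_smul] at hv0
  have h1 := hv' ![0, 0]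
  rw [hγ _ hb0, hv0] at h1
  have h2 : e.2 = 0 := by
    have := h1.1.2
    rw [height_base] at this
    simpa using this.symm
  have h3 : e.1 ≠ 0 := fun h => h1.2 (Prod.ext h h2)
  refine ⟨fun t => e.1⁻¹ • v t, by fun_prop, fun t => ⟨(hv' t).1.smul _,
    smul_ne_zero (inv_ne_zero h3) (hv' t).2⟩, fun t ht => ?_⟩
  dsimp only
  rw [he t ht, smul_comm]
  congr 1
  refine Prod.ext ?_ ?_
  · exact inv_mul_cancel₀ h3
  · change e.1⁻¹ * e.2 = 0
    rw [h2, mul_zero]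

/-- After multiplication by the winding of the first section on its last edge, the second section
fits to it along the common edge. On the final edge the two windings multiply. -/
theorem Deg.transAt {i : ZMod 3} {p q : Ω^ (Fin 2) Y2 Y2.base} {a b : ℤ} (hp : Deg i p a)
    (hq : Deg i q b) : Deg i (GenLoop.transAt 0 p q) (a + b) := by
  obtain ⟨v, hv, hv', he⟩ := hp.exists_section p.2
  obtain ⟨w, hw, hw', he'⟩ := hq.exists_section q.2
  have hpr : Continuous (Set.projIcc (0 : ℝ) 1 zero_le_one) := continuous_projIcc
  let A : (Fin 2 → I) → Fin 2 → I := fun t => Function.update t 0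
    (Set.projIcc 0 1 zero_le_one (2 * (t 0 : ℝ)))
  let B : (Fin 2 → I) → Fin 2 → I := fun t => Function.update t 0
    (Set.projIcc 0 1 zero_le_one (2 * (t 0 : ℝ) - 1))
  have hA : Continuous A := continuous_id.update 0 (hpr.comp (by fun_prop))
  have hB : Continuous B := continuous_id.update 0 (hpr.comp (by fun_prop))
  have hAt : ∀ t, A t = ![Set.projIcc 0 1 zero_le_one (2 * (t 0 : ℝ)), t 1] := fun t => by
    funext j
    fin_cases j <;> rfl
  have hBt : ∀ t, B t = ![Set.projIcc 0 1 zero_le_one (2 * (t 0 : ℝ) - 1), t 1] := fun t => by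
    funext j
    fin_cases j <;> rfl
  have hT : ∀ t, GenLoop.transAt 0 p q t = if (t 0 : ℝ) ≤ 1 / 2 then p (A t) else q (B t) :=
    fun t => rfl
  have hE : Continuous fun t : Fin 2 → I =>
      exp (2 * Real.pi * Complex.I * a * (t 1 : ℝ)) • w (B t) := by fun_prop
  refine ⟨fun t => if (t 0 : ℝ) ≤ 1 / 2 then v (A t) else
    exp (2 * Real.pi * Complex.I * a * (t 1 : ℝ)) • w (B t), ?_, fun t => ?_, (1, 0), ?_⟩
  · refine Continuous.if_le (hv.comp hA) hE
      (by fun_prop) continuous_const fun t ht => ?_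
    have h1 : A t = ![1, t 1] := by
      rw [hAt, ht]
      norm_num
    have h2 : B t = ![0, t 1] := by
      rw [hBt, ht]
      norm_num
    rw [h1, h2, he _ ⟨0, Or.inr rfl⟩, he' _ ⟨0, Or.inl rfl⟩, wind_of_one, wind_of_zero, one_smul]
  · beta_reduce
    rw [hT]
    split_ifs
    · exact hv' _
    · exact ⟨(hw' _).1.smul _, smul_ne_zero (exp_ne_zero _) (hw' _).2⟩
  · refine forall_boundary (fun x => ?_) (fun x => ?_) fun s x hx => ?_
    · have h : (((![0, x] : Fin 2 → I) 0 : I) : ℝ) ≤ 1 / 2 := by norm_num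
      beta_reduce
      rw [if_pos h, hAt, wind_of_zero, one_smul]
      have h1 : Set.projIcc (0 : ℝ) 1 zero_le_one (2 * ((![0, x] : Fin 2 → I) 0 : I)) = 0 := by
        norm_num
      rw [h1]
      refine (he _ ⟨0, Or.inl rfl⟩).trans ?_
      rw [wind_of_zero, one_smul]
    · have h : ¬ (((![1, x] : Fin 2 → I) 0 : I) : ℝ) ≤ 1 / 2 := by norm_num
      beta_reduce
      rw [if_neg h, hBt, wind_of_one]
      have h1 : Set.projIcc (0 : ℝ) 1 zero_le_one (2 * ((![1, x] : Fin 2 → I) 0 : I) - 1) = 1 := by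
        norm_num
      rw [h1]
      refine (congrArg _ (he' _ ⟨0, Or.inr rfl⟩)).trans ?_
      change exp (2 * Real.pi * Complex.I * a * (x : ℝ)) • wind b ![1, x] • _ = _
      rw [wind_of_one, smul_smul, ← exp_add]
      push_cast
      ring_nf
    · have h3 : exp (2 * Real.pi * Complex.I * a * (x : ℝ)) = 1 := by
        rw [← wind_of_one, wind_of_edge _ _ hx]
      beta_reduce
      rw [wind_of_edge _ _ hx, one_smul]
      split_ifs
      · rw [hAt]
        refine (he _ ⟨1, hx⟩).trans ?_
        rw [show (![s, x] : Fin 2 → I) 1 = x from rfl, wind_of_edge _ _ hx, one_smul]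
      · rw [hBt]
        change exp (2 * Real.pi * Complex.I * a * (x : ℝ)) • _ = _
        rw [h3, one_smul]
        refine (he' _ ⟨1, hx⟩).trans ?_
        rw [show (![s, x] : Fin 2 → I) 1 = x from rfl, wind_of_edge _ _ hx, one_smul]

end Y2

/-! ### Homogeneous coordinates on the complex of three discs -/

/-- The median of three real numbers. -/
def median (x y w : ℝ) : ℝ := max (min x y) (max (min y w) (min w x))

theorem median_rotate (x y w : ℝ) : median y w x = median x y w := by
  unfold median
  ac_rfl

theorem median_eq_min {x y w : ℝ} (hy : x ≤ y) (hw : x ≤ w) : median x y w = min y w := by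
  unfold median
  rw [min_eq_left hy, min_eq_right hw, max_eq_left (le_min hy hw), max_eq_right (le_min hy hw)]

theorem le_of_lt_median {x y w : ℝ} (h : x < median x y w) : x ≤ y ∧ x ≤ w := by
  rcases lt_max_iff.1 h with h | h
  · exact absurd (min_le_left x y) (not_le.2 h)
  · rcases lt_max_iff.1 h with h | h
    · exact ⟨(lt_min_iff.1 h).1.le, (lt_min_iff.1 h).2.le⟩
    · exact absurd (min_le_right w x) (not_le.2 h)

theorem median_le_max {x y w : ℝ} : median x y w ≤ max x y := by
  unfold median
  refine max_le ((min_le_left _ _).trans (le_max_left _ _)) (max_le ?_ ?_)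
  · exact (min_le_left _ _).trans (le_max_right _ _)
  · exact (min_le_right _ _).trans (le_max_left _ _)

theorem median_pos {x y w : ℝ} (hx : 0 ≤ x) (hy : 0 ≤ y) (hw : 0 ≤ w) (h1 : x ≠ 0 ∨ y ≠ 0)
    (h2 : y ≠ 0 ∨ w ≠ 0) (h3 : w ≠ 0 ∨ x ≠ 0) : 0 < median x y w := by
  simp only [median, lt_max_iff, lt_min_iff, hx.lt_iff_ne', hy.lt_iff_ne', hw.lt_iff_ne']
  tauto

namespace Y2

open Complex ComplexConjugate

/-- At most one of the coordinates of the triple vanishes. -/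
def InW (z : ZMod 3 → ℂ) : Prop := ∀ i j, i ≠ j → z i ≠ 0 ∨ z j ≠ 0

/-- The median of the absolute values of the coordinates. -/
noncomputable def mid (z : ZMod 3 → ℂ) : ℝ := median ‖z 0‖ ‖z 1‖ ‖z 2‖

/-- The maximum of the absolute values of the coordinates. -/
noncomputable def top (z : ZMod 3 → ℂ) : ℝ := max ‖z 0‖ (max ‖z 1‖ ‖z 2‖)

theorem mid_eq (z : ZMod 3 → ℂ) (i : ZMod 3) :
    mid z = median ‖z i‖ ‖z (i + 1)‖ ‖z (i + 2)‖ := by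
  fin_cases i
  · rfl
  · exact (median_rotate _ _ _).symm
  · exact median_rotate _ _ _

theorem top_eq (z : ZMod 3 → ℂ) (i : ZMod 3) :
    top z = max ‖z i‖ (max ‖z (i + 1)‖ ‖z (i + 2)‖) := by
  fin_cases i
  · rfl
  · change max ‖z 0‖ (max ‖z 1‖ ‖z 2‖) = max ‖z 1‖ (max ‖z 2‖ ‖z 0‖)
    ac_rfl
  · change max ‖z 0‖ (max ‖z 1‖ ‖z 2‖) = max ‖z 2‖ (max ‖z 0‖ ‖z 1‖)
    ac_rfl

theorem prod_eq (z : ZMod 3 → ℂ) (i : ZMod 3) :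
    z 0 * z 1 * z 2 = z i * z (i + 1) * z (i + 2) := by
  fin_cases i
  · rfl
  · change _ = z 1 * z 2 * z 0
    ring
  · change _ = z 2 * z 0 * z 1
    ring

theorem index_cases (i j : ZMod 3) : j = i ∨ j = i + 1 ∨ j = i + 2 := by
  revert i j; decide

theorem add_one_ne (i : ZMod 3) : i + 1 ≠ i := by revert i; decide

theorem add_two_ne (i : ZMod 3) : i + 2 ≠ i := by revert i; decide

theorem add_two_ne_add_one (i : ZMod 3) : i + 2 ≠ i + 1 := by revert i; decide

theorem InW.mid_pos {z : ZMod 3 → ℂ} (h : InW z) : 0 < mid z := by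
  refine median_pos (norm_nonneg _) (norm_nonneg _) (norm_nonneg _) ?_ ?_ ?_ <;>
    simpa only [norm_ne_zero_iff] using h _ _ (by decide)

theorem mid_le_top (z : ZMod 3 → ℂ) : mid z ≤ top z := by
  refine median_le_max.trans (max_le (le_max_left _ _) ?_)
  exact (le_max_left _ _).trans (le_max_right _ _)

theorem InW.top_pos {z : ZMod 3 → ℂ} (h : InW z) : 0 < top z := h.mid_pos.trans_le (mid_le_top z)

theorem mid_le_max (z : ZMod 3 → ℂ) {i j : ZMod 3} (h : i ≠ j) : mid z ≤ max ‖z i‖ ‖z j‖ := by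
  rcases index_cases i j with rfl | rfl | rfl
  · exact absurd rfl h
  · rw [mid_eq z i]
    exact median_le_max
  · rw [mid_eq z i, max_comm, ← median_rotate, ← median_rotate]
    exact median_le_max

theorem continuous_mid : Continuous mid := by
  unfold mid median
  fun_prop

theorem continuous_top : Continuous top := by
  unfold top
  fun_prop

/-- The coordinate `fold` in terms of homogeneous coordinates. -/
noncomputable def wFold (z : ZMod 3 → ℂ) : ℂ := z 0 * z 1 * z 2 / (mid z ^ 2 * top z : ℝ)

/-- The coordinate `height` in terms of homogeneous coordinates. -/
noncomputable def wHeight (z : ZMod 3 → ℂ) (i : ZMod 3) : ℝ := √(1 - (min ‖z i‖ (mid z) / mid z) ^ 2)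

theorem wHeight_of_le {z : ZMod 3 → ℂ} (hz : InW z) {i : ZMod 3} (h : mid z ≤ ‖z i‖) :
    wHeight z i = 0 := by
  rw [wHeight, min_eq_right h, div_self hz.mid_pos.ne']
  simp

theorem wHeight_sq {z : ZMod 3 → ℂ} (hz : InW z) {i : ZMod 3} (h : ‖z i‖ ≤ mid z) :
    wHeight z i ^ 2 = 1 - ‖z i‖ ^ 2 / mid z ^ 2 := by
  rw [wHeight, min_eq_left h, Real.sq_sqrt, div_pow]
  rw [sub_nonneg, div_pow, div_le_one (pow_pos hz.mid_pos 2)]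
  exact pow_le_pow_left₀ (norm_nonneg _) h 2

theorem mid_mul_top {z : ZMod 3 → ℂ} {i : ZMod 3} (h1 : ‖z i‖ ≤ ‖z (i + 1)‖)
    (h2 : ‖z i‖ ≤ ‖z (i + 2)‖) : mid z * top z = ‖z (i + 1)‖ * ‖z (i + 2)‖ := by
  rw [mid_eq z i, top_eq z i, median_eq_min h1 h2, max_eq_right (h1.trans (le_max_left _ _)),
    min_mul_max]

theorem exists_norm_le (z : ZMod 3 → ℂ) : ∃ i, ‖z i‖ ≤ ‖z (i + 1)‖ ∧ ‖z i‖ ≤ ‖z (i + 2)‖ := by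
  obtain ⟨i, hi⟩ := Finite.exists_min fun i => ‖z i‖
  exact ⟨i, hi _, hi _⟩

/-- If `z i` has the least modulus, then `mid` is the smaller of the other two moduli and `mid *
top` is their product, so `wFold` has modulus `‖z i‖ / mid`. The other two heights vanish. -/
theorem InW.isCoord {z : ZMod 3 → ℂ} (hz : InW z) : IsCoord (wFold z) (wHeight z) := by
  obtain ⟨i, h1, h2⟩ := exists_norm_le z
  have hm := hz.mid_pos
  have ht := hz.top_pos
  have hmid : mid z = min ‖z (i + 1)‖ ‖z (i + 2)‖ := by rw [mid_eq z i, median_eq_min h1 h2]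
  refine ⟨i, fun j hj => wHeight_of_le hz ?_, Real.sqrt_nonneg _, ?_⟩
  · rw [hmid]
    rcases index_cases i j with rfl | rfl | rfl
    · exact absurd rfl hj
    · exact min_le_left _ _
    · exact min_le_right _ _
  · rw [wHeight_sq hz (by rw [hmid]; exact le_min h1 h2), wFold, prod_eq z i, norm_div, norm_mul,
      norm_mul, mul_assoc, ← mid_mul_top h1 h2, Complex.norm_real,
      Real.norm_of_nonneg (by positivity)]
    field_simp
    ring

theorem exists_ofW {X : Type*} [TopologicalSpace X] {z : X → ZMod 3 → ℂ} (hz : Continuous z)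
    (h : ∀ x, InW (z x)) : ∃ f : C(X, Y2), (∀ x, fold (f x) = wFold (z x)) ∧
      ∀ x i, height i (f x) = wHeight (z x) i := by
  have h1 := continuous_mid.comp hz
  have h2 := continuous_top.comp hz
  refine exists_lift (A := fun x => wFold (z x)) (s := fun x => wHeight (z x)) ?_ ?_
    fun x => (h x).isCoord
  · unfold wFold
    refine Continuous.div (by fun_prop) (continuous_ofReal.comp ((h1.pow 2).mul h2)) fun x => ?_
    have := (h x).mid_pos
    have := (h x).top_pos
    rw [Ne, ofReal_eq_zero]
    positivity
  · unfold wHeight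
    refine continuous_pi fun i => Real.continuous_sqrt.comp (continuous_const.sub (Continuous.pow
      (Continuous.div ?_ h1 fun x => (h x).mid_pos.ne') 2))
    exact Continuous.min (by fun_prop) h1

/-- The homogeneous coordinate `z i` is the first component of a section of the `i`-th line bundle.
The second component is chosen to lie on the same line. -/
theorem InW.inLine {z : ZMod 3 → ℂ} (hz : InW z) {y : Y2} (hf : fold y = wFold z) (i : ZMod 3)
    (hh : height i y = wHeight z i) :
    InLine i y (z i, conj (z (i + 1) * z (i + 2)) * wHeight z i / top z) := by
  have hm := hz.mid_pos
  have ht := hz.top_pos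
  rw [InLine, hf, hh]
  dsimp only
  rcases le_or_gt (mid z) ‖z i‖ with h | h
  · rw [wHeight_of_le hz h]
    simp
  · rw [mid_eq z i] at h
    obtain ⟨h1, h2⟩ := le_of_lt_median h
    rw [← mid_eq z i] at h
    have e1 := wHeight_sq hz h.le
    have e2 : ((mid z : ℂ) * top z) ^ 2 =
        z (i + 1) * conj (z (i + 1)) * (z (i + 2) * conj (z (i + 2))) := by
      rw [mul_conj, mul_conj, normSq_eq_norm_sq, normSq_eq_norm_sq, ← ofReal_mul, mid_mul_top h1 h2]
      push_cast
      ring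
    have e3 : 1 - (wHeight z i : ℂ) ^ 2 = z i * conj (z i) / (mid z : ℂ) ^ 2 := by
      rw [mul_conj, normSq_eq_norm_sq, ← ofReal_pow, e1]
      push_cast
      ring
    have hm' : (mid z : ℂ) ≠ 0 := ofReal_ne_zero.2 hm.ne'
    have ht' : (top z : ℂ) ≠ 0 := ofReal_ne_zero.2 ht.ne'
    rw [e3, wFold, prod_eq z i]
    simp only [map_div₀, map_mul, map_pow, conj_ofReal, ofReal_mul, ofReal_pow]
    constructor
    · field_simp
      linear_combination (wHeight z i * z i : ℂ) * e2
    · field_simp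

/-- The section of `InW.inLine` has no zeros: where `z i = 0` the height is `1` and the other two
coordinates are nonzero. On the boundary all moduli agree, the height is zero, and the section winds
like `z i`. -/
theorem InW.deg {z : (Fin 2 → I) → ZMod 3 → ℂ} (hz : Continuous z) (h : ∀ t, InW (z t))
    {γ : (Fin 2 → I) → Y2} (hf : ∀ t, fold (γ t) = wFold (z t))
    (hh : ∀ t i, height i (γ t) = wHeight (z t) i)
    (hb : ∀ t ∈ Cube.boundary (Fin 2), ∀ i, ‖z t i‖ = 1) {i : ZMod 3} {a : ℤ}
    (ha : ∀ t ∈ Cube.boundary (Fin 2), z t i = wind a t) : Deg i γ a := by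
  have h2 := continuous_ofReal.comp (continuous_top.comp hz)
  have h3 : Continuous fun t => (wHeight (z t) i : ℂ) := by
    obtain ⟨f, -, hf'⟩ := exists_ofW hz h
    exact (continuous_ofReal.comp ((continuous_height i).comp f.continuous)).congr
      fun t => congrArg _ (hf' t i)
  have h4 : Continuous fun t => conj (z t (i + 1) * z t (i + 2)) :=
    continuous_conj.comp (by fun_prop)
  refine ⟨fun t => (z t i, conj (z t (i + 1) * z t (i + 2)) * wHeight (z t) i / top (z t)), ?_,
    fun t => ⟨(h t).inLine (hf t) i (hh t i), fun h0 => ?_⟩, (1, 0), fun t ht => ?_⟩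
  · exact Continuous.prodMk (by fun_prop)
      ((h4.mul h3).div h2 fun t => ofReal_ne_zero.2 (h t).top_pos.ne')
  · rw [Prod.mk_eq_zero] at h0
    obtain ⟨h5, h6⟩ := h0
    have h7 := wHeight_sq (h t) (i := i) (by rw [h5, norm_zero]; exact (h t).mid_pos.le)
    rw [h5, norm_zero, zero_pow two_ne_zero, zero_div, sub_zero] at h7
    have h8 : (wHeight (z t) i : ℂ) ≠ 0 := by
      intro h9
      rw [ofReal_eq_zero.1 h9] at h7
      norm_num at h7
    rw [div_eq_zero_iff, or_iff_left (ofReal_ne_zero.2 (h t).top_pos.ne'), mul_eq_zero,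
      or_iff_left h8, map_eq_zero, mul_eq_zero] at h6
    rcases h6 with h6 | h6
    · exact (h t i (i + 1) (add_one_ne i).symm).elim (fun h => h h5) fun h => h h6
    · exact (h t i (i + 2) (add_two_ne i).symm).elim (fun h => h h5) fun h => h h6
  · have h5 : wHeight (z t) i = 0 := wHeight_of_le (h t) (by
      rw [hb t ht, mid, hb t ht, hb t ht, hb t ht]
      simp [median])
    beta_reduce
    rw [h5, ha t ht]
    simp

/-- A triple of unit complex numbers with product `1` represents the base point. -/
theorem eq_base_of_norm {z : ZMod 3 → ℂ} (hz : ∀ i, ‖z i‖ = 1) (hp : z 0 * z 1 * z 2 = 1) {y : Y2}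
    (hf : fold y = wFold z) (hh : ∀ i, height i y = wHeight z i) : y = Y2.base := by
  have hW : InW z := fun i j _ => Or.inl (norm_ne_zero_iff.1 (by rw [hz]; exact one_ne_zero))
  have hm : mid z = 1 := by rw [mid, hz, hz, hz]; simp [median]
  refine ext ?_ fun i => ?_
  · rw [hf, fold_base, wFold, hp, hm, top, hz, hz, hz]
    simp
  · rw [hh, height_base, wHeight_of_le hW (by rw [hm, hz])]

/-- A sphere made of two hemispheres. -/
theorem exists_generator (i : ZMod 3) : ∃ γ : Ω^ (Fin 2) Y2 Y2.base,
    Deg i γ 1 ∧ Deg (i + 1) γ (-1) ∧ Deg (i + 2) γ 0 := by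
  -- On the boundary `w` is `wind 1`. The function `r` vanishes only on the boundary, where `w` does
  -- not, so `w` and `w - r` have no common zero.
  let w : (Fin 2 → I) → ℂ := fun t =>
    1 + (t 0 : ℝ) * (exp (2 * Real.pi * Complex.I * (t 1 : ℝ)) - 1)
  let r : (Fin 2 → I) → ℝ := fun t => t 0 * (1 - t 0) * (t 1 * (1 - t 1))
  have hw : Continuous w := by fun_prop
  have hr : Continuous fun t => (r t : ℂ) := by fun_prop
  have hwb : ∀ t ∈ Cube.boundary (Fin 2), w t = wind 1 t := by
    refine forall_boundary (fun x => ?_) (fun x => ?_) fun s x hx => ?_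
    · rw [wind_of_zero]
      simp [w]
    · rw [wind_of_one]
      simp [w]
    · rw [wind_of_edge _ _ hx]
      rcases hx with rfl | rfl <;> simp [w]
  have hrb : ∀ t, r t = 0 ↔ t ∈ Cube.boundary (Fin 2) := fun t => by
    rw [mem_boundary_iff]
    simp only [r, mul_eq_zero, sub_eq_zero, Set.Icc.coe_eq_zero, eq_comm (a := (1 : ℝ)),
      Set.Icc.coe_eq_one]
    tauto
  have hwn : ∀ t ∈ Cube.boundary (Fin 2), w t * conj (w t) = 1 := by
    intro t ht
    rw [hwb t ht, mul_conj, normSq_eq_norm_sq, wind]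
    split_ifs
    · rw [norm_exp]
      simp
    · simp
  -- The conjugate winds in the opposite direction, and on the boundary the product of the
  -- coordinates is `|w|² = 1`, which represents the base point.
  let z : (Fin 2 → I) → ZMod 3 → ℂ := fun t j =>
    if j = i then w t else if j = i + 1 then conj (w t - r t) else 1
  have hz0 : ∀ t, z t i = w t := fun t => if_pos rfl
  have hz1 : ∀ t, z t (i + 1) = conj (w t - r t) := fun t => (if_neg (add_one_ne i)).trans (if_pos rfl)
  have hz2 : ∀ t, z t (i + 2) = 1 := fun t => (if_neg (add_two_ne i)).trans (if_neg (add_two_ne_add_one i))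
  have hz : Continuous z := by
    refine continuous_pi fun j => ?_
    rcases index_cases i j with rfl | rfl | rfl
    · simpa only [hz0] using hw
    · simp only [hz1]
      exact continuous_conj.comp (hw.sub hr)
    · simpa only [hz2] using continuous_const
  have hne : ∀ t, w t ≠ 0 ∨ conj (w t - r t) ≠ 0 := fun t => by
    rw [Ne, Ne, map_eq_zero, sub_eq_zero]
    by_contra! h
    obtain ⟨h1, h2⟩ := h
    rw [h1, eq_comm, ofReal_eq_zero, hrb] at h2
    have := hwn t h2
    rw [h1, zero_mul] at this
    exact zero_ne_one this
  have hW : ∀ t, InW (z t) := fun t j k hjk => by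
    rcases index_cases i j with rfl | rfl | rfl
    · rcases index_cases j k with rfl | rfl | rfl
      · exact absurd rfl hjk
      · rw [hz0, hz1]
        exact hne t
      · rw [hz2]
        exact Or.inr one_ne_zero
    · rcases index_cases i k with rfl | rfl | rfl
      · rw [hz0, hz1]
        exact (hne t).symm
      · exact absurd rfl hjk
      · rw [hz2]
        exact Or.inr one_ne_zero
    · rw [hz2]
      exact Or.inl one_ne_zero
  have hb0 : ∀ t ∈ Cube.boundary (Fin 2), z t (i + 1) = conj (w t) := fun t ht => by
    rw [hz1, (hrb t).2 ht, ofReal_zero, sub_zero]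
  have hwn' : ∀ t ∈ Cube.boundary (Fin 2), ‖w t‖ = 1 := fun t ht => by
    have := hwn t ht
    rw [mul_conj, normSq_eq_norm_sq, ← ofReal_one, ofReal_inj] at this
    exact (pow_eq_one_iff_of_nonneg (norm_nonneg _) two_ne_zero).1 this
  have hb : ∀ t ∈ Cube.boundary (Fin 2), ∀ j, ‖z t j‖ = 1 := fun t ht j => by
    rcases index_cases i j with rfl | rfl | rfl
    · rw [hz0, hwn' t ht]
    · rw [hb0 t ht, norm_conj, hwn' t ht]
    · rw [hz2, norm_one]
  obtain ⟨f, hf, hh⟩ := exists_ofW hz hW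
  refine ⟨⟨f, fun t ht => eq_base_of_norm (hb t ht) ?_ (hf t) (hh t)⟩, ?_, ?_, ?_⟩
  · rw [prod_eq (z t) i, hz0, hb0 t ht, hz2, mul_one, hwn t ht]
  · exact InW.deg hz hW hf hh hb fun t ht => by rw [hz0, hwb t ht]
  · refine InW.deg hz hW hf hh hb fun t ht => ?_
    rw [hb0 t ht, hwb t ht, wind, wind]
    split_ifs
    · rw [← exp_conj]
      simp [map_ofNat]
    · simp
  · refine InW.deg hz hW hf hh hb fun t ht => ?_
    rw [hz2, wind]
    simp

end Y2

namespace Y2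

open Complex ComplexConjugate

/-! ### Null-homotopies -/

theorem homotopicRel_of_homogeneous {γ γ' : Ω^ (Fin 2) Y2 Y2.base}
    {H : I × (Fin 2 → I) → ZMod 3 → ℂ} (hH : Continuous H) (hW : ∀ x, InW (H x))
    (hb : ∀ s, ∀ t ∈ Cube.boundary (Fin 2), H (s, t) = 1)
    (h0 : ∀ t, fold (γ t) = wFold (H (0, t)) ∧ ∀ i, height i (γ t) = wHeight (H (0, t)) i)
    (h1 : ∀ t, fold (γ' t) = wFold (H (1, t)) ∧ ∀ i, height i (γ' t) = wHeight (H (1, t)) i) :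
    GenLoop.Homotopic γ γ' := by
  obtain ⟨f, hf, hh⟩ := exists_ofW hH hW
  refine ⟨⟨⟨f, fun t => ?_, fun t => ?_⟩, fun s t ht => ?_⟩⟩
  · exact ext ((hf _).trans (h0 t).1.symm) fun i => (hh _ i).trans ((h0 t).2 i).symm
  · exact ext ((hf _).trans (h1 t).1.symm) fun i => (hh _ i).trans ((h1 t).2 i).symm
  · refine Eq.trans (eq_base_of_norm (z := H (s, t)) (fun i => ?_) ?_ (hf _) (hh _)) (γ.2 t ht).symm
    · rw [hb s t ht, Pi.one_apply, norm_one]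
    · rw [hb s t ht]
      simp

/-- A family of triples that stays at `1` on the boundary can be approximated by a differentiable
one. -/
theorem exists_contDiff_triple {z : (Fin 2 → I) → ZMod 3 → ℂ} (hz : Continuous z)
    (hb : ∀ t ∈ Cube.boundary (Fin 2), z t = 1) {ε : ℝ} (hε : 0 < ε) :
    ∃ q : (Fin 2 → ℝ) → ZMod 3 → ℂ, ContDiff ℝ 1 q ∧
      (∀ t : Fin 2 → I, ∀ i, ‖q (fun j => t j) i - z t i‖ < ε) ∧
      ∀ t ∈ Cube.boundary (Fin 2), q (fun j => t j) = 1 := by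
  let j : (Fin 2 → I) → Fin 2 → ℝ := fun t k => t k
  have hj : Continuous j := by fun_prop
  have hj' : Function.Injective j := fun t t' h => funext fun k => Subtype.ext (congrFun h k)
  obtain ⟨p, hp, hp1, hp2⟩ := exists_contDiff_approx_pi hj hj'
    (⟨fun t i => (z t i - 1).re, by fun_prop⟩ : C(Fin 2 → I, ZMod 3 → ℝ)) (half_pos hε)
  obtain ⟨r, hr, hr1, hr2⟩ := exists_contDiff_approx_pi hj hj'
    (⟨fun t i => (z t i - 1).im, by fun_prop⟩ : C(Fin 2 → I, ZMod 3 → ℝ)) (half_pos hε)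
  refine ⟨fun x i => 1 + p x i + r x i * Complex.I, ?_, fun t i => ?_, fun t ht => funext fun i => ?_⟩
  · have h1 := contDiff_pi.1 hp
    have h2 := contDiff_pi.1 hr
    refine contDiff_pi.2 fun i => (contDiff_const.add ?_).add (ContDiff.mul ?_ contDiff_const)
    · exact ofRealCLM.contDiff.comp (h1 i)
    · exact ofRealCLM.contDiff.comp (h2 i)
  · have e1 := hp1 t i
    have e2 := hr1 t i
    change |p (j t) i - (z t i - 1).re| < _ at e1
    change |r (j t) i - (z t i - 1).im| < _ at e2
    refine (norm_le_abs_re_add_abs_im _).trans_lt ?_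
    have h1 : (1 + (p (j t) i : ℂ) + r (j t) i * Complex.I - z t i).re =
        p (j t) i - (z t i - 1).re := by
      simp
      ring
    have h2 : (1 + (p (j t) i : ℂ) + r (j t) i * Complex.I - z t i).im =
        r (j t) i - (z t i - 1).im := by
      simp
    change |(1 + (p (j t) i : ℂ) + r (j t) i * Complex.I - z t i).re| +
      |(1 + (p (j t) i : ℂ) + r (j t) i * Complex.I - z t i).im| < ε
    rw [h1, h2]
    linarith
  · have e1 : p (j t) i = 0 := hp2 t i (by
      change (z t i - 1).re = 0
      rw [hb t ht, Pi.one_apply, sub_self, zero_re])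
    have e2 : r (j t) i = 0 := hr2 t i (by
      change (z t i - 1).im = 0
      rw [hb t ht, Pi.one_apply, sub_self, zero_im])
    change 1 + (p (j t) i : ℂ) + r (j t) i * Complex.I = 1
    rw [e1, e2]
    simp

/-- A generic triple does not share two of its coordinates, up to a common real factor, with any
member of a given two-dimensional family. -/
theorem exists_generic {q : (Fin 2 → ℝ) → ZMod 3 → ℂ} (hq : ContDiff ℝ 1 q) :
    ∃ c : ZMod 3 → ℂ, (∀ i, ‖c i - 1‖ < 1) ∧
      ∀ i j, i ≠ j → ∀ (r : ℝ) (x : Fin 2 → ℝ), c i = r * q x i → c j ≠ r * q x j := by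
  -- If `c` shares two coordinates with a real multiple of `q x`, it lies in the image of `f k`,
  -- with `k` the third index. The parameters are one real factor, the two coordinates of `x` and
  -- one complex number: five real dimensions in a space of six.
  let f : ZMod 3 → (ℝ × (Fin 2 → ℝ)) × ℂ → ZMod 3 → ℂ := fun k x l =>
    if l = k then x.2 else x.1.1 * q x.1.2 l
  have hf : ∀ k, ContDiff ℝ 1 (f k) := fun k => by
    refine contDiff_pi.2 fun l => ?_
    by_cases h : l = k
    · simp only [f, h, if_true]
      exact contDiff_snd
    · simp only [f, h, if_false]
      exact (ofRealCLM.contDiff.comp (contDiff_fst.comp contDiff_fst)).mul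
        ((contDiff_pi.1 hq l).comp (contDiff_snd.comp contDiff_fst))
  have hd : Dense (⋃ k, Set.range (f k))ᶜ := by
    refine dense_compl_of_dimH_lt_finrank ?_
    rw [dimH_iUnion]
    have h5 : Module.finrank ℝ ((ℝ × (Fin 2 → ℝ)) × ℂ) = 5 := by simp
    have h6 : Module.finrank ℝ (ZMod 3 → ℂ) = 6 := by simp [Module.finrank_pi_fintype]
    refine (iSup_le fun k => ((hf k).dimH_range_le.trans_eq (by rw [h5]))).trans_lt ?_
    rw [h6]
    norm_num
  obtain ⟨c, hc, hc'⟩ := Metric.dense_iff.1 hd 1 1 one_pos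
  rw [mem_ball_iff_norm, pi_norm_lt_iff one_pos] at hc
  refine ⟨c, hc, fun i j hij r x hi hj => hc' ?_⟩
  obtain ⟨k, hik, hjk, hk⟩ : ∃ k, i ≠ k ∧ j ≠ k ∧ ∀ l, l = i ∨ l = j ∨ l = k := by
    clear hi hj
    revert i j
    decide
  refine Set.mem_iUnion.2 ⟨k, ((r, x), c k), funext fun l => ?_⟩
  simp only [f]
  rcases hk l with rfl | rfl | rfl
  · rw [if_neg hik, hi]
  · rw [if_neg hjk, hj]
  · rw [if_pos rfl]

/-- `H` moves `z` in a straight line to a differentiable approximation `q`; one of any two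
coordinates has modulus at least `mid z`, more than the error of the approximation, so two never
vanish together. `K` then contracts `q` along segments to a generic point `c`. -/
theorem exists_homotopy_homogeneous {z : (Fin 2 → I) → ZMod 3 → ℂ} (hz : Continuous z)
    (hW : ∀ t, InW (z t)) (hb : ∀ t ∈ Cube.boundary (Fin 2), z t = 1) :
    ∃ (q : (Fin 2 → I) → ZMod 3 → ℂ) (H K : I × (Fin 2 → I) → ZMod 3 → ℂ),
      (Continuous H ∧ (∀ x, InW (H x)) ∧ (∀ s, ∀ t ∈ Cube.boundary (Fin 2), H (s, t) = 1) ∧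
        (∀ t, H (0, t) = z t) ∧ ∀ t, H (1, t) = q t) ∧
      Continuous K ∧ (∀ x, InW (K x)) ∧ (∀ s, ∀ t ∈ Cube.boundary (Fin 2), K (s, t) = 1) ∧
        (∀ t, K (0, t) = q t) ∧ ∀ t, K (1, t) = 1 := by
  obtain ⟨t₀, -, ht₀⟩ := (isCompact_univ (X := Fin 2 → I)).exists_isMinOn Set.univ_nonempty
    (continuous_mid.comp hz).continuousOn
  have hδ := (hW t₀).mid_pos
  have hmin : ∀ t, mid (z t₀) ≤ mid (z t) := fun t => ht₀ (Set.mem_univ t)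
  obtain ⟨q, hq, hq1, hqb⟩ := exists_contDiff_triple hz hb hδ
  obtain ⟨c, hc, hc'⟩ := exists_generic hq
  let j : (Fin 2 → I) → Fin 2 → ℝ := fun t k => t k
  have hqc : Continuous fun t => q (j t) := hq.continuous.comp (by fun_prop)
  let H : I × (Fin 2 → I) → ZMod 3 → ℂ := fun x i =>
    z x.2 i + (x.1 : ℝ) * (q (j x.2) i - z x.2 i)
  have hHW : ∀ x, InW (H x) := fun x i k hik => by
    have key : ∀ l, mid (z t₀) ≤ ‖z x.2 l‖ → H x l ≠ 0 := fun l hl h0 => by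
      have h1 : z x.2 l = -((x.1 : ℝ) * (q (j x.2) l - z x.2 l)) := eq_neg_of_add_eq_zero_left h0
      have h2 : ‖z x.2 l‖ ≤ ‖q (j x.2) l - z x.2 l‖ := by
        rw [h1, norm_neg, norm_mul, norm_real, Real.norm_of_nonneg x.1.2.1, ← h1]
        exact mul_le_of_le_one_left (norm_nonneg _) x.1.2.2
      exact absurd (hq1 x.2 l) (not_lt.2 (hl.trans h2))
    exact (le_max_iff.1 ((hmin x.2).trans (mid_le_max _ hik))).imp (key i) (key k)
  have hqW : ∀ t, InW (q (j t)) := fun t => by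
    have : H (1, t) = q (j t) := funext fun i => by simp [H]
    rw [← this]
    exact hHW _
  -- On the boundary `q = 1` and `D` is the numerator of `K`, so dividing by it keeps the boundary
  -- at `1`. It has no zeros because `c` is within distance `1` of `1`.
  let D : I → ZMod 3 → ℂ := fun s i => 1 + (s : ℝ) * (c i - 1)
  have hD : ∀ s i, D s i ≠ 0 := fun s i h => by
    have h1 : (s : ℝ) * (c i - 1) = -1 := (eq_neg_of_add_eq_zero_right h)
    have h2 := congrArg norm h1
    rw [norm_neg, norm_one, norm_mul, norm_real, Real.norm_of_nonneg s.2.1] at h2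
    nlinarith [hc i, s.2.2, norm_nonneg (c i - 1), s.2.1]
  let K : I × (Fin 2 → I) → ZMod 3 → ℂ := fun x i =>
    ((1 - (x.1 : ℝ)) * q (j x.2) i + (x.1 : ℝ) * c i) / D x.1 i
  refine ⟨fun t => q (j t), H, K, ⟨?_, hHW, fun s t ht => funext fun i => ?_,
    fun t => funext fun i => ?_, fun t => funext fun i => ?_⟩, ?_, fun x i k hik => ?_,
    fun s t ht => funext fun i => ?_, fun t => funext fun i => ?_, fun t => funext fun i => ?_⟩
  · have := hqc.comp (continuous_snd (X := I))
    fun_prop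
  · have h1 : q (j t) = 1 := hqb t ht
    simp only [H]
    rw [h1, hb t ht]
    simp
  · simp [H]
  · simp [H]
  · have := hqc.comp (continuous_snd (X := I))
    refine continuous_pi fun i => Continuous.div ?_ (by fun_prop) fun x => hD _ _
    fun_prop
  · by_contra! h
    obtain ⟨h1, h2⟩ := h
    simp only [K, div_eq_zero_iff, hD, or_false] at h1 h2
    rcases eq_or_ne (x.1 : ℝ) 0 with h0 | h0
    · rw [h0, ofReal_zero, sub_zero, one_mul, zero_mul, add_zero] at h1 h2
      exact (hqW x.2 i k hik).elim (fun h => h h1) fun h => h h2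
    · have h0' : ((x.1 : ℝ) : ℂ) ≠ 0 := ofReal_ne_zero.2 h0
      -- Where `(1 - s) q + s c` vanishes, `c` is the multiple of `q` by `-(1 - s) / s`.
      refine hc' i k hik (-(1 - x.1) / x.1) (j x.2) ?_ ?_
      · push_cast
        field_simp
        linear_combination h1
      · push_cast
        field_simp
        linear_combination h2
  · have h1 : q (j t) = 1 := hqb t ht
    simp only [K]
    rw [h1, Pi.one_apply, div_eq_one_iff_eq (hD _ _)]
    simp only [D]
    ring
  · simp [K, D]
  · have h1 : c i ≠ 0 := fun h => by
      have := hc i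
      rw [h] at this
      norm_num at this
    simp [K, D, h1]

/-! ### Spheres of degree zero -/

/-- On triples with two unit coordinates and a third one in the unit disc, `mid` and `top` are `1`
and the map to `Y₂` is the plain product. Lifts of spheres are built from such triples. -/
theorem wFold_of_norm_eq_one {z : ZMod 3 → ℂ} {i : ZMod 3} (h0 : ‖z i‖ ≤ 1) (h1 : ‖z (i + 1)‖ = 1)
    (h2 : ‖z (i + 2)‖ = 1) : InW z ∧ wFold z = z i * z (i + 1) * z (i + 2) ∧
      wHeight z i ^ 2 = 1 - ‖z i‖ ^ 2 ∧ wHeight z (i + 1) = 0 ∧ wHeight z (i + 2) = 0 := by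
  have hm : mid z = 1 := by
    rw [mid_eq z i, median_eq_min (h0.trans_eq h1.symm) (h0.trans_eq h2.symm), h1, h2, min_self]
  have ht : top z = 1 := by rw [top_eq z i, h1, h2, max_self, max_eq_right h0]
  have n1 : z (i + 1) ≠ 0 := norm_ne_zero_iff.1 (by rw [h1]; exact one_ne_zero)
  have n2 : z (i + 2) ≠ 0 := norm_ne_zero_iff.1 (by rw [h2]; exact one_ne_zero)
  have hW : InW z := fun j k hjk => by
    rcases index_cases i j with rfl | rfl | rfl
    · rcases index_cases j k with rfl | rfl | rfl
      · exact absurd rfl hjk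
      · exact Or.inr n1
      · exact Or.inr n2
    · exact Or.inl n1
    · exact Or.inl n2
  refine ⟨hW, ?_, ?_, wHeight_of_le hW (by rw [hm, h1]), wHeight_of_le hW (by rw [hm, h2])⟩
  · rw [wFold, hm, ht, prod_eq z i]
    simp
  · rw [wHeight_sq hW (by rw [hm]; exact h0), hm]
    simp

/-- Homogeneous coordinates of a point, in terms of unit vectors of two of the lines. -/
noncomputable def triple (y : Y2) (v w : ℂ × ℂ) : ZMod 3 → ℂ := fun i =>
  if i = 0 then v.1 else if i = 1 then w.1 else
    fold y * conj (v.1 * w.1) + height 0 y * conj (v.2 * w.1) + height 1 y * conj (w.2 * v.1)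

theorem InLine.of_height_eq_zero {i : ZMod 3} {y : Y2} {v : ℂ × ℂ} (hv : InLine i y v)
    (h1 : v.1 * conj v.1 + v.2 * conj v.2 = 1) (h : height i y = 0) :
    v.2 = 0 ∧ v.1 * conj v.1 = 1 := by
  have h2 : v.2 = 0 := by
    have := hv.2
    rw [h, ofReal_zero] at this
    linear_combination -this
  refine ⟨h2, ?_⟩
  rw [h2] at h1
  simpa using h1

theorem InLine.exists_unit {i : ZMod 3} {y : Y2} {v : ℂ × ℂ} (hv : InLine i y v)
    (h1 : v.1 * conj v.1 + v.2 * conj v.2 = 1)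
    (h : fold y * conj (fold y) = 1 - (height i y : ℂ) ^ 2) :
    ∃ l : ℂ, l * conj l = 1 ∧ v.1 = l * fold y ∧ v.2 = l * height i y := by
  obtain ⟨e1, e2⟩ := hv
  have f1 : v.1 = (v.1 * conj (fold y) + v.2 * height i y) * fold y := by
    linear_combination -v.1 * h + (height i y : ℂ) * e1
  have f2 : v.2 = (v.1 * conj (fold y) + v.2 * height i y) * height i y := by
    linear_combination -e2
  refine ⟨_, ?_, f1, f2⟩
  generalize v.1 * conj (fold y) + v.2 * height i y = l at f1 f2
  rw [f1, f2] at h1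
  simp only [map_mul, conj_ofReal] at h1
  linear_combination h1 - l * conj l * h

theorem norm_eq_one_of_mul_conj {a : ℂ} (h : a * conj a = 1) : ‖a‖ = 1 := by
  rw [mul_conj, normSq_eq_norm_sq, ← ofReal_one, ofReal_inj] at h
  exact (pow_eq_one_iff_of_nonneg (norm_nonneg _) two_ne_zero).1 h

theorem eq_of_triple {y : Y2} {z : ZMod 3 → ℂ} {i : ZMod 3} (hi : ∀ j ≠ i, height j y = 0)
    (h0 : 0 ≤ height i y) (h1 : ‖fold y‖ ^ 2 + height i y ^ 2 = 1) (hz : ‖z i‖ = ‖fold y‖)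
    (hz1 : ‖z (i + 1)‖ = 1) (hz2 : ‖z (i + 2)‖ = 1) (hp : z 0 * z 1 * z 2 = fold y) :
    InW z ∧ fold y = wFold z ∧ ∀ i, height i y = wHeight z i := by
  have h2 : ‖z i‖ ≤ 1 := by
    rw [hz]
    nlinarith [norm_nonneg (fold y), sq_nonneg (height i y)]
  obtain ⟨e1, e2, e3, e4, e5⟩ := wFold_of_norm_eq_one h2 hz1 hz2
  refine ⟨e1, by rw [e2, ← prod_eq, hp], fun j => ?_⟩
  rcases index_cases i j with rfl | rfl | rfl
  · rw [hz, ← h1, add_sub_cancel_left] at e3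
    exact ((sq_eq_sq₀ (Real.sqrt_nonneg _) h0).1 e3).symm
  · rw [e4, hi _ (add_one_ne i)]
  · rw [e5, hi _ (add_two_ne i)]

/-- The first two coordinates come from unit vectors of two of the lines, and the third is forced by
the requirement that the product be `fold y`. On each of the three discs the three-term formula in
`triple` reduces to this value; having one formula makes the lift continuous. -/
theorem triple_spec {y : Y2} {v w : ℂ × ℂ} (hv : InLine 0 y v) (hw : InLine 1 y w)
    (hv1 : v.1 * conj v.1 + v.2 * conj v.2 = 1) (hw1 : w.1 * conj w.1 + w.2 * conj w.2 = 1) :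
    InW (triple y v w) ∧ fold y = wFold (triple y v w) ∧
      ∀ i, height i y = wHeight (triple y v w) i := by
  obtain ⟨i, hi, h0, h1⟩ := isCoord y
  dsimp only at hi h0 h1
  have hc : fold y * conj (fold y) = 1 - (height i y : ℂ) ^ 2 := by
    rw [mul_conj, normSq_eq_norm_sq, eq_sub_iff_add_eq]
    exact_mod_cast h1
  have z0 : triple y v w 0 = v.1 := rfl
  have z1 : triple y v w 1 = w.1 := rfl
  have z2 : triple y v w 2 = fold y * conj (v.1 * w.1) + height 0 y * conj (v.2 * w.1) +
    height 1 y * conj (w.2 * v.1) := rfl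
  obtain rfl | rfl | rfl : i = 0 ∨ i = 1 ∨ i = 2 := by clear * -; revert i; decide
  · obtain ⟨w2, w1⟩ := hw.of_height_eq_zero hw1 (hi 1 (by decide))
    obtain ⟨l, hl, v1, v2⟩ := hv.exists_unit hv1 hc
    have e2 : triple y v w 2 = conj (w.1 * l) := by
      rw [z2, hi 1 (by decide), v1, v2]
      simp only [map_mul, conj_ofReal, ofReal_zero, zero_mul, add_zero]
      linear_combination conj l * conj w.1 * hc
    refine eq_of_triple hi h0 h1 ?_ ?_ ?_ ?_
    · rw [z0, v1, norm_mul, norm_eq_one_of_mul_conj hl, one_mul]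
    · exact norm_eq_one_of_mul_conj w1
    · change ‖triple y v w 2‖ = 1
      rw [e2, norm_conj, norm_mul, norm_eq_one_of_mul_conj hl, norm_eq_one_of_mul_conj w1, one_mul]
    · rw [z0, z1, e2, map_mul, v1]
      linear_combination fold y * w.1 * conj w.1 * hl + fold y * w1
  · obtain ⟨v2, v1⟩ := hv.of_height_eq_zero hv1 (hi 0 (by decide))
    obtain ⟨l, hl, w1, w2⟩ := hw.exists_unit hw1 hc
    have e2 : triple y v w 2 = conj (v.1 * l) := by
      rw [z2, hi 0 (by decide), w1, w2]
      simp only [map_mul, conj_ofReal, ofReal_zero, zero_mul, add_zero]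
      linear_combination conj l * conj v.1 * hc
    refine eq_of_triple hi h0 h1 ?_ ?_ ?_ ?_
    · rw [z1, w1, norm_mul, norm_eq_one_of_mul_conj hl, one_mul]
    · change ‖triple y v w 2‖ = 1
      rw [e2, norm_conj, norm_mul, norm_eq_one_of_mul_conj hl, norm_eq_one_of_mul_conj v1, one_mul]
    · exact norm_eq_one_of_mul_conj v1
    · rw [z0, z1, e2, map_mul, w1]
      linear_combination fold y * v.1 * conj v.1 * hl + fold y * v1
  · obtain ⟨v2, v1⟩ := hv.of_height_eq_zero hv1 (hi 0 (by decide))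
    obtain ⟨w2, w1⟩ := hw.of_height_eq_zero hw1 (hi 1 (by decide))
    have e2 : triple y v w 2 = fold y * conj (v.1 * w.1) := by
      rw [z2, hi 0 (by decide), hi 1 (by decide)]
      simp
    refine eq_of_triple hi h0 h1 ?_ ?_ ?_ ?_
    · rw [e2, norm_mul, norm_conj, norm_mul, norm_eq_one_of_mul_conj v1,
        norm_eq_one_of_mul_conj w1, mul_one, mul_one]
    · exact norm_eq_one_of_mul_conj v1
    · exact norm_eq_one_of_mul_conj w1
    · rw [z0, z1, e2, map_mul]
      linear_combination fold y * w.1 * conj w.1 * v1 + fold y * w1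

theorem exists_unit_section {i : ZMod 3} {γ : Ω^ (Fin 2) Y2 Y2.base} (h : Deg i γ 0) :
    ∃ v : (Fin 2 → I) → ℂ × ℂ, Continuous v ∧ (∀ t, InLine i (γ t) (v t) ∧
      (v t).1 * conj (v t).1 + (v t).2 * conj (v t).2 = 1) ∧
      ∀ t ∈ Cube.boundary (Fin 2), v t = (1, 0) := by
  obtain ⟨v, hv, hv', hb⟩ := h.exists_section γ.2
  let n : (Fin 2 → I) → ℝ := fun t => √(‖(v t).1‖ ^ 2 + ‖(v t).2‖ ^ 2)
  have hn : Continuous n := by fun_prop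
  have hpos : ∀ t, 0 < ‖(v t).1‖ ^ 2 + ‖(v t).2‖ ^ 2 := fun t => by
    by_contra! h
    have h1 := sq_nonneg ‖(v t).1‖
    have h2 := sq_nonneg ‖(v t).2‖
    have h3 : ‖(v t).1‖ ^ 2 = 0 := by linarith
    have h4 : ‖(v t).2‖ ^ 2 = 0 := by linarith
    refine (hv' t).2 (Prod.ext ?_ ?_)
    · simpa using h3
    · simpa using h4
  have hn0 : ∀ t, (n t : ℂ) ≠ 0 := fun t => ofReal_ne_zero.2 (Real.sqrt_pos.2 (hpos t)).ne'
  have hn2 : ∀ t, (n t : ℂ) ^ 2 = (v t).1 * conj (v t).1 + (v t).2 * conj (v t).2 := fun t => by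
    rw [← ofReal_pow, Real.sq_sqrt (hpos t).le, mul_conj, mul_conj, normSq_eq_norm_sq,
      normSq_eq_norm_sq, ← ofReal_add]
  refine ⟨fun t => (n t : ℂ)⁻¹ • v t, ?_, fun t => ⟨(hv' t).1.smul _, ?_⟩, fun t ht => ?_⟩
  · exact ((continuous_ofReal.comp hn).inv₀ hn0).smul hv
  · simp only [Prod.smul_fst, Prod.smul_snd, smul_eq_mul, map_mul, map_inv₀, conj_ofReal]
    have := hn0 t
    field_simp
    rw [hn2]
  · have h1 : v t = (1, 0) := by
      rw [hb t ht, wind]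
      simp
    have h2 : n t = 1 := by simp [n, h1]
    beta_reduce
    rw [h1, h2]
    simp

/-- A sphere is determined by two of its degrees. -/
theorem homotopic_const {γ : Ω^ (Fin 2) Y2 Y2.base} (h₀ : Deg 0 γ 0) (h₁ : Deg 1 γ 0) :
    GenLoop.Homotopic γ GenLoop.const := by
  -- Degree zero gives sections of two of the bundles that are constant on the boundary. They lift
  -- the sphere to homogeneous coordinates, where it contracts.
  obtain ⟨v, hv, hv', hvb⟩ := exists_unit_section h₀
  obtain ⟨w, hw, hw', hwb⟩ := exists_unit_section h₁
  have hspec := fun t => triple_spec (hv' t).1 (hw' t).1 (hv' t).2 (hw' t).2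
  have hγ : ∀ t ∈ Cube.boundary (Fin 2), γ t = Y2.base := γ.2
  have hc : Continuous fun t => triple (γ t) (v t) (w t) := by
    have e1 := continuous_fold.comp γ.1.continuous
    have e2 := continuous_ofReal.comp ((continuous_height 0).comp γ.1.continuous)
    have e3 := continuous_ofReal.comp ((continuous_height 1).comp γ.1.continuous)
    refine continuous_pi fun i => ?_
    unfold triple
    split_ifs
    · fun_prop
    · fun_prop
    · exact ((e1.mul (continuous_conj.comp (by fun_prop))).add
        (e2.mul (continuous_conj.comp (by fun_prop)))).add
          (e3.mul (continuous_conj.comp (by fun_prop)))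
  have hb : ∀ t ∈ Cube.boundary (Fin 2), triple (γ t) (v t) (w t) = 1 := fun t ht => by
    funext i
    rw [hγ t ht, hvb t ht, hwb t ht, triple, fold_base]
    simp
  obtain ⟨q, H, K, ⟨hH, hHW, hHb, hH0, hH1⟩, hK, hKW, hKb, hK0, hK1⟩ :=
    exists_homotopy_homogeneous hc (fun t => (hspec t).1) hb
  have hqW : ∀ t, InW (q t) := fun t => hK0 t ▸ hKW (0, t)
  have hqc : Continuous q := (hK.comp (Continuous.prodMk_right 0)).congr hK0
  obtain ⟨f, hf, hf'⟩ := exists_ofW hqc hqW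
  have hone : ∀ (y : Y2) (z : ZMod 3 → ℂ), z = 1 → fold y = wFold z →
      (∀ i, height i y = wHeight z i) → y = Y2.base := fun y z hz h1 h2 =>
    eq_base_of_norm (fun i => by rw [hz, Pi.one_apply, norm_one]) (by rw [hz]; simp) h1 h2
  have hfb : ∀ t ∈ Cube.boundary (Fin 2), f t = Y2.base := fun t ht =>
    hone _ _ ((hK0 t).symm.trans (hKb 0 t ht)) (hf t) (hf' t)
  have hbase : Y2.base = Y2.base ∧ fold Y2.base = wFold 1 ∧
      ∀ i, height i Y2.base = wHeight 1 i := by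
    have hW1 : InW 1 := fun i j _ => Or.inl one_ne_zero
    obtain ⟨y, e1, e2⟩ := hW1.isCoord.exists_mk
    obtain rfl := hone y 1 rfl e1 e2
    exact ⟨rfl, e1, e2⟩
  let δ : Ω^ (Fin 2) Y2 Y2.base := ⟨f, hfb⟩
  have hδ : ∀ t, fold (δ t) = wFold (q t) ∧ ∀ i, height i (δ t) = wHeight (q t) i :=
    fun t => ⟨hf t, hf' t⟩
  refine (homotopicRel_of_homogeneous (γ' := δ) hH hHW hHb (fun t => ?_) fun t => ?_).trans
    (homotopicRel_of_homogeneous hK hKW hKb (fun t => ?_) fun t => ?_)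
  · rw [hH0]
    exact (hspec t).2
  · rw [hH1]
    exact hδ t
  · rw [hK0]
    exact hδ t
  · rw [hK1]
    exact hbase.2

end Y2

/-! ### Free homotopy -/

namespace FreelyHomotopic

variable {X Z : Type} [TopologicalSpace X] [TopologicalSpace Z] {f f' f'' : (Fin 2 → I) → X}

/-- Free homotopies as homotopies through maps that are constant on the boundary. -/
theorem iff_homotopicWith {f f' : C(Fin 2 → I, X)} : FreelyHomotopic f f' ↔
    f.HomotopicWith f' fun h => ∀ b ∈ Cube.boundary (Fin 2), ∀ b' ∈ Cube.boundary (Fin 2),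
      h b = h b' :=
  ⟨fun ⟨F, h0, h1, h⟩ => ⟨⟨⟨F, h0, h1⟩, h⟩⟩, fun ⟨F⟩ => ⟨F.toContinuousMap, F.apply_zero, F.apply_one,
    F.prop'⟩⟩

theorem continuous (h : FreelyHomotopic f f') : Continuous f ∧ Continuous f' := by
  obtain ⟨F, h0, h1, -⟩ := h
  exact ⟨(F.continuous.comp (Continuous.prodMk_right 0)).congr h0,
    (F.continuous.comp (Continuous.prodMk_right 1)).congr h1⟩

theorem symm (h : FreelyHomotopic f f') : FreelyHomotopic f' f := by
  obtain ⟨h1, h2⟩ := h.continuous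
  lift f to C(Fin 2 → I, X) using h1
  lift f' to C(Fin 2 → I, X) using h2
  exact iff_homotopicWith.2 (iff_homotopicWith.1 h).symm

theorem trans (h : FreelyHomotopic f f') (h' : FreelyHomotopic f' f'') : FreelyHomotopic f f'' := by
  obtain ⟨h1, h2⟩ := h.continuous
  have h3 := h'.continuous.2
  lift f to C(Fin 2 → I, X) using h1
  lift f' to C(Fin 2 → I, X) using h2
  lift f'' to C(Fin 2 → I, X) using h3
  exact iff_homotopicWith.2 ((iff_homotopicWith.1 h).trans (iff_homotopicWith.1 h'))

theorem map (h : FreelyHomotopic f f') {k : X → Z} (hk : Continuous k) :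
    FreelyHomotopic (fun t => k (f t)) fun t => k (f' t) := by
  obtain ⟨F, h0, h1, hF⟩ := h
  exact ⟨⟨fun x => k (F x), hk.comp F.continuous⟩, fun t => congrArg k (h0 t),
    fun t => congrArg k (h1 t), fun s b hb b' hb' => congrArg k (hF s b hb b' hb')⟩

theorem of_homotopic {x : X} {γ δ : Ω^ (Fin 2) X x} (h : GenLoop.Homotopic γ δ) :
    FreelyHomotopic γ δ := by
  obtain ⟨F⟩ := h
  exact ⟨F.toContinuousMap, F.apply_zero, F.apply_one, fun s b hb b' hb' =>
    ((F.eq_fst s hb).trans (γ.2 b hb)).trans ((F.eq_fst s hb').trans (γ.2 b' hb')).symm⟩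

end FreelyHomotopic

theorem piClass_eq_iff {n : ℕ} {X : Type} [TopologicalSpace X] {x : X} {γ δ : Ω^ (Fin n) X x} :
    piClass γ = piClass δ ↔ GenLoop.Homotopic γ δ := Quotient.eq

theorem piClass_surjective {n : ℕ} {X : Type} [TopologicalSpace X] {x : X} :
    Function.Surjective (piClass : Ω^ (Fin n) X x → π_ n X x) := Quotient.mk_surjective

/-- The product of the homotopy group puts the second factor first along the coordinate. -/
theorem piClass_mul {X : Type} [TopologicalSpace X] {x : X} (γ δ : Ω^ (Fin 2) X x) :
    piClass γ * piClass δ = piClass (GenLoop.transAt 0 δ γ) :=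
  HomotopyGroup.mul_spec (i := 0)

/-! ### The second homotopy group of the complex of three discs -/

/-- The triples of integers with sum zero. -/
def zeroSum : AddSubgroup (ZMod 3 → ℤ) where
  carrier := {a | a 0 + a 1 + a 2 = 0}
  zero_mem' := rfl
  add_mem' {a b} ha hb := by
    change a 0 + b 0 + (a 1 + b 1) + (a 2 + b 2) = 0
    change a 0 + a 1 + a 2 = 0 at ha
    change b 0 + b 1 + b 2 = 0 at hb
    lia
  neg_mem' {a} ha := by
    change -a 0 + -a 1 + -a 2 = 0
    change a 0 + a 1 + a 2 = 0 at ha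
    lia

theorem sum_shift (a : ZMod 3 → ℤ) (g : ZMod 3) :
    a (0 - g) + a (1 - g) + a (2 - g) = a 0 + a 1 + a 2 := by
  obtain rfl | rfl | rfl : g = 0 ∨ g = 1 ∨ g = 2 := by revert g; decide
  · simp
  · change a 2 + a 0 + a 1 = _
    lia
  · change a 1 + a 2 + a 0 = _
    lia

/-- The permutation action on the triples with sum zero. -/
def shiftRep : Representation ℤ Z3 zeroSum where
  toFun g := AddMonoidHom.toIntLinearMap
    { toFun := fun a => ⟨fun i => a.1 (i - Multiplicative.toAdd g),
        (sum_shift a.1 (Multiplicative.toAdd g)).trans a.2⟩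
      map_zero' := rfl
      map_add' := fun a b => rfl }
  map_one' := by
    refine LinearMap.ext fun a => Subtype.ext (funext fun i => ?_)
    change a.1 (i - 0) = a.1 i
    rw [sub_zero]
  map_mul' g h := by
    refine LinearMap.ext fun a => Subtype.ext (funext fun i => ?_)
    change a.1 (i - (Multiplicative.toAdd g + Multiplicative.toAdd h)) =
      a.1 (i - Multiplicative.toAdd g - Multiplicative.toAdd h)
    rw [sub_sub]

theorem shiftRep_apply (g : Z3) (a : zeroSum) (i : ZMod 3) :
    (shiftRep g a).1 i = a.1 (i - Multiplicative.toAdd g) := rfl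

theorem zeroSum_ext {a b : zeroSum} (h0 : a.1 0 = b.1 0) (h1 : a.1 1 = b.1 1) : a = b := by
  have ha : a.1 0 + a.1 1 + a.1 2 = 0 := a.2
  have hb : b.1 0 + b.1 1 + b.1 2 = 0 := b.2
  have h2 : a.1 2 = b.1 2 := by lia
  refine Subtype.ext (funext fun i => ?_)
  obtain rfl | rfl | rfl : i = 0 ∨ i = 1 ∨ i = 2 := by clear * -; revert i; decide
  exacts [h0, h1, h2]

/-- The coinvariants of the permutation action. -/
def coinvariant : zeroSum →+ ZMod 3 where
  -- The sum of `i * a i` modulo `3`: a cyclic shift changes it by the sum of the `a i`, which is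
  -- zero.
  toFun a := ((a.1 1 + 2 * a.1 2 : ℤ) : ZMod 3)
  map_zero' := rfl
  map_add' a b := by
    change ((a.1 1 + b.1 1 + 2 * (a.1 2 + b.1 2) : ℤ) : ZMod 3) = _
    push_cast
    ring

theorem coinvariant_surjective : Function.Surjective coinvariant := fun m => by
  obtain ⟨m, rfl⟩ := ZMod.intCast_surjective m
  refine ⟨⟨fun i => if i = 0 then -m else if i = 1 then m else 0, ?_⟩, ?_⟩
  · change -m + m + 0 = 0
    lia
  · change ((m + 2 * 0 : ℤ) : ZMod 3) = m
    simp

theorem coinvariant_eq_zero (a : zeroSum) :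
    coinvariant a = 0 ↔ ∃ b, shiftRep genZ3 b - b = a := by
  have ha : a.1 0 + a.1 1 + a.1 2 = 0 := a.2
  change ((a.1 1 + 2 * a.1 2 : ℤ) : ZMod 3) = 0 ↔ _
  rw [ZMod.intCast_zmod_eq_zero_iff_dvd]
  constructor
  · rintro ⟨k, hk⟩
    -- The equations determine `b` up to its entry `x` at `0`, and the sum of `b` is `3 x - 2 a₁ -
    -- a₂`. With `a₁ + 2 a₂ = 3 k` this vanishes for `x = 2 k - a₂`.
    let x : ℤ := 2 * k - a.1 2
    refine ⟨⟨fun i => if i = 0 then x else if i = 1 then x - a.1 1 else x - a.1 1 - a.1 2, ?_⟩,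
      zeroSum_ext ?_ ?_⟩
    · change x + (x - a.1 1) + (x - a.1 1 - a.1 2) = 0
      push_cast at hk
      lia
    · change x - a.1 1 - a.1 2 - x = a.1 0
      lia
    · change x - (x - a.1 1) = a.1 1
      lia
  · rintro ⟨b, rfl⟩
    have hb : b.1 0 + b.1 1 + b.1 2 = 0 := b.2
    change ((3 : ℕ) : ℤ) ∣ b.1 0 - b.1 1 + 2 * (b.1 1 - b.1 2)
    exact ⟨-b.1 2, by push_cast; lia⟩

theorem eq_zero_of_shiftRep_eq (a : zeroSum) (h : shiftRep genZ3 a = a) : a = 0 := by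
  have ha : a.1 0 + a.1 1 + a.1 2 = 0 := a.2
  have h0 : a.1 2 = a.1 0 := congrFun (congrArg Subtype.val h) 0
  have h1 : a.1 0 = a.1 1 := congrFun (congrArg Subtype.val h) 1
  refine zeroSum_ext ?_ ?_
  · change a.1 0 = 0
    lia
  · change a.1 1 = 0
    lia

namespace Y2

theorem exists_deg_loop (i : ZMod 3) (γ : Ω^ (Fin 2) Y2 Y2.base) : ∃ a, Deg i γ a := by
  obtain ⟨a, ha⟩ := exists_deg i (F := fun x => γ x.2) (γ.1.continuous.comp continuous_snd)
    fun s b hb b' hb' => (γ.2 b hb).trans (γ.2 b' hb').symm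
  exact ⟨a, ha 0⟩

theorem Deg.of_freelyHomotopic {i : ZMod 3} {γ δ : (Fin 2 → I) → Y2} {a : ℤ} (h : Deg i γ a)
    (hγδ : FreelyHomotopic γ δ) : Deg i δ a := by
  obtain ⟨F, h0, h1, hF⟩ := hγδ
  obtain ⟨b, hb⟩ := exists_deg i F.continuous hF
  have hb0 := hb 0
  have hb1 := hb 1
  rw [funext h0] at hb0
  rw [funext h1] at hb1
  rwa [h.unique hb0]

/-- The degree as a function of the homotopy class. -/
noncomputable def degPi (i : ZMod 3) : π_ 2 Y2 Y2.base → ℤ :=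
  Quotient.lift (fun γ => (exists_deg_loop i γ).choose) fun γ δ h =>
    ((exists_deg_loop i γ).choose_spec.of_freelyHomotopic (.of_homotopic h)).unique
      (exists_deg_loop i δ).choose_spec

theorem degPi_eq {i : ZMod 3} {γ : Ω^ (Fin 2) Y2 Y2.base} {a : ℤ} :
    degPi i (piClass γ) = a ↔ Deg i γ a := by
  have h : Deg i γ (degPi i (piClass γ)) := (exists_deg_loop i γ).choose_spec
  exact ⟨fun h' => h' ▸ h, fun h' => h.unique h'⟩

/-- The degree as a homomorphism. -/
noncomputable def degHom (i : ZMod 3) : Additive (π_ 2 Y2 Y2.base) →+ ℤ :=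
  AddMonoidHom.mk' (fun x => degPi i x.toMul) fun x y => by
    obtain ⟨γ, hγ⟩ := piClass_surjective x.toMul
    obtain ⟨δ, hδ⟩ := piClass_surjective y.toMul
    rw [toMul_add, ← hγ, ← hδ, add_comm]
    exact (congrArg (degPi i) (piClass_mul γ δ)).trans
      (degPi_eq.2 ((degPi_eq.1 rfl).transAt (degPi_eq.1 rfl)))

theorem degHom_eq {i : ZMod 3} {γ : Ω^ (Fin 2) Y2 Y2.base} {a : ℤ} :
    degHom i (.ofMul (piClass γ)) = a ↔ Deg i γ a := degPi_eq

theorem eq_zero_of_degHom (x : Additive (π_ 2 Y2 Y2.base)) (h0 : degHom 0 x = 0)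
    (h1 : degHom 1 x = 0) : x = 0 := by
  obtain ⟨γ, rfl⟩ := piClass_surjective x
  exact piClass_eq_iff.2 (homotopic_const (degHom_eq.1 h0) (degHom_eq.1 h1))

/-- Two spheres that meet in a disc. -/
theorem exists_basis : ∃ x y : Additive (π_ 2 Y2 Y2.base),
    (degHom 0 x = 1 ∧ degHom 1 x = -1 ∧ degHom 2 x = 0) ∧
      degHom 0 y = 0 ∧ degHom 1 y = 1 ∧ degHom 2 y = -1 := by
  obtain ⟨γ, h0, h1, h2⟩ := exists_generator 0
  obtain ⟨δ, h3, h4, h5⟩ := exists_generator 1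
  exact ⟨.ofMul (piClass γ), .ofMul (piClass δ), ⟨degHom_eq.2 h0, degHom_eq.2 h1, degHom_eq.2 h2⟩,
    degHom_eq.2 h5, degHom_eq.2 h3, degHom_eq.2 h4⟩

/-- The second homotopy group of the complex of three discs. -/
theorem exists_equiv : ∃ e : Additive (π_ 2 Y2 Y2.base) ≃+ zeroSum,
    ∀ x i, (e x).1 i = degHom i x := by
  obtain ⟨x, y, ⟨x0, x1, x2⟩, y0, y1, y2⟩ := exists_basis
  -- The degrees over two discs detect zero, so the two explicit spheres generate. That the three
  -- degrees always add up to zero is then read off from these generators.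
  have key : ∀ w, w = degHom 0 w • x + (degHom 0 w + degHom 1 w) • y := fun w => by
    refine sub_eq_zero.1 (eq_zero_of_degHom _ ?_ ?_)
    · simp [x0, y0]
    · simp [x1, y1]
  have hsum : ∀ w, (fun i => degHom i w) ∈ zeroSum := fun w => by
    have := congrArg (degHom 2) (key w)
    simp only [map_add, map_zsmul, x2, y2, smul_eq_mul] at this
    change degHom 0 w + degHom 1 w + degHom 2 w = 0
    lia
  let f : Additive (π_ 2 Y2 Y2.base) →+ zeroSum :=
    AddMonoidHom.mk' (fun w => ⟨fun i => degHom i w, hsum w⟩) fun w w' =>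
      Subtype.ext (funext fun i => map_add (degHom i) w w')
  refine ⟨AddEquiv.ofBijective f ⟨?_, fun a => ⟨a.1 0 • x + (a.1 0 + a.1 1) • y, ?_⟩⟩,
    fun w i => rfl⟩
  · rw [injective_iff_map_eq_zero]
    intro w hw
    exact eq_zero_of_degHom w (congrFun (congrArg Subtype.val hw) 0)
      (congrFun (congrArg Subtype.val hw) 1)
  · refine zeroSum_ext ?_ ?_
    · change degHom 0 _ = _
      simp [x0, y0]
    · change degHom 1 _ = _
      simp [x1, y1]

/-- Free homotopy classes of spheres are classified by the degrees. -/
theorem freelyHomotopic_smul_iff (g : Z3) (γ δ : Ω^ (Fin 2) Y2 Y2.base) :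
    FreelyHomotopic (fun t => g • γ t) δ ↔ ∀ i, degHom i (.ofMul (piClass δ)) =
      degHom (i - Multiplicative.toAdd g) (.ofMul (piClass γ)) := by
  have h1 : ∀ δ : Ω^ (Fin 2) Y2 Y2.base, FreelyHomotopic (fun t => g • γ t) δ → ∀ i,
      degHom i (.ofMul (piClass δ)) =
        degHom (i - Multiplicative.toAdd g) (.ofMul (piClass γ)) := fun δ h i => by
    have h2 : Deg (i - Multiplicative.toAdd g) γ _ := degHom_eq.1 rfl
    have h3 := (h2.smul g).of_freelyHomotopic h
    rw [add_sub_cancel] at h3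
    exact degHom_eq.2 h3
  refine ⟨h1 δ, fun h => ?_⟩
  -- Some based sphere is freely homotopic to the translate of `γ`. Having the same degrees as `δ`,
  -- it is homotopic to `δ`.
  obtain ⟨δ', hδ'⟩ := exists_loop_freelyHomotopic g γ
  have h2 := h1 δ' hδ'
  refine hδ'.trans (.of_homotopic (piClass_eq_iff.1 ?_))
  have h3 : Additive.ofMul (piClass δ') - Additive.ofMul (piClass δ) = 0 :=
    eq_zero_of_degHom _ (by rw [map_sub, h2, h, sub_self]) (by rw [map_sub, h2, h, sub_self])
  exact Additive.ofMul.injective (sub_eq_zero.1 h3)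

end Y2

/-! ### The second homotopy group of the union with its action -/

namespace P2

variable (c : P2Choice)

theorem mapSphere_transAt (γ δ : Ω^ (Fin 2) Y2 Y2.base) :
    mapSphere c (GenLoop.transAt 0 γ δ) = GenLoop.transAt 0 (mapSphere c γ) (mapSphere c δ) :=
  GenLoop.ext _ _ fun _ => apply_ite (ofY2 c) _ _ _

/-- The homomorphism of second homotopy groups induced by the inclusion. -/
noncomputable def mapPi : Additive (π_ 2 Y2 Y2.base) →+ Additive (π_ 2 (P2 c) (P2 c).base) :=
  AddMonoidHom.mk' (fun x => .ofMul (Quotient.map (mapSphere c) (fun _ _ h =>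
    ContinuousMap.HomotopicRel.comp_continuousMap h (ofY2 c)) x.toMul)) fun x y => by
    obtain ⟨γ, hγ⟩ := piClass_surjective x.toMul
    obtain ⟨δ, hδ⟩ := piClass_surjective y.toMul
    rw [toMul_add, ← hγ, ← hδ]
    refine congrArg Additive.ofMul ?_
    rw [piClass_mul γ δ]
    exact (congrArg piClass (mapSphere_transAt c δ γ)).trans (piClass_mul _ _).symm

/-- A null-homotopy in the union compresses only to a free null-homotopy in `Y₂`; this suffices,
because degrees are invariant under free homotopy and detect zero. Surjectivity is the compression
of a single sphere. -/
theorem mapPi_bijective : Function.Bijective (mapPi c) := by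
  constructor
  · rw [injective_iff_map_eq_zero]
    intro x hx
    obtain ⟨γ, rfl⟩ := piClass_surjective x
    have h1 : GenLoop.Homotopic (mapSphere c γ) (mapSphere c GenLoop.const) := piClass_eq_iff.1 hx
    have h2 : FreelyHomotopic γ (GenLoop.const : Ω^ (Fin 2) Y2 Y2.base) :=
      (freelyHomotopic_iff c).1 (.of_homotopic h1)
    have h3 : ∀ i, Y2.degHom i (.ofMul (piClass γ)) = 0 := fun i => by
      refine Y2.degHom_eq.2 (Y2.Deg.of_freelyHomotopic (Y2.degHom_eq.1 ?_) h2.symm)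
      exact map_zero (Y2.degHom i)
    exact Y2.eq_zero_of_degHom _ (h3 0) (h3 1)
  · intro x
    obtain ⟨γ, rfl⟩ := piClass_surjective x
    obtain ⟨γ', h⟩ := exists_homotopic_mapSphere c γ
    exact ⟨.ofMul (piClass γ'), (piClass_eq_iff.2 h).symm⟩

theorem exists_equiv : ∃ e : Additive (π_ 2 (P2 c) (P2 c).base) ≃+ zeroSum,
    ∀ (g : Z3) (γ δ : Ω^ (Fin 2) (P2 c) (P2 c).base),
      shiftRep g (e (.ofMul (piClass γ))) = e (.ofMul (piClass δ)) ↔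
        FreelyHomotopic (fun t => g • γ t) δ := by
  obtain ⟨e, he⟩ := Y2.exists_equiv
  refine ⟨(AddEquiv.ofBijective (mapPi c) (mapPi_bijective c)).symm.trans e, fun g γ δ => ?_⟩
  obtain ⟨γ', hγ⟩ := exists_homotopic_mapSphere c γ
  obtain ⟨δ', hδ⟩ := exists_homotopic_mapSphere c δ
  have key : ∀ {γ : Ω^ (Fin 2) (P2 c) (P2 c).base} {γ'}, GenLoop.Homotopic γ (mapSphere c γ') →
      ((AddEquiv.ofBijective (mapPi c) (mapPi_bijective c)).symm.trans e) (.ofMul (piClass γ)) =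
        e (.ofMul (piClass γ')) := fun {γ γ'} h => by
    rw [AddEquiv.trans_apply]
    congr 1
    rw [AddEquiv.symm_apply_eq]
    exact congrArg Additive.ofMul (piClass_eq_iff.2 h)
  rw [key hγ, key hδ]
  -- All spheres can be deformed into `Y₂`, compatibly with the action, and free homotopies between
  -- spheres of `Y₂` can be compressed.
  have h1 : FreelyHomotopic (fun t => g • γ t) δ ↔ FreelyHomotopic (fun t => g • γ' t) δ' := by
    have e1 : FreelyHomotopic (fun t => g • γ t) (fun t => ofY2 c (g • γ' t)) :=
      (FreelyHomotopic.of_homotopic hγ).map (continuous_const_smul g)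
    have e2 : FreelyHomotopic δ (fun t => ofY2 c (δ' t)) := .of_homotopic hδ
    rw [← freelyHomotopic_iff c]
    exact ⟨fun h => (e1.symm.trans h).trans e2, fun h => (e1.trans h).trans e2.symm⟩
  rw [h1, Y2.freelyHomotopic_smul_iff, Subtype.ext_iff, funext_iff]
  refine forall_congr' fun i => ?_
  rw [shiftRep_apply, he, he, eq_comm]

end P2

/-! ### The induced action and the Bredon cohomology -/

theorem mainTheorem4 (c : P2Choice) :
    ∃ ρ : Representation ℤ Z3 (Additive (π_ 2 (P2 c) (P2 c).base)),
      (∀ ρ', IsInducedAction (P2 c) ρ' ↔ ρ' = ρ) ∧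
      ∀ n d : ℕ, 1 ≤ n → 1 ≤ d →
        Nonempty ((torusCW n).BredonCohomology ρ d ≃+
          (Fin ((n - 1).choose (d - 1)) → ZMod 3)) := by
  obtain ⟨e, he⟩ := P2.exists_equiv c
  -- The cyclic permutation of the degrees, transported to the homotopy group.
  let ρ : Representation ℤ Z3 (Additive (π_ 2 (P2 c) (P2 c).base)) :=
    { toFun := fun g => e.symm.toAddMonoidHom.toIntLinearMap ∘ₗ shiftRep g ∘ₗ
        e.toAddMonoidHom.toIntLinearMap
      map_one' := by
        refine LinearMap.ext fun x => ?_
        change e.symm (shiftRep 1 (e x)) = x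
        rw [map_one, Module.End.one_apply, e.symm_apply_apply]
      map_mul' := fun g h => by
        refine LinearMap.ext fun x => ?_
        change e.symm (shiftRep (g * h) (e x)) = e.symm (shiftRep g (e (e.symm (shiftRep h (e x)))))
        rw [map_mul, Module.End.mul_apply, e.apply_symm_apply] }
  have hρ : ∀ g x, ρ g x = e.symm (shiftRep g (e x)) := fun g x => rfl
  have hind : IsInducedAction (P2 c) ρ := fun g γ δ => by
    rw [hρ, e.symm_apply_eq, he]
  refine ⟨ρ, fun ρ' => ⟨fun h => ?_, fun h => h ▸ hind⟩, fun n d hn hd => ?_⟩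
  · refine MonoidHom.ext fun g => LinearMap.ext fun x => ?_
    obtain ⟨γ, rfl⟩ := piClass_surjective x
    obtain ⟨δ, hδ⟩ := piClass_surjective (ρ g (.ofMul (piClass γ))).toMul
    -- Each value of `ρ` is the class of some sphere `δ`, and the criterion of free homotopy forces
    -- any other induced action to take the same value.
    have h1 : ρ g (.ofMul (piClass γ)) = .ofMul (piClass δ) := congrArg Additive.ofMul hδ.symm
    exact ((h g γ δ).2 ((hind g γ δ).1 h1)).trans h1.symm
  · obtain ⟨n, rfl⟩ := Nat.exists_eq_add_of_le' hn
    obtain ⟨d, rfl⟩ := Nat.exists_eq_add_of_le' hd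
    -- The two facts about the coefficients that matter: the generator fixes only zero, and the
    -- coinvariants are `ℤ/3`.
    refine nonempty_bredon_equiv ρ (coinvariant.comp e.toAddMonoidHom) (fun x hx => ?_)
      (coinvariant_surjective.comp e.surjective) (fun x => ?_) n d
    · rw [hρ, e.symm_apply_eq] at hx
      exact (map_eq_zero_iff e e.injective).1 (eq_zero_of_shiftRep_eq _ hx)
    · refine (coinvariant_eq_zero (e x)).trans ⟨fun ⟨b, hb⟩ => ⟨e.symm b, ?_⟩,
        fun ⟨w, hw⟩ => ⟨e w, ?_⟩⟩
      · rw [hρ, e.apply_symm_apply, ← map_sub, hb, e.symm_apply_apply]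
      · rw [← hw, map_sub, hρ, e.apply_symm_apply]
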